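/- For integers $k, n \ge 0$ let $d_k(n)$ denote the number of $k$-elongated plane partition diamonds of $n$, that is, the coefficients defined by the identity of formal power series $$\sum_{n=0}^{\infty} d_k(n)\,q^n = \prod_{m=1}^{\infty}\frac{(1-q^{2m})^k}{(1-q^m)^{3k+1}}.$$ Let $n, \alpha \ge 1$ be integers such that $4n\equiv 1 \pmod{5^{\alpha}}$. Then $$d_5(n)\equiv 0 \pmod{5^{\lfloor \alpha/2\rfloor+1}}.$$ -/

import Mathlib

open scoped PowerSeries.WithPiTopology

/-- The inverse `1 / (1 - q^(m+1))` in the ring of formal power series with integer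
coefficients. -/
noncomputable def invOneSubPow (m : ℕ) : PowerSeries ℤ :=
  PowerSeries.invOfUnit (1 - PowerSeries.X ^ (m + 1)) 1

theorem one_sub_pow_mul_invOneSubPow (m : ℕ) :
    (1 - PowerSeries.X ^ (m + 1)) * invOneSubPow m = 1 :=
  PowerSeries.mul_invOfUnit _ _ (by simp)

/-- The factor `(1 - q^(2(m+1)))^k / (1 - q^(m+1))^(3k+1)` of the generating function; the index
`m = 0, 1, 2, …` is shifted by one against the usual product over positive integers. -/
noncomputable def diamondFactor (k m : ℕ) : PowerSeries ℤ :=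
  (1 - PowerSeries.X ^ (2 * (m + 1))) ^ k * invOneSubPow m ^ (3 * k + 1)

/-- The generating function `D_k(q) = ∏_{m ≥ 1} (1 - q^(2m))^k / (1 - q^m)^(3k+1)`, as a formal
power series over `ℤ` (the infinite product is the limit coefficient by coefficient, `ℤ` being
discrete; it converges by `multipliable_diamondFactor`). -/
noncomputable def diamondSeries (k : ℕ) : PowerSeries ℤ :=
  ∏' m : ℕ, diamondFactor k m

/-- The number `d_k(n)` of `k`-elongated plane partition diamonds: the coefficient of `q^n` in
`D_k(q)`. -/
noncomputable def diamondCount (k n : ℕ) : ℤ :=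
  PowerSeries.coeff n (diamondSeries k)

/-- The infinite product defining the generating function converges. -/
theorem multipliable_diamondFactor (k : ℕ) : Multipliable (diamondFactor k) := by
  have key : ∀ f : ℕ → PowerSeries ℤ, (∀ m, ((m + 1 : ℕ) : ℕ∞) ≤ (f m).order) →
      Multipliable (fun m => 1 + f m) := by
    intro f hf
    apply PowerSeries.WithPiTopology.multipliable_one_add_of_tendsto_order_atTop_nhds_top
    refine ENat.tendsto_nhds_top_iff_natCast_lt.mpr
      (fun n => Filter.eventually_atTop.mpr ⟨n, fun m hm => lt_of_lt_of_le ?_ (hf m)⟩)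
    exact_mod_cast Nat.lt_succ_of_le hm
  have hpow : ∀ (f : ℕ → PowerSeries ℤ), Multipliable f → ∀ j : ℕ,
      Multipliable (fun m => f m ^ j) := by
    intro f hf j
    induction j with
    | zero => simp
    | succ j ih => simpa only [pow_succ] using ih.mul hf
  have h1 : Multipliable (fun m : ℕ => (1 : PowerSeries ℤ) - PowerSeries.X ^ (2 * (m + 1))) := by
    simp_rw [sub_eq_add_neg]
    apply key
    intro m
    rw [PowerSeries.order_neg, PowerSeries.order_X_pow]
    exact_mod_cast (by omega : m + 1 ≤ 2 * (m + 1))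
  have h2 : Multipliable invOneSubPow := by
    have h : invOneSubPow = fun m => 1 + PowerSeries.X ^ (m + 1) * invOneSubPow m := by
      funext m
      linear_combination one_sub_pow_mul_invOneSubPow m
    rw [h]
    apply key
    intro m
    refine le_trans ?_ (PowerSeries.le_order_mul _ _)
    rw [PowerSeries.order_X_pow]
    exact le_self_add
  exact (hpow _ h1 k).mul (hpow _ h2 (3 * k + 1))

/-! ### Formal power series: Euler's product, Gauss's triangular series and the identity linking
them. -/

namespace ElongatedDiamond

open PowerSeries

section PowerSeriesIdentities

variable {R : Type*} [CommRing R]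

/-! Write E(q) for Euler's product, ψ(q) for Gauss's series, σ for q ↦ q⁵, U for the operator
keeping the coefficients of index divisible by 5, and D = E(q²)⁵/E(q)¹⁶ for the generating function.
Put x = qψ(q⁵)²/ψ(q)², y = (1 - 5x)/(1 - x), κ = x/y⁵, P = E(q)/(qE(q²⁵)), φ = P(q)²/P(q²). The
engine is q⁶D = κ·σ(κ)·φ·σσ(D) (`qvar_pow_six_mul_diamond`). Since U(σ(f)g) = f·U(g), sieving D
twice by U gives D back times a multiplier: with W(f) = U(φf), the multipliers arise from 1 by
applying f ↦ W(κf) and f ↦ U(κf) alternately (`coeff_multiplier_mul_diamond`). It remains to gain a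
factor 5 at the first W-step and at every U-step (`exists_evenMultiplier`).

The algebra rests on 5-dissections. Let Ψ = ψ(q)/(q³ψ(q²⁵)), so that xσ(x)Ψ² = 1. Then Ψ = 1 + a + b
and P = α - 1 + β, with terms in separate residue classes. Comparing classes in ΨP = P(q²)²
expresses all parts through two series u, c with u⁵ rational in c. The norm of ψ over the fifth
roots of unity then identifies σ(x) as a rational function of c (`exists_parametrization`). This
gives the values of U and W on x⁰, …, x⁻⁴, the degree five `modular_equation` for x over σ(x), and
yσ(y) = φ² (`mobius_mul_sig`).

The modular equation turns these values into recurrences for U(xⁿ) and W(xⁿ) in ℤ[x], whose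
coefficients carry enough powers of 5 to bound the results 5-adically from below. Every multiplier
after the first keeps a factor (1 - x)x, because (1 - x)⁵ is divisible by σ(1 - x) in ℤ[σ(x)][x].
The denominator (1 - 5x)⁵ of κ makes the multipliers infinite series in x, so the bounds are carried
by limits of polynomials (`IsLimit`). The bounds ⌈r/10⌉ and ⌈(r - 3)/10⌉ on the coefficient of xʳ
reproduce each other under the two operators. -/

theorem eq_of_forall_X_pow_dvd_sub {f g : R⟦X⟧} (h : ∀ N : ℕ, X ^ N ∣ f - g) : f = g := by
  ext n
  have := X_pow_dvd_iff.mp (h (n + 1)) n n.lt_succ_self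
  rwa [map_sub, sub_eq_zero] at this

variable (R) in
/-- The Euler product truncated after `M` factors agrees with the pentagonal series to any
prescribed order once `M` is large. -/
theorem exists_X_pow_dvd_pentagonalSeries_sub_prod (N : ℕ) :
    ∃ M₀, ∀ M ≥ M₀,
      X ^ N ∣ pentagonalSeries R - ∏ i ∈ Finset.range M, (1 - X ^ (i + 1) : R⟦X⟧) := by
  have h : ∀ᶠ s : Finset ℕ in Filter.atTop, ∀ n ∈ Finset.range N,
      (∏ i ∈ s, (1 - X ^ (i + 1) : R⟦X⟧)).coeff n = (pentagonalSeries R).coeff n :=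
    (Filter.eventually_all_finset _).mpr fun n _ => coeff_prod_one_sub_X_pow_eventually_eq R n
  obtain ⟨M₀, hM₀⟩ := Filter.eventually_atTop.mp (Filter.tendsto_finset_range.eventually h)
  refine ⟨M₀, fun M hM => X_pow_dvd_iff.mpr fun n hn => ?_⟩
  rw [map_sub, hM₀ M hM n (Finset.mem_range.mpr hn), sub_self]

theorem X_pow_dvd_expand {N d : ℕ} (hd : d ≠ 0) {f : R⟦X⟧} (h : X ^ N ∣ f) :
    X ^ N ∣ expand d hd f := by
  obtain ⟨g, rfl⟩ := h
  rw [map_mul, map_pow, expand_X, ← pow_mul, mul_comm d, pow_mul]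
  exact (dvd_pow_self _ hd).mul_right _

theorem expand_prod_one_sub_X_pow {d : ℕ} (hd : d ≠ 0) (M : ℕ) :
    expand d hd (∏ i ∈ Finset.range M, (1 - X ^ (i + 1) : R⟦X⟧)) =
      ∏ i ∈ Finset.range M, (1 - X ^ (d * (i + 1))) := by
  simp [map_prod, ← pow_mul]

theorem map_pentagonalSeries {S : Type*} [CommRing S] (φ : R →+* S) :
    PowerSeries.map φ (pentagonalSeries R) = pentagonalSeries S := by
  ext n
  rw [coeff_map]
  by_cases h : n ∈ Set.range pentagonal
  · obtain ⟨k, rfl⟩ := h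
    simp
  · rw [coeff_pentagonalSeries_eq_zero R h, coeff_pentagonalSeries_eq_zero S h, map_zero]

theorem map_expand' {S : Type*} [CommRing S] (φ : R →+* S) {d : ℕ} (hd : d ≠ 0) (f : R⟦X⟧) :
    PowerSeries.map φ (expand d hd f) = expand d hd (PowerSeries.map φ f) := by
  ext n
  simp only [coeff_map, coeff_expand]
  split_ifs <;> simp

variable (R) in
theorem constantCoeff_pentagonalSeries : constantCoeff (pentagonalSeries R) = 1 := by
  have := coeff_pentagonalSeries_pentagonal R 0
  simpa [pentagonal_def] using this

/-! ### Gauss's triangular number series -/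

variable (R) in
open Classical in
/-- Gauss's series `∑ q^(s(s+1)/2)`. -/
noncomputable def triangularSeries : R⟦X⟧ :=
  .mk fun n => if ∃ s : ℕ, s * (s + 1) / 2 = n then 1 else 0

theorem triangle_succ (s : ℕ) : (s + 1) * (s + 1 + 1) / 2 = s * (s + 1) / 2 + (s + 1) := by
  have : (s + 1) * (s + 1 + 1) = s * (s + 1) + (s + 1) * 2 := by ring
  rw [this, Nat.add_mul_div_right _ _ two_pos]

theorem triangle_strictMono : StrictMono fun s : ℕ => s * (s + 1) / 2 :=
  strictMono_nat_of_lt_succ fun s => by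
    rw [triangle_succ]
    omega

theorem X_pow_dvd_triangularSeries_sub_sum (M : ℕ) :
    X ^ M ∣ triangularSeries R - ∑ s ∈ Finset.range M, (X : R⟦X⟧) ^ (s * (s + 1) / 2) := by
  refine X_pow_dvd_iff.mpr fun n hn => ?_
  rw [map_sub, map_sum, sub_eq_zero, triangularSeries, coeff_mk]
  simp only [coeff_X_pow]
  split_ifs with h
  · obtain ⟨s, rfl⟩ := h
    have hs : s < M := lt_of_le_of_lt (triangle_strictMono.le_apply (x := s)) hn
    rw [Finset.sum_eq_single s]
    · simp
    · intro t _ hts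
      rw [if_neg fun h => hts (triangle_strictMono.injective h).symm]
    · exact fun h => absurd (Finset.mem_range.mpr hs) h
  · exact (Finset.sum_eq_zero fun s _ => if_neg fun hs => h ⟨s, hs.symm⟩).symm

/-- Shanks's finite form of Gauss's identity: with `P n = ∏_{s ≤ n} (1 - q^(2s)) / (1 - q^(2s-1))`,
`∑_{s < n} (P n / P s) q^(s(2n+1))` is the sum of the first `2n` triangular powers. -/
theorem sum_shanks [IsDomain R] (P Q : ℕ → R⟦X⟧) (hPQ : ∀ n, P n * Q n = 1)
    (hP : ∀ n, P (n + 1) * (1 - X ^ (2 * n + 1)) = P n * (1 - X ^ (2 * n + 2))) (n : ℕ) :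
    ∑ s ∈ Finset.range n, P n * Q s * X ^ (s * (2 * n + 1)) =
      ∑ t ∈ Finset.range (2 * n), X ^ (t * (t + 1) / 2) := by
  have hne : ∀ k : ℕ, (1 - X ^ (k + 1) : R⟦X⟧) ≠ 0 := fun k h => by
    have := congrArg constantCoeff h
    simp at this
  have hPne : ∀ n, P n ≠ 0 := fun n h => by simpa [h] using hPQ n
  have hQ : ∀ n, Q (n + 1) * (1 - X ^ (2 * n + 2)) = Q n * (1 - X ^ (2 * n + 1)) := fun n => by
    apply mul_left_cancel₀ (mul_ne_zero (hPne n) (hPne (n + 1)))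
    linear_combination (P n * (1 - X ^ (2 * n + 2))) * hPQ (n + 1) -
      (P (n + 1) * (1 - X ^ (2 * n + 1))) * hPQ n - hP n
  induction n with
  | zero => simp
  | succ n ih =>
    have htri : ∑ t ∈ Finset.range (2 * (n + 1)), (X : R⟦X⟧) ^ (t * (t + 1) / 2) =
        ∑ t ∈ Finset.range (2 * n), X ^ (t * (t + 1) / 2) +
          X ^ (n * (2 * n + 1)) * (1 + X ^ (2 * n + 1)) := by
      rw [mul_add, mul_one, Finset.sum_range_succ, Finset.sum_range_succ, triangle_succ,
        show 2 * n * (2 * n + 1) / 2 = n * (2 * n + 1) by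
          rw [mul_assoc]; exact Nat.mul_div_cancel_left _ two_pos]
      ring
    rw [htri, ← ih]
    apply mul_left_cancel₀ (hne (2 * n))
    -- The summands for n + 1 and n, scaled to a common factor, differ by a difference of
    -- consecutive values of P n · Q s · q^(s(2n+1)) · (1 - q^(2s)), so the sum telescopes.
    have htel : ∀ s, P n * (1 - X ^ (2 * n + 2)) * Q s * X ^ (s * (2 * (n + 1) + 1)) -
        (1 - X ^ (2 * n + 1)) * (P n * Q s * X ^ (s * (2 * n + 1))) =
        P n * Q (s + 1) * X ^ ((s + 1) * (2 * n + 1)) * (1 - X ^ (2 * (s + 1))) -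
          P n * Q s * X ^ (s * (2 * n + 1)) * (1 - X ^ (2 * s)) := fun s => by
      have := hQ s
      linear_combination (-P n * X ^ ((s + 1) * (2 * n + 1))) * hQ s
    have hsum := Finset.sum_range_sub
      (fun s => P n * Q s * X ^ (s * (2 * n + 1)) * (1 - X ^ (2 * s))) n
    rw [← Finset.sum_congr rfl fun s _ => htel s, Finset.sum_sub_distrib] at hsum
    rw [← Finset.mul_sum] at hsum
    simp only [mul_zero, pow_zero, sub_self, sub_zero, zero_mul] at hsum
    have h1 : (1 - X ^ (2 * n + 1)) *
        ∑ s ∈ Finset.range n, P (n + 1) * Q s * X ^ (s * (2 * (n + 1) + 1)) =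
        ∑ s ∈ Finset.range n,
          P n * (1 - X ^ (2 * n + 2)) * Q s * X ^ (s * (2 * (n + 1) + 1)) := by
      rw [Finset.mul_sum]
      refine Finset.sum_congr rfl fun s _ => ?_
      linear_combination (Q s * X ^ (s * (2 * (n + 1) + 1))) * hP n
    rw [Finset.sum_range_succ]
    linear_combination h1 + hsum + (Q n * X ^ (n * (2 * (n + 1) + 1))) * hP n +
      (X ^ (n * (2 * n + 1)) * (1 - X ^ (2 * n)) +
        (1 - X ^ (2 * n + 2)) * X ^ (n * (2 * (n + 1) + 1))) * hPQ n

theorem prod_range_two_mul (M : ℕ) :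
    ∏ i ∈ Finset.range (2 * M), (1 - X ^ (i + 1) : R⟦X⟧) =
      (∏ i ∈ Finset.range M, (1 - X ^ (2 * i + 1))) *
        ∏ i ∈ Finset.range M, (1 - X ^ (2 * (i + 1))) := by
  induction M with
  | zero => simp
  | succ M ih =>
    rw [mul_add, mul_one, Finset.prod_range_succ, Finset.prod_range_succ, ih,
      Finset.prod_range_succ _ M, Finset.prod_range_succ _ M]
    ring

/-- **Gauss's identity** `∑ q^(s(s+1)/2) = ∏ (1 - q^(2m))² / (1 - q^m)`. -/
theorem triangularSeries_mul_pentagonalSeries [IsDomain R] :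
    triangularSeries R * pentagonalSeries R = expand 2 two_ne_zero (pentagonalSeries R) ^ 2 := by
  choose I hI using fun k : ℕ => show ∃ g : R⟦X⟧, (1 - X ^ (k + 1)) * g = 1 from
    ⟨invOfUnit _ 1, mul_invOfUnit _ _ (by simp)⟩
  set P : ℕ → R⟦X⟧ := fun n => ∏ i ∈ Finset.range n, (1 - X ^ (2 * i + 2)) * I (2 * i) with hPdef
  set Q : ℕ → R⟦X⟧ := fun n => ∏ i ∈ Finset.range n, (1 - X ^ (2 * i + 1)) * I (2 * i + 1)
    with hQdef
  have hPQ : ∀ n, P n * Q n = 1 := fun n => by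
    rw [hPdef, hQdef, ← Finset.prod_mul_distrib]
    refine Finset.prod_eq_one fun i _ => ?_
    linear_combination ((1 - X ^ (2 * i + 1)) * I (2 * i)) * hI (2 * i + 1) + hI (2 * i)
  have hP : ∀ n, P (n + 1) * (1 - X ^ (2 * n + 1)) = P n * (1 - X ^ (2 * n + 2)) := fun n => by
    simp only [hPdef, Finset.prod_range_succ]
    linear_combination ((∏ i ∈ Finset.range n, (1 - X ^ (2 * i + 2)) * I (2 * i)) *
      (1 - X ^ (2 * n + 2))) * hI (2 * n)
  have hPprod : ∀ n, P n * ∏ i ∈ Finset.range n, (1 - X ^ (2 * i + 1)) =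
      ∏ i ∈ Finset.range n, (1 - X ^ (2 * (i + 1))) := fun n => by
    rw [hPdef, ← Finset.prod_mul_distrib]
    refine Finset.prod_congr rfl fun i _ => ?_
    linear_combination (1 - X ^ (2 * i + 2)) * hI (2 * i)
  refine eq_of_forall_X_pow_dvd_sub fun N => ?_
  obtain ⟨M₀, hM₀⟩ := exists_X_pow_dvd_pentagonalSeries_sub_prod R N
  set n := max M₀ (N + 1)
  have h1 := hM₀ (2 * n) (le_trans (le_max_left _ _) (Nat.le_mul_of_pos_left _ two_pos))
  have h2 := X_pow_dvd_expand two_ne_zero (hM₀ n (le_max_left _ _))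
  rw [map_sub, expand_prod_one_sub_X_pow] at h2
  have h3 : X ^ N ∣ triangularSeries R - P n := by
    have hN : N ≤ 2 * n := by have := le_max_right M₀ (N + 1); omega
    have ha := (pow_dvd_pow X hN).trans (X_pow_dvd_triangularSeries_sub_sum (R := R) (2 * n))
    rw [← sum_shanks P Q hPQ hP n] at ha
    obtain ⟨m, hm⟩ : ∃ m, n = m + 1 := ⟨n - 1, by have := le_max_right M₀ (N + 1); omega⟩
    -- Only the term s = 0, equal to P n, survives modulo q^N: the others carry at least q^(2n+1),
    -- and n > N.
    have hb : X ^ N ∣ ∑ s ∈ Finset.range n, P n * Q s * X ^ (s * (2 * n + 1)) - P n := by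
      rw [hm, Finset.sum_range_succ', ← hm]
      have hQ0 : Q 0 = 1 := by simp [hQdef]
      simp only [hQ0, zero_mul, pow_zero, mul_one, add_sub_cancel_right]
      refine Finset.dvd_sum fun s _ => Dvd.dvd.mul_left (pow_dvd_pow _ ?_) _
      nlinarith
    simpa using dvd_add ha hb
  have h4 := hPprod n
  rw [prod_range_two_mul] at h1
  set A := ∏ i ∈ Finset.range n, (1 - X ^ (2 * (i + 1)) : R⟦X⟧)
  set B := ∏ i ∈ Finset.range n, (1 - X ^ (2 * i + 1) : R⟦X⟧)
  have : triangularSeries R * pentagonalSeries R -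
      expand 2 two_ne_zero (pentagonalSeries R) ^ 2 =
      (triangularSeries R - P n) * pentagonalSeries R + P n * (pentagonalSeries R - B * A) -
      (expand 2 two_ne_zero (pentagonalSeries R) - A) *
        (expand 2 two_ne_zero (pentagonalSeries R) + A) := by
    linear_combination A * h4
  rw [this]
  exact dvd_sub (dvd_add (h3.mul_right _) (h1.mul_left _)) (h2.mul_right _)

end PowerSeriesIdentities

end ElongatedDiamond

/-! ### The generating function as a quotient of Euler products, and residue classes of exponents
modulo 5. -/

namespace ElongatedDiamond

open PowerSeries

theorem continuous_expand {d : ℕ} (hd : d ≠ 0) :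
    Continuous (expand d hd : ℤ⟦X⟧ → ℤ⟦X⟧) := by
  rw [continuous_iff_continuousAt]
  intro f
  rw [ContinuousAt, WithPiTopology.tendsto_iff_coeff_tendsto]
  intro n
  simp only [coeff_expand]
  split_ifs
  · exact (WithPiTopology.continuous_coeff ℤ (n / d)).continuousAt
  · exact tendsto_const_nhds

/-- The inverses cancel factor by factor, and an infinite product has a unique limit. -/
theorem diamondSeries_mul (k : ℕ) :
    diamondSeries k * pentagonalSeries ℤ ^ (3 * k + 1) =
      expand 2 two_ne_zero (pentagonalSeries ℤ) ^ k := by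
  have hE : HasProd (fun m => (1 - X ^ (m + 1) : ℤ⟦X⟧)) (pentagonalSeries ℤ) :=
    WithPiTopology.hasProd_one_sub_X_pow ℤ
  have hE2 := hE.map (expand 2 two_ne_zero : ℤ⟦X⟧ →ₐ[ℤ] ℤ⟦X⟧) (continuous_expand two_ne_zero)
  have h1 := hE.map (powMonoidHom (3 * k + 1)) (continuous_pow _)
  have h2 := hE2.map (powMonoidHom k) (continuous_pow _)
  have h3 := (multipliable_diamondFactor k).hasProd.mul h1
  refine h3.unique ?_
  convert h2 using 2 with m
  swap
  · rfl
  simp only [Function.comp_apply, powMonoidHom_apply, map_sub, map_one, map_pow, expand_X,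
    diamondFactor]
  rw [mul_assoc, ← mul_pow, mul_comm (invOneSubPow m), one_sub_pow_mul_invOneSubPow, one_pow,
    mul_one, ← pow_mul]

/-! ### Dissections modulo five -/

section Dissection

variable {R : Type*} [CommRing R]

/-- The part of a power series supported on exponents congruent to `r` modulo `5`. -/
noncomputable def residuePart (r : ℕ) (f : R⟦X⟧) : R⟦X⟧ :=
  .mk fun n => if n % 5 = r then coeff n f else 0

theorem coeff_residuePart (r n : ℕ) (f : R⟦X⟧) :
    coeff n (residuePart r f) = if n % 5 = r then coeff n f else 0 := coeff_mk _ _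

theorem pentagonal_mod_five (k : ℤ) : pentagonal k % 5 = 0 ∨ pentagonal k % 5 = 1 ∨
    pentagonal k % 5 = 2 := by
  have h := two_mul_natCast_pentagonal k
  have h5 : k % 5 = 0 ∨ k % 5 = 1 ∨ k % 5 = 2 ∨ k % 5 = 3 ∨ k % 5 = 4 := by omega
  have key : (2 * (pentagonal k : ℤ)) % 5 = ((k % 5) * (3 * (k % 5) - 1)) % 5 := by
    rw [h]
    exact (((Int.mod_modEq k 5).mul (((Int.mod_modEq k 5).mul_left 3).sub_right 1))).symm
  rcases h5 with h5 | h5 | h5 | h5 | h5 <;> rw [h5] at key <;> omega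

theorem pentagonal_mod_five_eq_one {k : ℤ} (hk : pentagonal k % 5 = 1) : ∃ j, k = 1 - 5 * j := by
  have h := two_mul_natCast_pentagonal k
  have h5 : k % 5 = 0 ∨ k % 5 = 1 ∨ k % 5 = 2 ∨ k % 5 = 3 ∨ k % 5 = 4 := by omega
  have key : (2 * (pentagonal k : ℤ)) % 5 = ((k % 5) * (3 * (k % 5) - 1)) % 5 := by
    rw [h]
    exact (((Int.mod_modEq k 5).mul (((Int.mod_modEq k 5).mul_left 3).sub_right 1))).symm
  refine ⟨(1 - k) / 5, ?_⟩
  rcases h5 with h5 | h5 | h5 | h5 | h5 <;> rw [h5] at key <;> omega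

/-- Indices k = 1 - 5j are exactly those in residue class 1, and they reproduce the pentagonal
numbers scaled by 25. With the sign change this makes -qE(q²⁵) the class 1 part of E. -/
theorem pentagonal_one_sub_five_mul (j : ℤ) : pentagonal (1 - 5 * j) = 25 * pentagonal j + 1 := by
  have h1 := two_mul_natCast_pentagonal (1 - 5 * j)
  have h2 := two_mul_natCast_pentagonal j
  zify
  linarith

variable (R) in
theorem coeff_pentagonalSeries_five_mul_add_one (n : ℕ) :
    coeff (5 * n + 1) (pentagonalSeries R) =
      -coeff n (expand 5 (by norm_num) (pentagonalSeries R)) := by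
  rw [coeff_expand]
  by_cases h : 5 * n + 1 ∈ Set.range pentagonal
  · obtain ⟨k, hk⟩ := h
    obtain ⟨j, rfl⟩ := pentagonal_mod_five_eq_one (k := k) (by omega)
    rw [← hk, coeff_pentagonalSeries_pentagonal]
    rw [pentagonal_one_sub_five_mul] at hk
    have hn : n = 5 * pentagonal j := by omega
    rw [hn, if_pos (dvd_mul_right _ _), Nat.mul_div_cancel_left _ (by norm_num),
      coeff_pentagonalSeries_pentagonal]
    have : Int.negOnePow (1 - 5 * j) = -Int.negOnePow j := by
      rw [show 1 - 5 * j = j + 1 - 2 * (3 * j) by ring, Int.negOnePow_sub, Int.negOnePow_succ,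
        Int.negOnePow_two_mul, mul_one]
    rw [this]
    simp
  · rw [coeff_pentagonalSeries_eq_zero R h]
    split_ifs with hd
    · obtain ⟨m, rfl⟩ := hd
      rw [Nat.mul_div_cancel_left _ (by norm_num), coeff_pentagonalSeries_eq_zero, neg_zero]
      rintro ⟨j, rfl⟩
      exact h ⟨1 - 5 * j, by rw [pentagonal_one_sub_five_mul]; ring⟩
    · simp

variable (R) in
theorem coeff_pentagonalSeries_of_mod_five {n : ℕ} (h : n % 5 = 3 ∨ n % 5 = 4) :
    coeff n (pentagonalSeries R) = 0 := by
  refine coeff_pentagonalSeries_eq_zero R ?_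
  rintro ⟨k, rfl⟩
  have := pentagonal_mod_five k
  omega

theorem two_mul_triangle (s : ℕ) : 2 * (s * (s + 1) / 2) = s * (s + 1) :=
  Nat.mul_div_cancel' (Nat.even_mul_succ_self s).two_dvd

theorem triangle_mod_five (s : ℕ) : (s * (s + 1) / 2 % 5 = 0 ∨ s * (s + 1) / 2 % 5 = 1) ∨
    (s * (s + 1) / 2 % 5 = 3 ∧ s % 5 = 2) := by
  have h := two_mul_triangle s
  have key : (2 * (s * (s + 1) / 2)) % 5 = ((s % 5) * (s % 5 + 1)) % 5 := by
    rw [h]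
    exact ((Nat.mod_modEq s 5).mul ((Nat.mod_modEq s 5).add_right 1)).symm
  have h5 : s % 5 = 0 ∨ s % 5 = 1 ∨ s % 5 = 2 ∨ s % 5 = 3 ∨ s % 5 = 4 := by omega
  rcases h5 with h5 | h5 | h5 | h5 | h5 <;> rw [h5] at key <;> omega

/-- The analogue for triangular numbers: class 3 comes only from s ≡ 2, so that part of ψ is
q³ψ(q²⁵). -/
theorem triangle_five_mul_add_two (t : ℕ) :
    (5 * t + 2) * (5 * t + 2 + 1) / 2 = 25 * (t * (t + 1) / 2) + 3 := by
  have h1 := two_mul_triangle (5 * t + 2)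
  have h2 := two_mul_triangle t
  nlinarith

variable (R) in
theorem coeff_triangularSeries_five_mul_add_three (n : ℕ) :
    coeff (5 * n + 3) (triangularSeries R) =
      coeff n (expand 5 (by norm_num) (triangularSeries R)) := by
  rw [coeff_expand]
  simp only [triangularSeries, coeff_mk]
  by_cases h : ∃ s : ℕ, s * (s + 1) / 2 = 5 * n + 3
  · rw [if_pos h]
    obtain ⟨s, hs⟩ := h
    obtain ⟨t, rfl⟩ : ∃ t, s = 5 * t + 2 := ⟨s / 5, by have := triangle_mod_five s; omega⟩
    rw [triangle_five_mul_add_two] at hs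
    have hn : n = 5 * (t * (t + 1) / 2) := by omega
    rw [hn, if_pos (dvd_mul_right _ _), Nat.mul_div_cancel_left _ (by norm_num), if_pos ⟨t, rfl⟩]
  · rw [if_neg h]
    split_ifs with hd ht
    · obtain ⟨m, rfl⟩ := hd
      rw [Nat.mul_div_cancel_left _ (by norm_num)] at ht
      obtain ⟨t, rfl⟩ := ht
      exact absurd ⟨5 * t + 2, by rw [triangle_five_mul_add_two]; ring⟩ h
    · rfl
    · rfl

variable (R) in
theorem coeff_triangularSeries_of_mod_five {n : ℕ} (h : n % 5 = 2 ∨ n % 5 = 4) :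
    coeff n (triangularSeries R) = 0 := by
  simp only [triangularSeries, coeff_mk]
  refine if_neg ?_
  rintro ⟨s, rfl⟩
  have := triangle_mod_five s
  omega

end Dissection

end ElongatedDiamond

/-! ### Norms over the fifth roots of unity. -/

namespace ElongatedDiamond

open PowerSeries

section Norm

variable {F : Type*} [Field F] {ζ : F}

/-- The product of the five conjugates `f(ζ^i q)`. -/
noncomputable def conjProd (ζ : F) : F⟦X⟧ →* F⟦X⟧ :=
  ∏ i ∈ Finset.range 5, (rescale (ζ ^ i) : F⟦X⟧ →+* F⟦X⟧).toMonoidHom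

theorem conjProd_apply (ζ : F) (f : F⟦X⟧) :
    conjProd ζ f = ∏ i ∈ Finset.range 5, rescale (ζ ^ i) f := by
  simp [conjProd, MonoidHom.finsetProd_apply]

theorem X_pow_dvd_rescale {N : ℕ} (a : F) {f : F⟦X⟧} (h : X ^ N ∣ f) : X ^ N ∣ rescale a f := by
  obtain ⟨g, rfl⟩ := h
  rw [map_mul, map_pow, rescale_X, mul_pow, mul_assoc]
  exact (dvd_mul_right _ _).mul_left _

theorem X_pow_dvd_prod_sub_prod {N : ℕ} (s : Finset ℕ) {f g : ℕ → F⟦X⟧}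
    (h : ∀ i, X ^ N ∣ f i - g i) : X ^ N ∣ ∏ i ∈ s, f i - ∏ i ∈ s, g i := by
  simp only [← Ideal.mem_span_singleton, ← Ideal.Quotient.eq_zero_iff_mem, map_sub, sub_eq_zero,
    map_prod] at h ⊢
  exact Finset.prod_congr rfl fun i _ => h i

theorem X_pow_dvd_conjProd_sub {N : ℕ} (ζ : F) {f g : F⟦X⟧} (h : X ^ N ∣ f - g) :
    X ^ N ∣ conjProd ζ f - conjProd ζ g := by
  simp only [conjProd_apply]
  refine X_pow_dvd_prod_sub_prod _ fun i => ?_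
  rw [← map_sub]
  exact X_pow_dvd_rescale _ h

theorem sum_pow_eq_zero (hζ : IsPrimitiveRoot ζ 5) : 1 + ζ + ζ ^ 2 + ζ ^ 3 + ζ ^ 4 = 0 := by
  have := hζ.geom_sum_eq_zero (by norm_num)
  simpa [Finset.sum_range_succ] using this

theorem prod_one_sub_C_pow_mul (hζ : IsPrimitiveRoot ζ 5) (Y : F⟦X⟧) :
    (1 - Y) * (1 - C ζ * Y) * (1 - C (ζ ^ 2) * Y) * (1 - C (ζ ^ 3) * Y) * (1 - C (ζ ^ 4) * Y) =
      1 - Y ^ 5 := by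
  have h1 : (1 + C ζ + C ζ ^ 2 + C ζ ^ 3 + C ζ ^ 4 : F⟦X⟧) = 0 := by
    have := congrArg (C : F →+* F⟦X⟧) (sum_pow_eq_zero hζ)
    simpa using this
  have h5 : (C ζ : F⟦X⟧) ^ 5 = 1 := by rw [← map_pow, hζ.pow_eq_one, map_one]
  simp only [map_pow]
  set z : F⟦X⟧ := C ζ
  have e4 : z ^ 4 = -(1 + z + z ^ 2 + z ^ 3) := by linear_combination h1
  ring_nf
  have e6 : z ^ 6 = z := by linear_combination z * h5
  have e7 : z ^ 7 = z ^ 2 := by linear_combination z ^ 2 * h5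
  have e8 : z ^ 8 = z ^ 3 := by linear_combination z ^ 3 * h5
  have e9 : z ^ 9 = z ^ 4 := by linear_combination z ^ 4 * h5
  have e10 : z ^ 10 = 1 := by linear_combination (z ^ 5 + 1) * h5
  simp only [e6, e7, e8, e9, e10, h5]
  linear_combination (-Y + 2 * Y ^ 2 - 2 * Y ^ 3 + Y ^ 4) * h1

theorem conjProd_one_sub_X_pow_of_dvd (hζ : IsPrimitiveRoot ζ 5) (m : ℕ) :
    conjProd ζ (1 - X ^ (5 * m)) = (1 - X ^ (5 * m)) ^ 5 := by
  have h : ∀ i : ℕ, rescale (ζ ^ i) (1 - X ^ (5 * m) : F⟦X⟧) = 1 - X ^ (5 * m) := fun i => by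
    rw [map_sub, map_one, map_pow, rescale_X, mul_pow, ← map_pow, ← pow_mul, ← mul_assoc,
      mul_comm i, mul_assoc, pow_mul, hζ.pow_eq_one, one_pow, map_one, one_mul]
  simp [conjProd_apply, h]

theorem conjProd_one_sub_X_pow_of_coprime (hζ : IsPrimitiveRoot ζ 5) {m : ℕ}
    (hm : Nat.Coprime m 5) : conjProd ζ (1 - X ^ m) = 1 - X ^ (5 * m) := by
  have h : ∀ i : ℕ, rescale (ζ ^ i) (1 - X ^ m : F⟦X⟧) = 1 - C ((ζ ^ m) ^ i) * X ^ m := fun i => by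
    rw [map_sub, map_one, map_pow, rescale_X, mul_pow, ← map_pow, ← pow_mul, ← pow_mul, mul_comm i]
  simp only [conjProd_apply, h, Finset.prod_range_succ, Finset.prod_range_zero, pow_zero, pow_one,
    map_one, one_mul]
  rw [prod_one_sub_C_pow_mul (hζ.pow_of_coprime m hm), ← pow_mul, mul_comm m]

/-- Of five consecutive factors, four have exponent m prime to 5 and norm 1 - q^(5m). The fifth is
its own conjugate, so its norm is its fifth power; the product over 25(i+1) compensates for it on
the left. -/
theorem conjProd_prod_one_sub_X_pow (hζ : IsPrimitiveRoot ζ 5) (M : ℕ) :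
    conjProd ζ (∏ i ∈ Finset.range (5 * M), (1 - X ^ (i + 1))) *
        ∏ i ∈ Finset.range M, (1 - X ^ (25 * (i + 1))) =
      (∏ i ∈ Finset.range (5 * M), (1 - X ^ (5 * (i + 1)))) *
        (∏ i ∈ Finset.range M, (1 - X ^ (5 * (i + 1)))) ^ 5 := by
  induction M with
  | zero => simp
  | succ M ih =>
    have hc : ∀ j, j = 1 ∨ j = 2 ∨ j = 3 ∨ j = 4 → Nat.Coprime (5 * M + j) 5 := fun j hj => by
      rw [Nat.coprime_comm, Nat.coprime_mul_left_add_right]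
      rcases hj with rfl | rfl | rfl | rfl <;> norm_num
    rw [mul_add, mul_one]
    simp only [Finset.prod_range_succ, map_mul]
    rw [conjProd_one_sub_X_pow_of_coprime hζ (hc 1 (by simp)),
      conjProd_one_sub_X_pow_of_coprime hζ (m := 5 * M + 1 + 1) (hc 2 (by simp)),
      conjProd_one_sub_X_pow_of_coprime hζ (m := 5 * M + 2 + 1) (hc 3 (by simp)),
      conjProd_one_sub_X_pow_of_coprime hζ (m := 5 * M + 3 + 1) (hc 4 (by simp)),
      show 5 * M + 4 + 1 = 5 * (M + 1) by ring, conjProd_one_sub_X_pow_of_dvd hζ]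
    have e : 25 * (M + 1) = 5 * (5 * (M + 1)) := by ring
    rw [e]
    linear_combination ((1 - X ^ (5 * (5 * M + 1))) * (1 - X ^ (5 * (5 * M + 1 + 1))) *
      (1 - X ^ (5 * (5 * M + 2 + 1))) * (1 - X ^ (5 * (5 * M + 3 + 1))) *
      (1 - X ^ (5 * (M + 1))) ^ 5 * (1 - X ^ (5 * (5 * (M + 1))))) * ih

theorem five_ne_zero' : (5 : ℕ) ≠ 0 := by norm_num

theorem twentyfive_ne_zero : (25 : ℕ) ≠ 0 := by norm_num

theorem conjProd_pentagonalSeries (hζ : IsPrimitiveRoot ζ 5) :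
    conjProd ζ (pentagonalSeries F) * expand 25 twentyfive_ne_zero (pentagonalSeries F) =
      expand 5 five_ne_zero' (pentagonalSeries F) ^ 6 := by
  refine eq_of_forall_X_pow_dvd_sub fun N => ?_
  obtain ⟨M, hM⟩ := exists_X_pow_dvd_pentagonalSeries_sub_prod F N
  have h1 := X_pow_dvd_conjProd_sub ζ (hM (5 * M) (by omega))
  have h2 := X_pow_dvd_expand twentyfive_ne_zero (hM M le_rfl)
  have h3 := X_pow_dvd_expand five_ne_zero' (hM (5 * M) (by omega))
  have h4 := X_pow_dvd_expand five_ne_zero' (hM M le_rfl)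
  rw [map_sub, expand_prod_one_sub_X_pow] at h2 h3 h4
  have key := congrArg (Ideal.Quotient.mk (Ideal.span {(X : F⟦X⟧) ^ N}))
    (conjProd_prod_one_sub_X_pow hζ M)
  simp only [← Ideal.mem_span_singleton, ← Ideal.Quotient.eq_zero_iff_mem, map_sub,
    sub_eq_zero] at h1 h2 h3 h4 ⊢
  rw [map_mul, map_mul, map_pow, ← h1, ← h2, ← h3, ← h4] at key
  rw [map_mul, key, map_pow]
  ring

theorem rescale_expand_two (a : F) (f : F⟦X⟧) :
    rescale a (expand 2 two_ne_zero f) = expand 2 two_ne_zero (rescale (a ^ 2) f) := by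
  ext n
  simp only [coeff_rescale, coeff_expand]
  split_ifs with h
  · obtain ⟨m, rfl⟩ := h
    rw [Nat.mul_div_cancel_left _ two_pos, pow_mul]
  · rw [mul_zero]

/-- Squaring permutes the fifth roots of unity. -/
theorem conjProd_expand_two (hζ : IsPrimitiveRoot ζ 5) (f : F⟦X⟧) :
    conjProd ζ (expand 2 two_ne_zero f) = expand 2 two_ne_zero (conjProd ζ f) := by
  have h5 := hζ.pow_eq_one
  have h6 : ζ ^ 6 = ζ := by linear_combination ζ * h5
  have h8 : ζ ^ 8 = ζ ^ 3 := by linear_combination ζ ^ 3 * h5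
  simp only [conjProd_apply, Finset.prod_range_succ, Finset.prod_range_zero, rescale_expand_two,
    map_mul, map_one, ← pow_mul]
  norm_num [h6, h8]
  ring

/-- The product of the conjugates of a five-term dissection with parts in residues `0, 1, 3`. -/
theorem prod_conj_trinomial (hζ : IsPrimitiveRoot ζ 5) (a b c : F⟦X⟧) :
    ∏ i ∈ Finset.range 5, (a + C (ζ ^ i) * b + C (ζ ^ i) ^ 3 * c) =
      a ^ 5 + b ^ 5 + c ^ 5 - 5 * a * b * c ^ 3 + 5 * a ^ 2 * b ^ 2 * c := by
  have h1 : (1 + C ζ + C ζ ^ 2 + C ζ ^ 3 + C ζ ^ 4 : F⟦X⟧) = 0 := by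
    have := congrArg (C : F →+* F⟦X⟧) (sum_pow_eq_zero hζ)
    simpa using this
  have h5 : (C ζ : F⟦X⟧) ^ 5 = 1 := by rw [← map_pow, hζ.pow_eq_one, map_one]
  simp only [Finset.prod_range_succ, Finset.prod_range_zero, map_pow, pow_zero, one_mul, pow_one]
  set z : F⟦X⟧ := C ζ
  have e6 : (z ^ 2) ^ 3 = z := by linear_combination z * h5
  have e9 : (z ^ 3) ^ 3 = z ^ 4 := by linear_combination z ^ 4 * h5
  have e12 : (z ^ 4) ^ 3 = z ^ 2 := by linear_combination (z ^ 7 + z ^ 2) * h5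
  rw [e6, e9, e12]
  -- Factors are paired by z ↔ z⁻¹. Both products then involve only g = z + z⁴ and z² + z³ = -1 - g,
  -- where g² = 1 - g.
  have m1 : (a + z * b + z ^ 3 * c) * (a + z ^ 4 * b + z ^ 2 * c) =
      a ^ 2 + b ^ 2 + c ^ 2 + (z + z ^ 4) * (a * b) + (z ^ 2 + z ^ 3) * (a * c + b * c) := by
    linear_combination (b ^ 2 + c ^ 2 + z ^ 2 * (b * c)) * h5
  have m2 : (a + z ^ 2 * b + z * c) * (a + z ^ 3 * b + z ^ 4 * c) =
      a ^ 2 + b ^ 2 + c ^ 2 + (z ^ 2 + z ^ 3) * (a * b) + (z + z ^ 4) * (a * c + b * c) := by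
    linear_combination (b ^ 2 + c ^ 2 + z * (b * c)) * h5
  have e : z ^ 4 = -(1 + z + z ^ 2 + z ^ 3) := by linear_combination h1
  have s : (z + z ^ 4) + (z ^ 2 + z ^ 3) = -1 := by linear_combination h1
  have p : (z + z ^ 4) * (z ^ 2 + z ^ 3) = -1 := by
    linear_combination h1 + (z + z ^ 2) * h5
  calc _ = (a + b + c) * ((a + z * b + z ^ 3 * c) * (a + z ^ 4 * b + z ^ 2 * c)) *
        ((a + z ^ 2 * b + z * c) * (a + z ^ 3 * b + z ^ 4 * c)) := by ring
    _ = _ := by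
      rw [m1, m2]
      generalize z + z ^ 4 = g at s p
      generalize z ^ 2 + z ^ 3 = g' at s p
      obtain rfl : g' = -1 - g := by linear_combination s
      have hg : g ^ 2 = 1 - g := by linear_combination -p
      ring_nf
      rw [hg]
      ring

theorem triangularSeries_ne_zero (R : Type*) [CommRing R] [Nontrivial R] :
    triangularSeries R ≠ 0 := fun h => by
  have := congrArg (coeff 0) h
  rw [triangularSeries, coeff_mk, if_pos ⟨0, rfl⟩] at this
  simp at this

theorem pentagonalSeries_ne_zero (R : Type*) [CommRing R] [Nontrivial R] :
    pentagonalSeries R ≠ 0 := fun h => by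
  have := constantCoeff_pentagonalSeries R
  simp [h] at this

theorem expand_ne_zero {R : Type*} [CommRing R] {d : ℕ} (hd : d ≠ 0) {f : R⟦X⟧} (hf : f ≠ 0) :
    expand d hd f ≠ 0 := fun h => hf <| by
  ext n
  rw [← coeff_expand_mul d hd, h, map_zero, map_zero]

theorem expand_expand {R : Type*} [CommRing R] {d e n : ℕ} (hd : d ≠ 0) (he : e ≠ 0) (hn : n ≠ 0)
    (h : n = d * e) (f : R⟦X⟧) : expand d hd (expand e he f) = expand n hn f := by
  subst h
  exact (expand_mul d hd e he f).symm

/-- The norm of ψ is deduced from that of E by taking norms in Gauss's identity and cancelling Euler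
products. -/
theorem conjProd_triangularSeries (hζ : IsPrimitiveRoot ζ 5) :
    conjProd ζ (triangularSeries F) * expand 25 twentyfive_ne_zero (triangularSeries F) =
      expand 5 five_ne_zero' (triangularSeries F) ^ 6 := by
  have g := triangularSeries_mul_pentagonalSeries (R := F)
  have g5 := congrArg (expand 5 five_ne_zero') g
  have g25 := congrArg (expand 25 twentyfive_ne_zero) g
  have gc := congrArg (conjProd ζ) g
  have n1 := conjProd_pentagonalSeries hζ
  have n2 := congrArg (expand 2 two_ne_zero) n1
  rw [map_mul, map_pow] at g5 g25 gc
  rw [conjProd_expand_two hζ] at gc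
  rw [map_mul, map_pow] at n2
  rw [expand_expand _ _ (by norm_num : 50 ≠ 0) (by norm_num)] at g25 n2
  rw [expand_expand _ _ (by norm_num : 10 ≠ 0) (by norm_num)] at g5 n2
  have e5 := expand_ne_zero five_ne_zero' (pentagonalSeries_ne_zero F)
  have e25 := expand_ne_zero twentyfive_ne_zero (pentagonalSeries_ne_zero F)
  apply mul_right_cancel₀ (mul_ne_zero (pow_ne_zero 6 e5) e25)
  generalize expand 5 five_ne_zero' (pentagonalSeries F) = E5 at *
  generalize expand 25 twentyfive_ne_zero (pentagonalSeries F) = E25 at *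
  generalize expand 5 five_ne_zero' (triangularSeries F) = T5 at *
  generalize expand 25 twentyfive_ne_zero (triangularSeries F) = T25 at *
  generalize expand 10 _ (pentagonalSeries F) = E10 at *
  generalize expand 50 _ (pentagonalSeries F) = E50 at *
  generalize expand 2 two_ne_zero (conjProd ζ (pentagonalSeries F)) = N2 at *
  generalize conjProd ζ (pentagonalSeries F) = N1 at *
  generalize conjProd ζ (triangularSeries F) = N at *
  calc N * T25 * (E5 ^ 6 * E25) = (N * N1) * E25 * (T25 * E25) := by rw [← n1]; ring
    _ = (N2 * E50) ^ 2 * E25 := by rw [gc, g25]; ring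
    _ = (T5 * E5) ^ 6 * E25 := by rw [n2, g5]; ring
    _ = _ := by ring

theorem rescale_residuePart (a : F) (ha : a ^ 5 = 1) (r : ℕ) (f : F⟦X⟧) :
    rescale a (residuePart r f) = C a ^ r * residuePart r f := by
  ext n
  rw [coeff_rescale, ← map_pow, coeff_C_mul, coeff_residuePart]
  split_ifs with h
  · congr 1
    rw [← Nat.div_add_mod n 5, h, pow_add, pow_mul, ha, one_pow, one_mul]
  · simp

theorem triangularSeries_eq_add_residuePart (R : Type*) [CommRing R] :
    triangularSeries R = residuePart 0 (triangularSeries R) +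
      residuePart 1 (triangularSeries R) + residuePart 3 (triangularSeries R) := by
  ext n
  simp only [map_add, coeff_residuePart]
  have h : n % 5 = 0 ∨ n % 5 = 1 ∨ n % 5 = 2 ∨ n % 5 = 3 ∨ n % 5 = 4 := by omega
  rcases h with h | h | h | h | h <;> simp [h, coeff_triangularSeries_of_mod_five]

theorem residuePart_three_triangularSeries (R : Type*) [CommRing R] :
    residuePart 3 (triangularSeries R) =
      X ^ 3 * expand 25 twentyfive_ne_zero (triangularSeries R) := by
  ext n
  rw [coeff_residuePart, coeff_X_pow_mul']
  by_cases h : n % 5 = 3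
  · obtain ⟨m, rfl⟩ : ∃ m, n = 5 * m + 3 := ⟨n / 5, by omega⟩
    rw [if_pos h, if_pos (by omega), coeff_triangularSeries_five_mul_add_three,
      Nat.add_sub_cancel,
      ← expand_expand five_ne_zero' five_ne_zero' twentyfive_ne_zero (by norm_num),
      coeff_expand_mul]
  · rw [if_neg h]
    split_ifs with h3
    · rw [coeff_expand_of_not_dvd]
      omega
    · rfl

theorem norm_triangularSeries_aux (hζ : IsPrimitiveRoot ζ 5) :
    (residuePart 0 (triangularSeries F) ^ 5 + residuePart 1 (triangularSeries F) ^ 5 +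
      residuePart 3 (triangularSeries F) ^ 5 - 5 * residuePart 0 (triangularSeries F) *
      residuePart 1 (triangularSeries F) * residuePart 3 (triangularSeries F) ^ 3 +
      5 * residuePart 0 (triangularSeries F) ^ 2 * residuePart 1 (triangularSeries F) ^ 2 *
      residuePart 3 (triangularSeries F)) * expand 25 twentyfive_ne_zero (triangularSeries F) =
      expand 5 five_ne_zero' (triangularSeries F) ^ 6 := by
  rw [← conjProd_triangularSeries hζ, ← prod_conj_trinomial hζ, conjProd_apply]
  congr 1
  refine Finset.prod_congr rfl fun i _ => ?_
  have ha : (ζ ^ i) ^ 5 = 1 := by rw [← pow_mul, mul_comm, pow_mul, hζ.pow_eq_one, one_pow]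
  conv_rhs => rw [triangularSeries_eq_add_residuePart F]
  simp only [map_add, rescale_residuePart _ ha, pow_zero, one_mul, pow_one]

theorem map_residuePart {R S : Type*} [CommRing R] [CommRing S] (φ : R →+* S) (r : ℕ) (f : R⟦X⟧) :
    PowerSeries.map φ (residuePart r f) = residuePart r (PowerSeries.map φ f) := by
  ext n
  simp only [coeff_map, coeff_residuePart]
  split_ifs <;> simp

theorem map_triangularSeries {R S : Type*} [CommRing R] [CommRing S] (φ : R →+* S) :
    PowerSeries.map φ (triangularSeries R) = triangularSeries S := by
  ext n
  simp only [coeff_map, triangularSeries, coeff_mk]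
  split_ifs <;> simp

/-- No root of unity is left in the identity, so it descends from ℂ to ℚ. -/
theorem norm_triangularSeries :
    (residuePart 0 (triangularSeries ℚ) ^ 5 + residuePart 1 (triangularSeries ℚ) ^ 5 +
      residuePart 3 (triangularSeries ℚ) ^ 5 - 5 * residuePart 0 (triangularSeries ℚ) *
      residuePart 1 (triangularSeries ℚ) * residuePart 3 (triangularSeries ℚ) ^ 3 +
      5 * residuePart 0 (triangularSeries ℚ) ^ 2 * residuePart 1 (triangularSeries ℚ) ^ 2 *
      residuePart 3 (triangularSeries ℚ)) * expand 25 twentyfive_ne_zero (triangularSeries ℚ) =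
      expand 5 five_ne_zero' (triangularSeries ℚ) ^ 6 := by
  refine PowerSeries.map_injective (algebraMap ℚ ℂ) (algebraMap ℚ ℂ).injective ?_
  simp only [map_mul, map_add, map_sub, map_pow, map_residuePart, map_triangularSeries,
    map_expand', map_ofNat]
  exact norm_triangularSeries_aux (Complex.isPrimitiveRoot_exp 5 (by norm_num))

end Norm

end ElongatedDiamond

/-! ### Laurent series over ℚ, the substitution q ↦ q⁵ and its left inverse U. -/

namespace ElongatedDiamond

open scoped LaurentSeries

section Laurent

/-- The variable of the field of Laurent series. -/
noncomputable def qvar : ℚ⸨X⸩ := HahnSeries.single 1 1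

theorem qvar_ne_zero : qvar ≠ 0 := HahnSeries.single_ne_zero one_ne_zero

theorem single_eq_qvar_zpow (n : ℤ) : HahnSeries.single n (1 : ℚ) = qvar ^ n :=
  RatFunc.single_zpow n

theorem coeff_qvar_zpow_mul (n m : ℤ) (f : ℚ⸨X⸩) : (qvar ^ n * f).coeff m = f.coeff (m - n) := by
  rw [← single_eq_qvar_zpow, HahnSeries.coeff_single_mul, one_mul]

/-- The substitution `q ↦ q^d`. -/
noncomputable def dilate (d : ℕ) (hd : 0 < d) : ℚ⸨X⸩ →+* ℚ⸨X⸩ :=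
  HahnSeries.embDomainRingHom (AddMonoidHom.mulLeft (d : ℤ))
    (fun a b h => by
      have hd' : (d : ℤ) ≠ 0 := by exact_mod_cast hd.ne'
      exact mul_left_cancel₀ hd' h)
    (fun a b => by
      have hd' : (0 : ℤ) < d := by exact_mod_cast hd
      exact mul_le_mul_iff_right₀ hd')

section Dilate

variable {d : ℕ} (hd : 0 < d)

theorem coeff_dilate_mul (f : ℚ⸨X⸩) (n : ℤ) : (dilate d hd f).coeff (d * n) = f.coeff n :=
  HahnSeries.embDomain_coeff (f := ⟨⟨AddMonoidHom.mulLeft (d : ℤ), _⟩, _⟩)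

theorem coeff_dilate_of_not_dvd (f : ℚ⸨X⸩) {n : ℤ} (hn : ¬ (d : ℤ) ∣ n) :
    (dilate d hd f).coeff n = 0 :=
  HahnSeries.embDomain_of_notMem_range (fun ⟨m, hm⟩ => hn ⟨m, hm.symm⟩)

theorem dilate_qvar : dilate d hd qvar = qvar ^ (d : ℤ) := by
  rw [← single_eq_qvar_zpow]
  exact HahnSeries.embDomain_single.trans (by simp)

theorem dilate_injective : Function.Injective (dilate d hd) := (dilate d hd).injective

theorem dilate_dilate {d e n : ℕ} (hd : 0 < d) (he : 0 < e) (hn : 0 < n) (h : n = d * e)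
    (f : ℚ⸨X⸩) : dilate d hd (dilate e he f) = dilate n hn f := by
  subst h
  have hd' : (d : ℤ) ≠ 0 := by exact_mod_cast hd.ne'
  ext m
  by_cases h1 : (d : ℤ) ∣ m
  · obtain ⟨m, rfl⟩ := h1
    rw [coeff_dilate_mul]
    by_cases h2 : (e : ℤ) ∣ m
    · obtain ⟨m, rfl⟩ := h2
      rw [coeff_dilate_mul, ← mul_assoc]
      exact_mod_cast (coeff_dilate_mul hn f m).symm
    · rw [coeff_dilate_of_not_dvd _ _ h2, coeff_dilate_of_not_dvd]
      push_cast
      rwa [mul_dvd_mul_iff_left hd']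
  · rw [coeff_dilate_of_not_dvd _ _ h1, coeff_dilate_of_not_dvd]
    push_cast
    exact fun h => h1 (dvd_of_mul_right_dvd h)

theorem coe_expand {d : ℕ} (hd : 0 < d) (f : PowerSeries ℚ) :
    HahnSeries.ofPowerSeries ℤ ℚ (PowerSeries.expand d hd.ne' f) =
      dilate d hd (HahnSeries.ofPowerSeries ℤ ℚ f) := by
  have hd' : (0 : ℤ) < d := by exact_mod_cast hd
  ext m
  by_cases h1 : (d : ℤ) ∣ m
  · obtain ⟨m, rfl⟩ := h1
    rw [coeff_dilate_mul, PowerSeries.coeff_coe, PowerSeries.coeff_coe]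
    have : (d : ℤ) * m < 0 ↔ m < 0 := by
      rw [mul_neg_iff]
      constructor
      · rintro (h | h)
        · exact h.2
        · omega
      · exact fun h => Or.inl ⟨hd', h⟩
    simp only [this, Int.natAbs_mul, Int.natAbs_natCast, PowerSeries.coeff_expand_mul]
  · rw [coeff_dilate_of_not_dvd _ _ h1, PowerSeries.coeff_coe]
    split_ifs
    · rfl
    · exact PowerSeries.coeff_expand_of_not_dvd _ _ _ fun h => h1 (Int.natCast_dvd.mpr h)

end Dilate

/-- The substitution `q ↦ q^5`. -/
noncomputable def sig : ℚ⸨X⸩ →+* ℚ⸨X⸩ := dilate 5 (by norm_num)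

/-- The operator `U₅`: it keeps the coefficients with index divisible by five. -/
noncomputable def U : ℚ⸨X⸩ →+ ℚ⸨X⸩ where
  toFun f := HahnSeries.ofSuppBddBelow (fun n => f.coeff (5 * n)) ⟨min f.order 0, fun n hn => by
    by_contra! h
    exact hn (HahnSeries.coeff_eq_zero_of_lt_order (by omega))⟩
  map_zero' := by ext n; rfl
  map_add' f g := by ext n; rfl

theorem coeff_U (f : ℚ⸨X⸩) (n : ℤ) : (U f).coeff n = f.coeff (5 * n) := rfl

theorem coeff_sig_mul (f : ℚ⸨X⸩) (n : ℤ) : (sig f).coeff (5 * n) = f.coeff n :=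
  coeff_dilate_mul _ f n

theorem coeff_sig_of_not_dvd (f : ℚ⸨X⸩) {n : ℤ} (hn : ¬ (5 : ℤ) ∣ n) : (sig f).coeff n = 0 :=
  coeff_dilate_of_not_dvd _ f hn

theorem U_sig (f : ℚ⸨X⸩) : U (sig f) = f := by
  ext n
  rw [coeff_U, coeff_sig_mul]

theorem U_qvar_zpow_mul_sig_of_not_dvd {n : ℤ} (hn : ¬ 5 ∣ n) (f : ℚ⸨X⸩) :
    U (qvar ^ n * sig f) = 0 := by
  ext m
  rw [coeff_U, coeff_qvar_zpow_mul, coeff_sig_of_not_dvd _ (by omega)]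
  rfl

theorem sig_qvar : sig qvar = qvar ^ (5 : ℤ) := dilate_qvar _

/-- The dissection of a Laurent series modulo five. -/
theorem eq_sum_qvar_zpow_mul_sig (f : ℚ⸨X⸩) :
    f = sig (U f) + qvar ^ (1 : ℤ) * sig (U (qvar ^ (-1 : ℤ) * f)) +
      qvar ^ (2 : ℤ) * sig (U (qvar ^ (-2 : ℤ) * f)) +
      qvar ^ (3 : ℤ) * sig (U (qvar ^ (-3 : ℤ) * f)) +
      qvar ^ (4 : ℤ) * sig (U (qvar ^ (-4 : ℤ) * f)) := by
  have key : ∀ (r n : ℤ), (sig (U (qvar ^ (-r) * f))).coeff (n - r) =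
      if 5 ∣ n - r then f.coeff n else 0 := fun r n => by
    split_ifs with h
    · obtain ⟨m, hm⟩ := h
      rw [hm, coeff_sig_mul, coeff_U, coeff_qvar_zpow_mul]
      congr 1
      omega
    · exact coeff_sig_of_not_dvd _ h
  ext n
  simp only [HahnSeries.coeff_add, coeff_qvar_zpow_mul, key]
  have h0 := key 0 n
  simp only [neg_zero, zpow_zero, one_mul, sub_zero] at h0
  rw [h0]
  have h5 : n % 5 = 0 ∨ n % 5 = 1 ∨ n % 5 = 2 ∨ n % 5 = 3 ∨ n % 5 = 4 := by omega
  rcases h5 with h | h | h | h | h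
  · rw [if_pos (by omega), if_neg (by omega), if_neg (by omega), if_neg (by omega),
      if_neg (by omega)]
    simp
  · rw [if_neg (by omega), if_pos (by omega), if_neg (by omega), if_neg (by omega),
      if_neg (by omega)]
    simp
  · rw [if_neg (by omega), if_neg (by omega), if_pos (by omega), if_neg (by omega),
      if_neg (by omega)]
    simp
  · rw [if_neg (by omega), if_neg (by omega), if_neg (by omega), if_pos (by omega),
      if_neg (by omega)]
    simp
  · rw [if_neg (by omega), if_neg (by omega), if_neg (by omega), if_neg (by omega),
      if_pos (by omega)]
    simp

/-- Multiplication by `sig f` preserves residue classes, and only the class zero part of `g`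
survives `U`. -/
theorem U_sig_mul (f g : ℚ⸨X⸩) : U (sig f * g) = f * U g := by
  have h : ∀ (r : ℤ) (g' : ℚ⸨X⸩), ¬ 5 ∣ r → U (sig f * (qvar ^ r * sig g')) = 0 := fun r g' hr => by
    rw [mul_left_comm, ← map_mul]
    exact U_qvar_zpow_mul_sig_of_not_dvd hr _
  conv_lhs => rw [eq_sum_qvar_zpow_mul_sig g]
  simp only [mul_add, map_add]
  rw [h 1 _ (by norm_num), h 2 _ (by norm_num), h 3 _ (by norm_num), h 4 _ (by norm_num),
    ← map_mul, U_sig]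
  simp

theorem U_mul_sig (f g : ℚ⸨X⸩) : U (g * sig f) = U g * f := by
  rw [mul_comm, U_sig_mul, mul_comm]

theorem U_qvar_zpow_five_mul (n : ℤ) (f : ℚ⸨X⸩) : U (qvar ^ (5 * n) * f) = qvar ^ n * U f := by
  rw [zpow_mul, ← sig_qvar, ← map_zpow₀, U_sig_mul]

end Laurent

end ElongatedDiamond

/-! ### Calculus of residue classes modulo 5; uniqueness of cube roots. -/

namespace ElongatedDiamond

open scoped LaurentSeries

section Residue

/-- The Laurent series `f` is supported on exponents congruent to `r` modulo five. -/
def HasResidue (r : ℤ) (f : ℚ⸨X⸩) : Prop := ∃ g, f = qvar ^ r * sig g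

theorem HasResidue.congr {r s : ℤ} {f : ℚ⸨X⸩} (h : HasResidue r f) (hrs : 5 ∣ r - s) :
    HasResidue s f := by
  obtain ⟨g, rfl⟩ := h
  obtain ⟨k, hk⟩ := hrs
  refine ⟨qvar ^ k * g, ?_⟩
  rw [map_mul, map_zpow₀, sig_qvar, ← zpow_mul, ← mul_assoc, ← zpow_add₀ qvar_ne_zero, ← hk]
  congr 2
  ring

theorem HasResidue.mul {r s : ℤ} {f g : ℚ⸨X⸩} (hf : HasResidue r f) (hg : HasResidue s g) :
    HasResidue (r + s) (f * g) := by
  obtain ⟨f, rfl⟩ := hf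
  obtain ⟨g, rfl⟩ := hg
  refine ⟨f * g, ?_⟩
  rw [map_mul, zpow_add₀ qvar_ne_zero]
  ring

theorem HasResidue.pow {r : ℤ} {f : ℚ⸨X⸩} (hf : HasResidue r f) (n : ℕ) :
    HasResidue (n * r) (f ^ n) := by
  obtain ⟨f, rfl⟩ := hf
  refine ⟨f ^ n, ?_⟩
  rw [map_pow, mul_pow, ← zpow_natCast, ← zpow_mul, mul_comm r]

theorem HasResidue.inv {r : ℤ} {f : ℚ⸨X⸩} (hf : HasResidue r f) : HasResidue (-r) f⁻¹ := by
  obtain ⟨f, rfl⟩ := hf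
  refine ⟨f⁻¹, ?_⟩
  rw [map_inv₀, mul_inv, zpow_neg]

theorem HasResidue.add {r : ℤ} {f g : ℚ⸨X⸩} (hf : HasResidue r f) (hg : HasResidue r g) :
    HasResidue r (f + g) := by
  obtain ⟨f, rfl⟩ := hf
  obtain ⟨g, rfl⟩ := hg
  exact ⟨f + g, by rw [map_add, mul_add]⟩

theorem HasResidue.neg {r : ℤ} {f : ℚ⸨X⸩} (hf : HasResidue r f) : HasResidue r (-f) := by
  obtain ⟨f, rfl⟩ := hf
  exact ⟨-f, by rw [map_neg, mul_neg]⟩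

theorem HasResidue.sub {r : ℤ} {f g : ℚ⸨X⸩} (hf : HasResidue r f) (hg : HasResidue r g) :
    HasResidue r (f - g) := sub_eq_add_neg f g ▸ hf.add hg.neg

theorem hasResidue_sig (f : ℚ⸨X⸩) : HasResidue 0 (sig f) := ⟨f, by simp⟩

theorem HasResidue.U_eq_zero {r : ℤ} {f : ℚ⸨X⸩} (hf : HasResidue r f) (hr : ¬ 5 ∣ r) :
    U f = 0 := by
  obtain ⟨f, rfl⟩ := hf
  exact U_qvar_zpow_mul_sig_of_not_dvd hr f

theorem HasResidue.eq_zero {f : ℚ⸨X⸩} (hf : HasResidue 0 f) (h : U f = 0) : f = 0 := by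
  obtain ⟨f, rfl⟩ := hf
  rw [zpow_zero, one_mul, U_sig] at h
  simp [h]

/-- Components in distinct residue classes of a vanishing sum vanish. -/
theorem HasResidue.eq_zero_of_add_eq_zero {a b c d e : ℚ⸨X⸩} {r : ℤ} (ha : HasResidue r a)
    (hb : HasResidue (r + 1) b) (hc : HasResidue (r + 2) c) (hd : HasResidue (r + 3) d)
    (he : HasResidue (r + 4) e) (h : a + b + c + d + e = 0) : a = 0 := by
  have hq : HasResidue (-r) (qvar ^ (-r)) := ⟨1, by simp⟩
  have h' : qvar ^ (-r) * a = 0 := by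
    refine HasResidue.eq_zero ((hq.mul ha).congr (by simp)) ?_
    have := congrArg (fun f => U (qvar ^ (-r) * f)) h
    simp only [mul_add, map_add, mul_zero, map_zero] at this
    rw [(hq.mul hb).U_eq_zero (by omega), (hq.mul hc).U_eq_zero (by omega),
      (hq.mul hd).U_eq_zero (by omega), (hq.mul he).U_eq_zero (by omega)] at this
    simpa using this
  exact (mul_eq_zero.mp h').resolve_left (zpow_ne_zero _ qvar_ne_zero)

theorem hasResidue_coe {r : ℕ} {f : PowerSeries ℚ} (h : ∀ n, n % 5 ≠ r % 5 → f.coeff n = 0) :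
    HasResidue r (HahnSeries.ofPowerSeries ℤ ℚ f) := by
  refine ⟨U (qvar ^ (-(r : ℤ)) * HahnSeries.ofPowerSeries ℤ ℚ f), ?_⟩
  ext n
  rw [coeff_qvar_zpow_mul]
  by_cases h5 : (5 : ℤ) ∣ n - r
  · obtain ⟨m, hm⟩ := h5
    rw [hm, coeff_sig_mul, coeff_U, coeff_qvar_zpow_mul]
    congr 1
    omega
  · rw [coeff_sig_of_not_dvd _ h5, PowerSeries.coeff_coe]
    split_ifs with hn
    · rfl
    · apply h
      omega

theorem dilate_two_sig (f : ℚ⸨X⸩) : dilate 2 two_pos (sig f) = sig (dilate 2 two_pos f) := by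
  rw [sig, dilate_dilate two_pos (by norm_num) (by norm_num : 0 < 10) (by norm_num),
    dilate_dilate (by norm_num) two_pos (by norm_num : 0 < 10) (by norm_num)]

theorem hasResidue_dilate_two {r : ℤ} {f : ℚ⸨X⸩} (hf : HasResidue r f) :
    HasResidue (2 * r) (dilate 2 two_pos f) := by
  obtain ⟨g, rfl⟩ := hf
  refine ⟨dilate 2 two_pos g, ?_⟩
  rw [map_mul, map_zpow₀, dilate_qvar, ← zpow_mul, dilate_two_sig]
  rfl

/-- Leading coefficients are rational and multiplicative, so -3 times a nonzero square is never a
square. -/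
theorem sq_add_three_mul_sq_eq_zero {a b : ℚ⸨X⸩} (h : a ^ 2 + 3 * b ^ 2 = 0) : b = 0 := by
  have h' : a * a = HahnSeries.C (-3 : ℚ) * (b * b) := by
    have : (HahnSeries.C (-3 : ℚ) : ℚ⸨X⸩) = -3 := by rw [map_neg]; rfl
    rw [this]
    linear_combination h
  have := congrArg HahnSeries.leadingCoeff h'
  rw [HahnSeries.leadingCoeff_mul, HahnSeries.leadingCoeff_mul, HahnSeries.leadingCoeff_mul,
    show (HahnSeries.C (-3 : ℚ) : ℚ⸨X⸩).leadingCoeff = -3 from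
      HahnSeries.leadingCoeff_of_single] at this
  rw [← HahnSeries.leadingCoeff_eq_zero]
  nlinarith [mul_self_nonneg a.leadingCoeff, mul_self_nonneg b.leadingCoeff]

/-- Without a square root of -3 the field has no nontrivial cube root of unity. This is needed
because the norm identity yields only the cube of σ(x⁻¹). -/
theorem eq_of_pow_three_eq {a b : ℚ⸨X⸩} (h : a ^ 3 = b ^ 3) : a = b := by
  by_contra hab
  have h1 : a ^ 2 + a * b + b ^ 2 = 0 := by
    apply (mul_eq_zero.mp (_ : (a - b) * (a ^ 2 + a * b + b ^ 2) = 0)).resolve_left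
      (sub_ne_zero.mpr hab)
    linear_combination h
  have hb : b = 0 := sq_add_three_mul_sq_eq_zero (a := 2 * a + b)
    (by linear_combination 4 * h1)
  have ha : a = 0 := by
    have : a ^ 3 = 0 := by rw [h, hb]; ring
    simpa using this
  exact hab (ha.trans hb.symm)

end Residue

end ElongatedDiamond

/-! ### The quotients P and Ψ and their dissections. -/

namespace ElongatedDiamond

open scoped LaurentSeries
open PowerSeries (pentagonalSeries expand)

section Objects

/-- Euler's product `∏ (1 - q ^ m)` as a Laurent series. -/
noncomputable def euler : ℚ⸨X⸩ := HahnSeries.ofPowerSeries ℤ ℚ (pentagonalSeries ℚ)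

/-- Gauss' series `∑ q ^ (n (n + 1) / 2)` as a Laurent series. -/
noncomputable def gauss : ℚ⸨X⸩ := HahnSeries.ofPowerSeries ℤ ℚ (triangularSeries ℚ)

theorem euler_ne_zero : euler ≠ 0 := fun h =>
  pentagonalSeries_ne_zero ℚ (HahnSeries.ofPowerSeries_injective (Γ := ℤ)
    (h.trans (map_zero _).symm))

theorem gauss_ne_zero : gauss ≠ 0 := fun h =>
  triangularSeries_ne_zero ℚ (HahnSeries.ofPowerSeries_injective (Γ := ℤ)
    (h.trans (map_zero _).symm))

theorem sig_ne_zero {f : ℚ⸨X⸩} (hf : f ≠ 0) : sig f ≠ 0 := (map_ne_zero sig).mpr hf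

theorem sig_sig (f : ℚ⸨X⸩) : sig (sig f) = dilate 25 (by norm_num) f :=
  dilate_dilate _ _ _ (by norm_num) f

theorem coe_expand_five (f : PowerSeries ℚ) :
    HahnSeries.ofPowerSeries ℤ ℚ (expand 5 five_ne_zero' f) =
      sig (HahnSeries.ofPowerSeries ℤ ℚ f) := coe_expand _ f

theorem coe_expand_twentyfive (f : PowerSeries ℚ) :
    HahnSeries.ofPowerSeries ℤ ℚ (expand 25 twentyfive_ne_zero f) =
      sig (sig (HahnSeries.ofPowerSeries ℤ ℚ f)) := by
  rw [sig_sig]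
  exact coe_expand _ f

theorem gauss_mul_euler : gauss * euler = dilate 2 two_pos euler ^ 2 := by
  rw [gauss, euler, ← map_mul, triangularSeries_mul_pentagonalSeries, map_pow]
  congr 1
  exact coe_expand two_pos _

theorem coe_X : HahnSeries.ofPowerSeries ℤ ℚ PowerSeries.X = qvar := HahnSeries.ofPowerSeries_X

/-- The quotient `E(q) / (q E(q²⁵))`. -/
noncomputable def eulerQuot : ℚ⸨X⸩ := euler / (qvar * sig (sig euler))

/-- The quotient `ψ(q) / (q³ ψ(q²⁵))`. -/
noncomputable def gaussQuot : ℚ⸨X⸩ := gauss / (qvar ^ 3 * sig (sig gauss))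

theorem eulerQuot_ne_zero : eulerQuot ≠ 0 :=
  div_ne_zero euler_ne_zero (mul_ne_zero qvar_ne_zero (sig_ne_zero (sig_ne_zero euler_ne_zero)))

theorem gaussQuot_ne_zero : gaussQuot ≠ 0 :=
  div_ne_zero gauss_ne_zero
    (mul_ne_zero (pow_ne_zero 3 qvar_ne_zero) (sig_ne_zero (sig_ne_zero gauss_ne_zero)))

/-- Gauss's identity divided by its image under q ↦ q²⁵; the powers of q match, 3 + 1 = 2·2. -/
theorem gaussQuot_mul_eulerQuot : gaussQuot * eulerQuot = dilate 2 two_pos eulerQuot ^ 2 := by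
  have h := gauss_mul_euler
  have h2 : sig (sig gauss) * sig (sig euler) = sig (sig (dilate 2 two_pos euler)) ^ 2 := by
    rw [← map_mul, ← map_mul, h, map_pow, map_pow]
  have h3 : dilate 2 two_pos eulerQuot =
      dilate 2 two_pos euler / (qvar ^ 2 * sig (sig (dilate 2 two_pos euler))) := by
    rw [eulerQuot, map_div₀, map_mul, dilate_qvar, dilate_two_sig, dilate_two_sig]
    rfl
  rw [h3, gaussQuot, eulerQuot, div_mul_div_comm, h, div_pow, mul_pow, ← h2]
  exact congrArg _ (by ring)

theorem pentagonalSeries_eq_add_residuePart : pentagonalSeries ℚ =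
    residuePart 0 (pentagonalSeries ℚ) + residuePart 1 (pentagonalSeries ℚ) +
      residuePart 2 (pentagonalSeries ℚ) := by
  ext n
  simp only [map_add, coeff_residuePart]
  have h : n % 5 = 0 ∨ n % 5 = 1 ∨ n % 5 = 2 ∨ n % 5 = 3 ∨ n % 5 = 4 := by omega
  rcases h with h | h | h | h | h <;> simp [h, coeff_pentagonalSeries_of_mod_five]

theorem residuePart_one_pentagonalSeries : residuePart 1 (pentagonalSeries ℚ) =
    -(PowerSeries.X * expand 25 twentyfive_ne_zero (pentagonalSeries ℚ)) := by
  ext n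
  rw [coeff_residuePart, map_neg]
  rcases n with _ | n
  · simp
  rw [PowerSeries.coeff_succ_X_mul]
  by_cases h : (n + 1) % 5 = 1
  · obtain ⟨m, rfl⟩ : ∃ m, n = 5 * m := ⟨n / 5, by omega⟩
    rw [if_pos h, coeff_pentagonalSeries_five_mul_add_one,
      ← expand_expand five_ne_zero' five_ne_zero' twentyfive_ne_zero (by norm_num),
      PowerSeries.coeff_expand_mul]
  · rw [if_neg h, PowerSeries.coeff_expand_of_not_dvd, neg_zero]
    omega

theorem hasResidue_residuePart (r : ℕ) (hr : r < 5) (f : PowerSeries ℚ) :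
    HasResidue r (HahnSeries.ofPowerSeries ℤ ℚ (residuePart r f)) :=
  hasResidue_coe fun n hn => by
    rw [coeff_residuePart, if_neg]
    rwa [Nat.mod_eq_of_lt hr] at hn

theorem hasResidue_qvar_pow (n : ℕ) : HasResidue n (qvar ^ n) := ⟨1, by simp⟩

/-- Dividing by qE(q²⁵) normalizes the class 1 part of E to -1 and shifts all classes by -1. -/
theorem exists_eulerQuot_eq : ∃ α β, HasResidue (-1) α ∧ HasResidue 1 β ∧
    eulerQuot = α - 1 + β := by
  have hd : qvar * sig (sig euler) ≠ 0 :=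
    mul_ne_zero qvar_ne_zero (sig_ne_zero (sig_ne_zero euler_ne_zero))
  have hdr : HasResidue 1 (qvar * sig (sig euler)) := by
    simpa using (hasResidue_qvar_pow 1).mul (hasResidue_sig (sig euler))
  have h0 := hasResidue_residuePart 0 (by norm_num) (pentagonalSeries ℚ)
  have h2 := hasResidue_residuePart 2 (by norm_num) (pentagonalSeries ℚ)
  have h := congrArg (HahnSeries.ofPowerSeries ℤ ℚ) pentagonalSeries_eq_add_residuePart
  rw [map_add, map_add, residuePart_one_pentagonalSeries, map_neg, map_mul, coe_X,
    coe_expand_twentyfive] at h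
  change euler = _ + -(qvar * sig (sig euler)) + _ at h
  rw [eulerQuot]
  generalize qvar * sig (sig euler) = d at *
  generalize HahnSeries.ofPowerSeries ℤ ℚ (residuePart 0 (pentagonalSeries ℚ)) = a at *
  generalize HahnSeries.ofPowerSeries ℤ ℚ (residuePart 2 (pentagonalSeries ℚ)) = b at *
  refine ⟨a / d, b / d, ?_, ?_, ?_⟩
  · rw [div_eq_mul_inv]
    exact (h0.mul hdr.inv).congr (by norm_num)
  · rw [div_eq_mul_inv]
    exact (h2.mul hdr.inv).congr (by norm_num)
  · field_simp
    linear_combination h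

/-- Dividing by q³ψ(q²⁵) normalizes the class 3 part of ψ to 1; the last relation is the norm of ψ
in this normalization. -/
theorem exists_gaussQuot_eq : ∃ a b, HasResidue 2 a ∧ HasResidue (-2) b ∧
    gaussQuot = 1 + a + b ∧ 1 - 5 * (a * b) + 5 * (a * b) ^ 2 + a ^ 5 + b ^ 5 =
      sig (gauss / sig gauss) ^ 6 / qvar ^ 15 := by
  have hg := sig_ne_zero (sig_ne_zero gauss_ne_zero)
  have hd : qvar ^ 3 * sig (sig gauss) ≠ 0 := mul_ne_zero (pow_ne_zero 3 qvar_ne_zero) hg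
  have hdr : HasResidue 3 (qvar ^ 3 * sig (sig gauss)) := by
    simpa using (hasResidue_qvar_pow 3).mul (hasResidue_sig (sig gauss))
  have h0 := hasResidue_residuePart 0 (by norm_num) (triangularSeries ℚ)
  have h1 := hasResidue_residuePart 1 (by norm_num) (triangularSeries ℚ)
  have h := congrArg (HahnSeries.ofPowerSeries ℤ ℚ) (triangularSeries_eq_add_residuePart ℚ)
  rw [map_add, map_add, residuePart_three_triangularSeries, map_mul, map_pow, coe_X,
    coe_expand_twentyfive] at h
  change gauss = _ + _ + qvar ^ 3 * sig (sig gauss) at h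
  have hn := congrArg (HahnSeries.ofPowerSeries ℤ ℚ) norm_triangularSeries
  simp only [map_add, map_sub, map_mul, map_pow, residuePart_three_triangularSeries, coe_X,
    coe_expand_twentyfive, coe_expand_five, map_ofNat] at hn
  change (_ + (qvar ^ 3 * sig (sig gauss)) ^ 5 - _ * (qvar ^ 3 * sig (sig gauss)) ^ 3
    + _ * (qvar ^ 3 * sig (sig gauss))) * sig (sig gauss) = sig gauss ^ 6 at hn
  rw [gaussQuot, map_div₀]
  have hdg : qvar ^ 15 * sig (sig gauss) ^ 6 =
      (qvar ^ 3 * sig (sig gauss)) ^ 5 * sig (sig gauss) := by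
    ring
  rw [div_pow, div_div, mul_comm _ (qvar ^ 15), hdg]
  clear hdg
  generalize qvar ^ 3 * sig (sig gauss) = d at *
  generalize sig (sig gauss) = g at *
  generalize HahnSeries.ofPowerSeries ℤ ℚ (residuePart 0 (triangularSeries ℚ)) = a at *
  generalize HahnSeries.ofPowerSeries ℤ ℚ (residuePart 1 (triangularSeries ℚ)) = b at *
  refine ⟨a / d, b / d, ?_, ?_, ?_, ?_⟩
  · rw [div_eq_mul_inv]
    exact (h0.mul hdr.inv).congr (by norm_num)
  · rw [div_eq_mul_inv]
    exact (h1.mul hdr.inv).congr (by norm_num)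
  · field_simp
    linear_combination h
  · rw [← hn]
    field_simp
    ring

end Objects

end ElongatedDiamond

/-! ### Parametrization of the dissections by one series c. -/

namespace ElongatedDiamond

open scoped LaurentSeries

section Parametrization

/-- The Hauptmodul `q E(q)² E(q¹⁰)⁴ / (E(q⁵)² E(q²)⁴)`. -/
noncomputable def hauptmodul : ℚ⸨X⸩ := qvar * (sig gauss / gauss) ^ 2

/-- The quotient of `eulerQuot ^ 2` by its image under `q ↦ q²`. -/
noncomputable def phiQuot : ℚ⸨X⸩ := eulerQuot ^ 2 / dilate 2 two_pos eulerQuot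

theorem hauptmodul_ne_zero : hauptmodul ≠ 0 :=
  mul_ne_zero qvar_ne_zero (pow_ne_zero 2 (div_ne_zero (sig_ne_zero gauss_ne_zero) gauss_ne_zero))

theorem hauptmodul_mul_sig : hauptmodul * sig hauptmodul * gaussQuot ^ 2 = 1 := by
  have h0 := gauss_ne_zero
  have h1 := sig_ne_zero h0
  have h2 := sig_ne_zero h1
  have hq := qvar_ne_zero
  rw [hauptmodul, map_mul, map_pow, map_div₀, sig_qvar, gaussQuot, zpow_ofNat]
  generalize sig (sig gauss) = a at *
  generalize sig gauss = b at *
  field_simp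

theorem hasResidue_one : HasResidue 0 (1 : ℚ⸨X⸩) := by
  have h := hasResidue_sig 1
  rwa [map_one] at h

instance : CharZero ℚ⸨X⸩ := charZero_of_injective_algebraMap (algebraMap ℚ ℚ⸨X⸩).injective

/-- The five residue classes of the product identity vanish separately. In class 0 the left side
contributes -1 and the right side 1 + 2γδ, whence γδ = -1. -/
theorem residue_relations {α β γ δ a b : ℚ⸨X⸩} (hα : HasResidue (-1) α)
    (hβ : HasResidue 1 β) (hγ : HasResidue (2 * -1) γ) (hδ : HasResidue (2 * 1) δ)
    (ha : HasResidue 2 a) (hb : HasResidue (-2) b)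
    (hPQ : (1 + a + b) * (α - 1 + β) = (γ - 1 + δ) ^ 2) :
    1 + γ * δ = 0 ∧ α * a + β - γ ^ 2 = 0 ∧ α * b - a + (δ + δ) = 0 ∧ β * a - b + (γ + γ) = 0 ∧
      α + β * b - δ ^ 2 = 0 := by
  have e : HasResidue 0 (1 + γ * δ) := hasResidue_one.add ((hγ.mul hδ).congr (by norm_num))
  have e0 : HasResidue 0 (-((1 + γ * δ) + (1 + γ * δ))) := (e.add e).neg
  have e1 : HasResidue 1 (α * a + β - γ ^ 2) :=
    (((hα.mul ha).congr (by norm_num)).add hβ).sub ((hγ.pow 2).congr (by norm_num))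
  have e2 : HasResidue 2 (α * b - a + (δ + δ)) :=
    (((hα.mul hb).congr (by norm_num)).sub ha).add (hδ.add hδ)
  have e3 : HasResidue 3 (β * a - b + (γ + γ)) :=
    (((hβ.mul ha).congr (by norm_num)).sub (hb.congr (by norm_num))).add
      ((hγ.add hγ).congr (by norm_num))
  have e4 : HasResidue 4 (α + β * b - δ ^ 2) :=
    ((hα.congr (by norm_num)).add ((hβ.mul hb).congr (by norm_num))).sub
      ((hδ.pow 2).congr (by norm_num))
  have hsum : (-((1 + γ * δ) + (1 + γ * δ))) + (α * a + β - γ ^ 2) + (α * b - a + (δ + δ)) +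
      (β * a - b + (γ + γ)) + (α + β * b - δ ^ 2) = 0 := by
    linear_combination hPQ
  have r0 := HasResidue.eq_zero_of_add_eq_zero e0 e1 e2 e3 e4 hsum
  have r1 := HasResidue.eq_zero_of_add_eq_zero e1 e2 e3 e4 (e0.congr (by norm_num))
    (by linear_combination hsum)
  have r2 := HasResidue.eq_zero_of_add_eq_zero e2 e3 e4 (e0.congr (by norm_num))
    (e1.congr (by norm_num)) (by linear_combination hsum)
  have r3 := HasResidue.eq_zero_of_add_eq_zero e3 e4 (e0.congr (by norm_num))
    (e1.congr (by norm_num)) (e2.congr (by norm_num)) (by linear_combination hsum)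
  have r4 := HasResidue.eq_zero_of_add_eq_zero e4 (e0.congr (by norm_num))
    (e1.congr (by norm_num)) (e2.congr (by norm_num)) (e3.congr (by norm_num))
    (by linear_combination hsum)
  refine ⟨?_, r1, r2, r3, r4⟩
  have h2 : (2 : ℚ⸨X⸩) ≠ 0 := two_ne_zero
  apply (mul_eq_zero.mp (_ : 2 * (1 + γ * δ) = 0)).resolve_left h2
  linear_combination -r0

/-- The relations `r1` and `r4` are solved for a and b; substituted into `r2` and `r3` they
determine u⁵ and exclude c = ±1. -/
theorem parametrization_of_relations {F : Type*} [Field F] [CharZero F] {u c a b : F}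
    (hu0 : u ≠ 0) (hc0 : c ≠ 0)
    (r1 : u⁻¹ * a - u - ((c * u ^ 2)⁻¹) ^ 2 = 0) (r2 : u⁻¹ * b - a - 2 * (c * u ^ 2) = 0)
    (r3 : -u * a - b + 2 * (c * u ^ 2)⁻¹ = 0) (r4 : u⁻¹ - u * b - (c * u ^ 2) ^ 2 = 0) :
    c - 1 ≠ 0 ∧ c + 1 ≠ 0 ∧ u ^ 5 = (c - 1) / (c ^ 2 * (c + 1)) ∧
    a = u ^ 2 * (2 * c / (c - 1)) ∧ b = 2 / (c + 1) / u ^ 2 ∧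
    (u⁻¹ - 1 - u) ^ 2 =
      (1 + (1 - c) / c ^ 2 / u ^ 4 + c * (1 + c) * u ^ 4) * ((c * u ^ 2)⁻¹ - 1 - c * u ^ 2) := by
  have ha' : a = 1 / (c ^ 2 * u ^ 3) + u ^ 2 := by
    field_simp at r1 ⊢
    linear_combination r1
  have hb' : b = 1 / u ^ 2 - c ^ 2 * u ^ 3 := by
    field_simp at r4 ⊢
    linear_combination -r4
  subst ha' hb'
  have s2 : c ^ 2 * u ^ 5 * (c + 1) ^ 2 = (c - 1) * (c + 1) := by
    field_simp at r2
    linear_combination -r2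
  have s3 : c ^ 2 * u ^ 5 * (c ^ 2 - 1) = (c - 1) ^ 2 := by
    field_simp at r3
    linear_combination r3
  have hc1 : c + 1 ≠ 0 := fun h => by
    obtain rfl : c = -1 := by linear_combination h
    norm_num at s3
  have hc2 : c - 1 ≠ 0 := fun h => by
    obtain rfl : c = 1 := by linear_combination h
    norm_num at s2
    exact hu0 s2
  have s : c ^ 2 * u ^ 5 * (c + 1) = c - 1 := by
    apply mul_right_cancel₀ hc1
    linear_combination s2
  have hcc : c ^ 2 - 1 ≠ 0 := by
    have : c ^ 2 - 1 = (c - 1) * (c + 1) := by ring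
    rw [this]
    exact mul_ne_zero hc2 hc1
  have s' : u ^ 5 = (c - 1) / (c ^ 2 * (c + 1)) := by
    field_simp
    linear_combination s
  refine ⟨hc2, hc1, s', ?_, ?_, ?_⟩
  · field_simp
    linear_combination -s
  · field_simp
    linear_combination -s
  · field_simp
    linear_combination (c ^ 2 * u ^ 5 - 1 + u ^ 2 * c ^ 3 * u ^ 5 + c * u ^ 2) * s

/-- In the application γ and δ are the images of α and β under q ↦ q², and `hinj` is the injectivity
of that substitution. The parameters are u = -β and c = -δ/u², so c lives in class 0. -/
theorem exists_parametrization_aux {α β γ δ a b : ℚ⸨X⸩} (hα : HasResidue (-1) α)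
    (hβ : HasResidue 1 β) (hγ : HasResidue (2 * -1) γ) (hδ : HasResidue (2 * 1) δ)
    (ha : HasResidue 2 a) (hb : HasResidue (-2) b)
    (hPQ : (1 + a + b) * (α - 1 + β) = (γ - 1 + δ) ^ 2) (hinj : γ * δ = -1 → α * β = -1) :
    ∃ u c : ℚ⸨X⸩, HasResidue 1 u ∧ HasResidue 0 c ∧ u ≠ 0 ∧ c ≠ 0 ∧
    c - 1 ≠ 0 ∧ c + 1 ≠ 0 ∧ u ^ 5 = (c - 1) / (c ^ 2 * (c + 1)) ∧
    a = u ^ 2 * (2 * c / (c - 1)) ∧ b = 2 / (c + 1) / u ^ 2 ∧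
    (α - 1 + β) ^ 2 =
      (1 + (1 - c) / c ^ 2 / u ^ 4 + c * (1 + c) * u ^ 4) * (γ - 1 + δ) := by
  obtain ⟨r0, r1, r2, r3, r4⟩ := residue_relations hα hβ hγ hδ ha hb hPQ
  have hγδ1 : γ * δ = -1 := by linear_combination r0
  have hαβ1 : α * β = -1 := hinj hγδ1
  have hβ0 : β ≠ 0 := by rintro rfl; simp at hαβ1
  have hδ0 : δ ≠ 0 := by rintro rfl; simp at hγδ1
  have hα' : α = (-β)⁻¹ := eq_inv_of_mul_eq_one_left (by rw [mul_neg, hαβ1, neg_neg])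
  have hγ' : γ = (-δ)⁻¹ := eq_inv_of_mul_eq_one_left (by rw [mul_neg, hγδ1, neg_neg])
  obtain ⟨u, hu⟩ : ∃ u, u = -β := ⟨_, rfl⟩
  have hu' : β = -u := by rw [hu, neg_neg]
  have hu0 : u ≠ 0 := by rw [hu]; exact neg_ne_zero.mpr hβ0
  obtain ⟨c, hc⟩ : ∃ c, c = -δ / u ^ 2 := ⟨_, rfl⟩
  have hδ' : δ = -(c * u ^ 2) := by rw [hc, div_mul_cancel₀ _ (pow_ne_zero 2 hu0), neg_neg]
  have hc0 : c ≠ 0 := by rw [hc]; exact div_ne_zero (neg_ne_zero.mpr hδ0) (pow_ne_zero 2 hu0)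
  have hru : HasResidue 1 u := hu ▸ hβ.neg
  have hrc : HasResidue 0 c := by
    rw [hc, div_eq_mul_inv]
    exact (hδ.neg.mul (hru.pow 2).inv).congr (by norm_num)
  rw [hδ', neg_neg] at hγ'
  rw [hu', neg_neg] at hα'
  clear hc hu hα hβ hγ hδ ha hb hinj hαβ1 hγδ1 hPQ hβ0 hδ0 r0
  subst hα' hγ' hu' hδ'
  obtain ⟨h1, h2, h3, h4, h5, h6⟩ := parametrization_of_relations (a := a) (b := b) hu0 hc0
    (by linear_combination r1) (by linear_combination r2) (by linear_combination r3)
    (by linear_combination r4)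
  exact ⟨u, c, hru, hrc, hu0, hc0, h1, h2, h3, h4, h5, by linear_combination h6⟩

theorem exists_parametrization : ∃ u c : ℚ⸨X⸩, HasResidue 1 u ∧ HasResidue 0 c ∧ u ≠ 0 ∧ c ≠ 0 ∧
    c - 1 ≠ 0 ∧ c + 1 ≠ 0 ∧ u ^ 5 = (c - 1) / (c ^ 2 * (c + 1)) ∧
    gaussQuot = 1 + u ^ 2 * (2 * c / (c - 1)) + 2 / (c + 1) / u ^ 2 ∧
    phiQuot = 1 + (1 - c) / c ^ 2 / u ^ 4 + c * (1 + c) * u ^ 4 ∧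
    sig (hauptmodul⁻¹) = 1 + 4 * c / (c ^ 2 - 1) := by
  obtain ⟨α, β, hα, hβ, hP⟩ := exists_eulerQuot_eq
  obtain ⟨a, b, ha, hb, hψ, hN⟩ := exists_gaussQuot_eq
  have hQ := congrArg (dilate 2 two_pos) hP
  rw [map_add, map_sub, map_one] at hQ
  have hPQ := gaussQuot_mul_eulerQuot
  rw [hQ, hψ, hP] at hPQ
  obtain ⟨u, c, hu, hc, hu0, hc0, hc2, hc1, s, rfl, rfl, hφ⟩ :=
    exists_parametrization_aux hα hβ (hasResidue_dilate_two hα) (hasResidue_dilate_two hβ) ha hb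
    hPQ (fun h => dilate_injective two_pos (by rw [map_mul, h, map_neg, map_one]))
  refine ⟨u, c, hu, hc, hu0, hc0, hc2, hc1, s, hψ, ?_, ?_⟩
  · rw [phiQuot, div_eq_iff ((map_ne_zero (dilate 2 two_pos)).mpr eulerQuot_ne_zero), hQ, hP, hφ]
  · have hcc : c ^ 2 - 1 ≠ 0 := by
      have : c ^ 2 - 1 = (c - 1) * (c + 1) := by ring
      rw [this]
      exact mul_ne_zero hc2 hc1
    have hab : u ^ 2 * (2 * c / (c - 1)) * (2 / (c + 1) / u ^ 2) = 4 * c / (c ^ 2 - 1) := by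
      field_simp
      ring
    have ha5 : (u ^ 2 * (2 * c / (c - 1))) ^ 5 =
        32 * c / ((c - 1) ^ 3 * (c + 1) ^ 2) := by
      rw [mul_pow, ← pow_mul, pow_mul u 5 2, s]
      field_simp
      ring
    have hb5 : (2 / (c + 1) / u ^ 2) ^ 5 = 32 * c ^ 4 / ((c - 1) ^ 2 * (c + 1) ^ 3) := by
      rw [div_pow, ← pow_mul, pow_mul u 5 2, s]
      field_simp
      ring
    -- With h = ab = 4c/(c² - 1) one has a⁵ + b⁵ = 8h - 2h² + h³, and the norm becomes the perfect
    -- cube (1 + h)³.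
    apply eq_of_pow_three_eq
    have hσ : sig (hauptmodul⁻¹) ^ 3 = sig (gauss / sig gauss) ^ 6 / qvar ^ 15 := by
      have h0 := gauss_ne_zero
      have h1 := sig_ne_zero h0
      have h2 := sig_ne_zero h1
      have hq := qvar_ne_zero
      rw [hauptmodul, map_inv₀, map_mul, map_pow, map_div₀, map_div₀, sig_qvar, zpow_ofNat]
      generalize sig (sig gauss) = a at *
      generalize sig gauss = b at *
      field_simp
    rw [hσ, ← hN, hab, ha5, hb5]
    field_simp
    ring

end Parametrization

end ElongatedDiamond

/-! ### Values of U and W on the power sums aⁱ + bⁱ. -/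

namespace ElongatedDiamond

open scoped LaurentSeries

section Values

/-- A power of 1 + a + b is symmetric in a and b, hence a combination of power sums with
coefficients in ab = σ(η), and these come out of L. The next three lemmas follow the same pattern.
-/
theorem map_add_pow_two {a b η : ℚ⸨X⸩} (hab : a * b = sig η) (L : ℚ⸨X⸩ →+ ℚ⸨X⸩)
    (hL : ∀ f g, L (sig f * g) = f * L g) : L ((1 + a + b) ^ 2) =
    (1 + 2 * η) * L 1 + (2) * L (a ^ 1 + b ^ 1) + L (a ^ 2 + b ^ 2) := by
  have h : (1 + a + b) ^ 2 =
    sig (1 + 2 * η) * 1 + sig (2) * (a ^ 1 + b ^ 1) + (a ^ 2 + b ^ 2) := by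
    simp only [map_add, map_mul, map_ofNat, map_one, ← hab]
    ring
  rw [h]
  simp only [map_add L, hL]

theorem map_add_pow_four {a b η : ℚ⸨X⸩} (hab : a * b = sig η) (L : ℚ⸨X⸩ →+ ℚ⸨X⸩)
    (hL : ∀ f g, L (sig f * g) = f * L g) : L ((1 + a + b) ^ 4) =
    (1 + 12 * η + 6 * η ^ 2) * L 1 + (4 + 12 * η) * L (a ^ 1 + b ^ 1) +
      (6 + 4 * η) * L (a ^ 2 + b ^ 2) + (4) * L (a ^ 3 + b ^ 3) + L (a ^ 4 + b ^ 4) := by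
  have h : (1 + a + b) ^ 4 =
    sig (1 + 12 * η + 6 * η ^ 2) * 1 + sig (4 + 12 * η) * (a ^ 1 + b ^ 1) +
      sig (6 + 4 * η) * (a ^ 2 + b ^ 2) + sig (4) * (a ^ 3 + b ^ 3) + (a ^ 4 + b ^ 4) := by
    simp only [map_add, map_mul, map_pow, map_ofNat, map_one, ← hab]
    ring
  rw [h]
  simp only [map_add L, hL]

theorem map_add_pow_six {a b η : ℚ⸨X⸩} (hab : a * b = sig η) (L : ℚ⸨X⸩ →+ ℚ⸨X⸩)
    (hL : ∀ f g, L (sig f * g) = f * L g) : L ((1 + a + b) ^ 6) =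
    (1 + 30 * η + 90 * η ^ 2 + 20 * η ^ 3) * L 1 +
      (6 + 60 * η + 60 * η ^ 2) * L (a ^ 1 + b ^ 1) +
      (15 + 60 * η + 15 * η ^ 2) * L (a ^ 2 + b ^ 2) + (20 + 30 * η) * L (a ^ 3 + b ^ 3) +
      (15 + 6 * η) * L (a ^ 4 + b ^ 4) + (6) * L (a ^ 5 + b ^ 5) + L (a ^ 6 + b ^ 6) := by
  have h : (1 + a + b) ^ 6 =
    sig (1 + 30 * η + 90 * η ^ 2 + 20 * η ^ 3) * 1 +
      sig (6 + 60 * η + 60 * η ^ 2) * (a ^ 1 + b ^ 1) +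
      sig (15 + 60 * η + 15 * η ^ 2) * (a ^ 2 + b ^ 2) + sig (20 + 30 * η) * (a ^ 3 + b ^ 3) +
      sig (15 + 6 * η) * (a ^ 4 + b ^ 4) + sig (6) * (a ^ 5 + b ^ 5) + (a ^ 6 + b ^ 6) := by
    simp only [map_add, map_mul, map_pow, map_ofNat, map_one, ← hab]
    ring
  rw [h]
  simp only [map_add L, hL]

theorem map_add_pow_eight {a b η : ℚ⸨X⸩} (hab : a * b = sig η) (L : ℚ⸨X⸩ →+ ℚ⸨X⸩)
    (hL : ∀ f g, L (sig f * g) = f * L g) : L ((1 + a + b) ^ 8) =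
    (1 + 56 * η + 420 * η ^ 2 + 560 * η ^ 3 + 70 * η ^ 4) * L 1 +
      (8 + 168 * η + 560 * η ^ 2 + 280 * η ^ 3) * L (a ^ 1 + b ^ 1) +
      (28 + 280 * η + 420 * η ^ 2 + 56 * η ^ 3) * L (a ^ 2 + b ^ 2) +
      (56 + 280 * η + 168 * η ^ 2) * L (a ^ 3 + b ^ 3) +
      (70 + 168 * η + 28 * η ^ 2) * L (a ^ 4 + b ^ 4) + (56 + 56 * η) * L (a ^ 5 + b ^ 5) +
      (28 + 8 * η) * L (a ^ 6 + b ^ 6) + (8) * L (a ^ 7 + b ^ 7) + L (a ^ 8 + b ^ 8) := by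
  have h : (1 + a + b) ^ 8 =
    sig (1 + 56 * η + 420 * η ^ 2 + 560 * η ^ 3 + 70 * η ^ 4) * 1 +
      sig (8 + 168 * η + 560 * η ^ 2 + 280 * η ^ 3) * (a ^ 1 + b ^ 1) +
      sig (28 + 280 * η + 420 * η ^ 2 + 56 * η ^ 3) * (a ^ 2 + b ^ 2) +
      sig (56 + 280 * η + 168 * η ^ 2) * (a ^ 3 + b ^ 3) +
      sig (70 + 168 * η + 28 * η ^ 2) * (a ^ 4 + b ^ 4) + sig (56 + 56 * η) * (a ^ 5 + b ^ 5) +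
      sig (28 + 8 * η) * (a ^ 6 + b ^ 6) + sig (8) * (a ^ 7 + b ^ 7) + (a ^ 8 + b ^ 8) := by
    simp only [map_add, map_mul, map_pow, map_ofNat, map_one, ← hab]
    ring
  rw [h]
  simp only [map_add L, hL]

/-- The defining properties of the summands of `gaussQuot`, in terms of the parameter `c`. -/
structure IsSplitting (a b c : ℚ⸨X⸩) : Prop where
  hasResidue_a : HasResidue 2 a
  hasResidue_b : HasResidue (-2) b
  hasResidue_c : HasResidue 0 c
  ne_zero : c ≠ 0
  sub_ne_zero : c - 1 ≠ 0
  add_ne_zero : c + 1 ≠ 0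
  gaussQuot_eq : gaussQuot = 1 + a + b
  mul_eq : a * b = 4 * c / (c ^ 2 - 1)
  sig_eq : sig (hauptmodul⁻¹ - 1) = 4 * c / (c ^ 2 - 1)
  a_pow_five : a ^ 5 = 32 * c / ((c - 1) ^ 3 * (c + 1) ^ 2)
  b_pow_five : b ^ 5 = 32 * c ^ 4 / ((c - 1) ^ 2 * (c + 1) ^ 3)
  phiQuot_eq : phiQuot = 1 + (c - 1) ^ 2 * (c + 1) / (4 * c) * a ^ 2 -
    (c - 1) * (c + 1) ^ 2 / (4 * c ^ 2) * b ^ 2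

theorem exists_isSplitting : ∃ a b c : ℚ⸨X⸩, IsSplitting a b c := by
  obtain ⟨u, c, hu, hc, hu0, hc0, hc2, hc1, s, hψ, hφ, hσ⟩ := exists_parametrization
  have hcc : c ^ 2 - 1 ≠ 0 := by
    have : c ^ 2 - 1 = (c - 1) * (c + 1) := by ring
    rw [this]
    exact mul_ne_zero hc2 hc1
  have hone := hasResidue_one
  have h2 : HasResidue 0 (2 : ℚ⸨X⸩) := by
    rw [← one_add_one_eq_two]
    exact hone.add hone
  refine ⟨u ^ 2 * (2 * c / (c - 1)), 2 / (c + 1) / u ^ 2, c, ?_, ?_, hc, hc0, hc2, hc1, hψ, ?_,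
    ?_, ?_, ?_, ?_⟩
  · rw [div_eq_mul_inv]
    exact ((hu.pow 2).mul ((h2.mul hc).mul (hc.sub hone).inv)).congr (by norm_num)
  · rw [div_eq_mul_inv, div_eq_mul_inv]
    exact ((h2.mul (hc.add hone).inv).mul (hu.pow 2).inv).congr (by norm_num)
  · field_simp
    ring
  · rw [map_sub, map_one, hσ]
    ring
  · rw [mul_pow, ← pow_mul, pow_mul u 5 2, s]
    field_simp
    ring
  · rw [div_pow, ← pow_mul, pow_mul u 5 2, s]
    field_simp
    ring
  · rw [hφ]
    field_simp
    ring

/-- The operator `f ↦ U₅ (phiQuot * f)`. -/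
noncomputable def W : ℚ⸨X⸩ →+ ℚ⸨X⸩ := U.comp (AddMonoidHom.mulLeft phiQuot)

theorem W_apply (f : ℚ⸨X⸩) : W f = U (phiQuot * f) := rfl

theorem W_sig_mul (f g : ℚ⸨X⸩) : W (sig f * g) = f * W g := by
  rw [W_apply, mul_left_comm, U_sig_mul, W_apply]

theorem U_one : U 1 = 1 := by
  have h := U_sig 1
  rwa [map_one] at h

theorem U_sub_eq_of_eq {v f g : ℚ⸨X⸩} (h : f - g = sig v) : U f - U g = v := by
  rw [← map_sub, h, U_sig]

theorem U_add_pow_eq_zero {a b : ℚ⸨X⸩} (ha : HasResidue 2 a) (hb : HasResidue (-2) b) {i : ℕ}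
    (hi : ¬ 5 ∣ i) : U (a ^ i + b ^ i) = 0 := by
  rw [map_add, (ha.pow i).U_eq_zero (by omega), (hb.pow i).U_eq_zero (by omega), add_zero]

theorem U_coeff_mul_pow_eq_zero {A a b : ℚ⸨X⸩} (hA : HasResidue 0 A) (ha : HasResidue 2 a)
    (hb : HasResidue (-2) b) {i j : ℕ} (hi : ¬ (5 : ℤ) ∣ (i : ℤ) - j) :
    U (A * (a ^ i * b ^ j)) = 0 :=
  (hA.mul ((ha.pow i).mul (hb.pow j))).U_eq_zero (by omega)

namespace IsSplitting

variable {a b c : ℚ⸨X⸩}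

theorem sq_sub_one_ne_zero (h : IsSplitting a b c) : c ^ 2 - 1 ≠ 0 := by
  have : c ^ 2 - 1 = (c - 1) * (c + 1) := by ring
  rw [this]
  exact mul_ne_zero h.sub_ne_zero h.add_ne_zero

theorem mul_eq_sig (h : IsSplitting a b c) : a * b = sig (hauptmodul⁻¹ - 1) :=
  h.mul_eq.trans h.sig_eq.symm

theorem pow_five_add_pow_five (h : IsSplitting a b c) :
    a ^ 5 + b ^ 5 = sig (8 * (hauptmodul⁻¹ - 1) -
    2 * (hauptmodul⁻¹ - 1) ^ 2 + (hauptmodul⁻¹ - 1) ^ 3) := by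
  rw [map_add, map_sub, map_mul, map_mul, map_pow, map_pow, h.sig_eq, h.a_pow_five, h.b_pow_five,
    map_ofNat, map_ofNat]
  have h1 := h.sq_sub_one_ne_zero
  have h2 := h.sub_ne_zero
  have h3 := h.add_ne_zero
  field_simp
  ring

theorem U_add_pow_five (h : IsSplitting a b c) : U (a ^ 5 + b ^ 5) = 8 * (hauptmodul⁻¹ - 1) -
    2 * (hauptmodul⁻¹ - 1) ^ 2 + (hauptmodul⁻¹ - 1) ^ 3 := by
  rw [h.pow_five_add_pow_five, U_sig]

theorem hasResidue_ratCoeffs (h : IsSplitting a b c) :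
    HasResidue 0 ((c - 1) ^ 2 * (c + 1) / (4 * c)) ∧
    HasResidue 0 ((c - 1) * (c + 1) ^ 2 / (4 * c ^ 2)) := by
  have hone := hasResidue_one
  have h4 : HasResidue 0 (4 : ℚ⸨X⸩) := by
    have : (4 : ℚ⸨X⸩) = 1 + 1 + (1 + 1) := by norm_num
    rw [this]
    exact (hone.add hone).add (hone.add hone)
  have hc := h.hasResidue_c
  have h1 := hc.sub hone
  have h2 := hc.add hone
  rw [div_eq_mul_inv, div_eq_mul_inv]
  exact ⟨(((h1.pow 2).mul h2).mul (h4.mul hc).inv).congr (by norm_num),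
    ((h1.mul (h2.pow 2)).mul (h4.mul (hc.pow 2)).inv).congr (by norm_num)⟩

/-- The parts of φ lie in classes 0, 4 and 1, so the class of each summand is visible: the first can
survive U only for i ≡ 0 mod 5, the mixed ones only for i ≡ 2, the pure a- and b-powers only for i ≡
3. -/
theorem W_add_pow (h : IsSplitting a b c) (i : ℕ) : W (a ^ i + b ^ i) = U (a ^ i + b ^ i) +
    U ((c - 1) ^ 2 * (c + 1) / (4 * c) * (a ^ (i + 2) * b ^ 0)) +
    U ((c - 1) ^ 2 * (c + 1) / (4 * c) * (a ^ 2 * b ^ i)) -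
    U ((c - 1) * (c + 1) ^ 2 / (4 * c ^ 2) * (a ^ i * b ^ 2)) -
    U ((c - 1) * (c + 1) ^ 2 / (4 * c ^ 2) * (a ^ 0 * b ^ (i + 2))) := by
  rw [W_apply, h.phiQuot_eq, ← map_add, ← map_add, ← map_sub, ← map_sub]
  congr 1
  ring

theorem W_one (h : IsSplitting a b c) : W 1 = 1 := by
  obtain ⟨hA, hB⟩ := h.hasResidue_ratCoeffs
  have h2 : W 1 + W 1 = 1 + 1 := by
    rw [← map_add]
    have := h.W_add_pow 0
    rw [U_coeff_mul_pow_eq_zero hA h.hasResidue_a h.hasResidue_b (by norm_num),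
      U_coeff_mul_pow_eq_zero hB h.hasResidue_a h.hasResidue_b (by norm_num)] at this
    simp only [pow_zero, add_zero, sub_zero] at this
    rw [this, map_add, U_one]
  linear_combination (1 / 2 : ℚ⸨X⸩) * h2

theorem W_add_pow_eq_zero (h : IsSplitting a b c) {i : ℕ} (hi : i % 5 = 1 ∨ i % 5 = 4) :
    W (a ^ i + b ^ i) = 0 := by
  obtain ⟨hA, hB⟩ := h.hasResidue_ratCoeffs
  rw [h.W_add_pow, U_add_pow_eq_zero h.hasResidue_a h.hasResidue_b (by omega),
    U_coeff_mul_pow_eq_zero hA h.hasResidue_a h.hasResidue_b (by omega),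
    U_coeff_mul_pow_eq_zero hA h.hasResidue_a h.hasResidue_b (by omega),
    U_coeff_mul_pow_eq_zero hB h.hasResidue_a h.hasResidue_b (by omega),
    U_coeff_mul_pow_eq_zero hB h.hasResidue_a h.hasResidue_b (by omega)]
  simp

theorem W_add_pow_five (h : IsSplitting a b c) : W (a ^ 5 + b ^ 5) = 8 * (hauptmodul⁻¹ - 1) -
    2 * (hauptmodul⁻¹ - 1) ^ 2 + (hauptmodul⁻¹ - 1) ^ 3 := by
  obtain ⟨hA, hB⟩ := h.hasResidue_ratCoeffs
  rw [h.W_add_pow, U_coeff_mul_pow_eq_zero hA h.hasResidue_a h.hasResidue_b (by omega),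
    U_coeff_mul_pow_eq_zero hA h.hasResidue_a h.hasResidue_b (by omega),
    U_coeff_mul_pow_eq_zero hB h.hasResidue_a h.hasResidue_b (by omega),
    U_coeff_mul_pow_eq_zero hB h.hasResidue_a h.hasResidue_b (by omega), h.U_add_pow_five]
  simp

theorem W_add_pow_two (h : IsSplitting a b c) : W (a ^ 2 + b ^ 2) =
    4 - 2 * (hauptmodul⁻¹ - 1) := by
  obtain ⟨hA, hB⟩ := h.hasResidue_ratCoeffs
  have key : U ((c - 1) ^ 2 * (c + 1) / (4 * c) * (a ^ 2 * b ^ 2)) -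
      U ((c - 1) * (c + 1) ^ 2 / (4 * c ^ 2) * (a ^ 2 * b ^ 2)) =
      4 - 2 * (hauptmodul⁻¹ - 1) := by
    apply U_sub_eq_of_eq
    have eA : a ^ 2 * b ^ 2 = (a * b) ^ 2 := by ring
    rw [eA]
    have hs := h.sig_eq
    generalize hauptmodul⁻¹ - 1 = η at hs ⊢
    simp only [map_sub, map_mul, map_ofNat, hs, h.mul_eq]
    have h1 := h.sq_sub_one_ne_zero
    have h2 := h.sub_ne_zero
    have h3 := h.add_ne_zero
    have h4 := h.ne_zero
    field_simp
    ring
  rw [h.W_add_pow, U_add_pow_eq_zero h.hasResidue_a h.hasResidue_b (by norm_num),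
    U_coeff_mul_pow_eq_zero hA h.hasResidue_a h.hasResidue_b (i := 2 + 2) (j := 0) (by norm_num),
    U_coeff_mul_pow_eq_zero hB h.hasResidue_a h.hasResidue_b (i := 0) (j := 2 + 2) (by norm_num),
    ← key]
  ring

theorem W_add_pow_seven (h : IsSplitting a b c) : W (a ^ 7 + b ^ 7) =
    32 * (hauptmodul⁻¹ - 1) - 16 * (hauptmodul⁻¹ - 1) ^ 2 + 8 * (hauptmodul⁻¹ - 1) ^ 3 -
      2 * (hauptmodul⁻¹ - 1) ^ 4 := by
  obtain ⟨hA, hB⟩ := h.hasResidue_ratCoeffs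
  have key : U ((c - 1) ^ 2 * (c + 1) / (4 * c) * (a ^ 2 * b ^ 7)) -
      U ((c - 1) * (c + 1) ^ 2 / (4 * c ^ 2) * (a ^ 7 * b ^ 2)) =
      32 * (hauptmodul⁻¹ - 1) - 16 * (hauptmodul⁻¹ - 1) ^ 2 + 8 * (hauptmodul⁻¹ - 1) ^ 3 -
      2 * (hauptmodul⁻¹ - 1) ^ 4 := by
    apply U_sub_eq_of_eq
    have eA : a ^ 2 * b ^ 7 = (a * b) ^ 2 * b ^ 5 := by ring
    have eB : a ^ 7 * b ^ 2 = (a * b) ^ 2 * a ^ 5 := by ring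
    rw [eA, eB]
    have hs := h.sig_eq
    generalize hauptmodul⁻¹ - 1 = η at hs ⊢
    simp only [map_add, map_sub, map_mul, map_pow, map_ofNat, hs, h.a_pow_five, h.b_pow_five,
      h.mul_eq]
    have h1 := h.sq_sub_one_ne_zero
    have h2 := h.sub_ne_zero
    have h3 := h.add_ne_zero
    have h4 := h.ne_zero
    field_simp
    ring
  rw [h.W_add_pow, U_add_pow_eq_zero h.hasResidue_a h.hasResidue_b (by norm_num),
    U_coeff_mul_pow_eq_zero hA h.hasResidue_a h.hasResidue_b (i := 7 + 2) (j := 0) (by norm_num),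
    U_coeff_mul_pow_eq_zero hB h.hasResidue_a h.hasResidue_b (i := 0) (j := 7 + 2) (by norm_num),
    ← key]
  ring

theorem W_add_pow_three (h : IsSplitting a b c) : W (a ^ 3 + b ^ 3) =
    -8 := by
  obtain ⟨hA, hB⟩ := h.hasResidue_ratCoeffs
  have key : U ((c - 1) ^ 2 * (c + 1) / (4 * c) * (a ^ (3 + 2) * b ^ 0)) -
      U ((c - 1) * (c + 1) ^ 2 / (4 * c ^ 2) * (a ^ 0 * b ^ (3 + 2))) =
      -8 := by
    apply U_sub_eq_of_eq
    have eA : a ^ (3 + 2) * b ^ 0 = a ^ 5 := by ring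
    have eB : a ^ 0 * b ^ (3 + 2) = b ^ 5 := by ring
    rw [eA, eB]
    have hs := h.sig_eq
    generalize hauptmodul⁻¹ - 1 = η at hs ⊢
    simp only [map_neg, map_ofNat, h.a_pow_five, h.b_pow_five]
    have h1 := h.sq_sub_one_ne_zero
    have h2 := h.sub_ne_zero
    have h3 := h.add_ne_zero
    have h4 := h.ne_zero
    field_simp
    ring
  rw [h.W_add_pow, U_add_pow_eq_zero h.hasResidue_a h.hasResidue_b (by norm_num),
    U_coeff_mul_pow_eq_zero hA h.hasResidue_a h.hasResidue_b (i := 2) (j := 3) (by norm_num),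
    U_coeff_mul_pow_eq_zero hB h.hasResidue_a h.hasResidue_b (i := 3) (j := 2) (by norm_num),
    ← key]
  ring

theorem W_add_pow_eight (h : IsSplitting a b c) : W (a ^ 8 + b ^ 8) =
    -64 * (hauptmodul⁻¹ - 1) + 16 * (hauptmodul⁻¹ - 1) ^ 2 - 12 * (hauptmodul⁻¹ - 1) ^ 3 +
      2 * (hauptmodul⁻¹ - 1) ^ 4 := by
  obtain ⟨hA, hB⟩ := h.hasResidue_ratCoeffs
  have key : U ((c - 1) ^ 2 * (c + 1) / (4 * c) * (a ^ (8 + 2) * b ^ 0)) -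
      U ((c - 1) * (c + 1) ^ 2 / (4 * c ^ 2) * (a ^ 0 * b ^ (8 + 2))) =
      -64 * (hauptmodul⁻¹ - 1) + 16 * (hauptmodul⁻¹ - 1) ^ 2 - 12 * (hauptmodul⁻¹ - 1) ^ 3 +
      2 * (hauptmodul⁻¹ - 1) ^ 4 := by
    apply U_sub_eq_of_eq
    have eA : a ^ (8 + 2) * b ^ 0 = (a ^ 5) ^ 2 := by ring
    have eB : a ^ 0 * b ^ (8 + 2) = (b ^ 5) ^ 2 := by ring
    rw [eA, eB]
    have hs := h.sig_eq
    generalize hauptmodul⁻¹ - 1 = η at hs ⊢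
    simp only [map_add, map_sub, map_neg, map_mul, map_pow, map_ofNat, hs, h.a_pow_five,
      h.b_pow_five]
    have h1 := h.sq_sub_one_ne_zero
    have h2 := h.sub_ne_zero
    have h3 := h.add_ne_zero
    have h4 := h.ne_zero
    field_simp
    ring
  rw [h.W_add_pow, U_add_pow_eq_zero h.hasResidue_a h.hasResidue_b (by norm_num),
    U_coeff_mul_pow_eq_zero hA h.hasResidue_a h.hasResidue_b (i := 2) (j := 8) (by norm_num),
    U_coeff_mul_pow_eq_zero hB h.hasResidue_a h.hasResidue_b (i := 8) (j := 2) (by norm_num),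
    ← key]
  ring

end IsSplitting

end Values

end ElongatedDiamond

/-! ### Values at negative powers of x, the modular equation and the functional equation of D. -/

namespace ElongatedDiamond

open scoped LaurentSeries

section Values

/-- This is why initial values are taken at negative powers: U(x⁻ⁿ) = xⁿU(Ψ²ⁿ), where Ψ²ⁿ is a
polynomial in a and b. -/
theorem inv_hauptmodul_pow (n : ℕ) :
    hauptmodul⁻¹ ^ n = sig (hauptmodul ^ n) * gaussQuot ^ (2 * n) := by
  have h := hauptmodul_mul_sig
  have h0 := hauptmodul_ne_zero
  rw [map_pow, pow_mul, ← mul_pow]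
  congr 1
  field_simp
  linear_combination -h

theorem U_inv_hauptmodul_pow_zero : U (hauptmodul⁻¹ ^ 0) = 1 := by
  rw [pow_zero, U_one]

theorem U_inv_hauptmodul_pow_one : U (hauptmodul⁻¹ ^ 1) = 2 - hauptmodul := by
  obtain ⟨a, b, c, h⟩ := exists_isSplitting
  rw [inv_hauptmodul_pow, U_sig_mul, h.gaussQuot_eq,
    map_add_pow_two h.mul_eq_sig U U_sig_mul,
    U_add_pow_eq_zero h.hasResidue_a h.hasResidue_b (i := 1) (by norm_num),
    U_add_pow_eq_zero h.hasResidue_a h.hasResidue_b (i := 2) (by norm_num),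
    U_one]
  have h0 := hauptmodul_ne_zero
  field_simp
  ring

theorem U_inv_hauptmodul_pow_two : U (hauptmodul⁻¹ ^ 2) = 6 - 5 * hauptmodul ^ 2 := by
  obtain ⟨a, b, c, h⟩ := exists_isSplitting
  rw [inv_hauptmodul_pow, U_sig_mul, h.gaussQuot_eq,
    map_add_pow_four h.mul_eq_sig U U_sig_mul,
    U_add_pow_eq_zero h.hasResidue_a h.hasResidue_b (i := 1) (by norm_num),
    U_add_pow_eq_zero h.hasResidue_a h.hasResidue_b (i := 2) (by norm_num),
    U_add_pow_eq_zero h.hasResidue_a h.hasResidue_b (i := 3) (by norm_num),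
    U_add_pow_eq_zero h.hasResidue_a h.hasResidue_b (i := 4) (by norm_num),
    U_one]
  have h0 := hauptmodul_ne_zero
  field_simp
  ring

theorem U_inv_hauptmodul_pow_three : U (hauptmodul⁻¹ ^ 3) = 26 - 25 * hauptmodul ^ 3 := by
  obtain ⟨a, b, c, h⟩ := exists_isSplitting
  rw [inv_hauptmodul_pow, U_sig_mul, h.gaussQuot_eq,
    map_add_pow_six h.mul_eq_sig U U_sig_mul,
    U_add_pow_eq_zero h.hasResidue_a h.hasResidue_b (i := 1) (by norm_num),
    U_add_pow_eq_zero h.hasResidue_a h.hasResidue_b (i := 2) (by norm_num),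
    U_add_pow_eq_zero h.hasResidue_a h.hasResidue_b (i := 3) (by norm_num),
    U_add_pow_eq_zero h.hasResidue_a h.hasResidue_b (i := 4) (by norm_num),
    h.U_add_pow_five,
    U_add_pow_eq_zero h.hasResidue_a h.hasResidue_b (i := 6) (by norm_num),
    U_one]
  have h0 := hauptmodul_ne_zero
  field_simp
  ring

theorem U_inv_hauptmodul_pow_four : U (hauptmodul⁻¹ ^ 4) = 126 - 125 * hauptmodul ^ 4 := by
  obtain ⟨a, b, c, h⟩ := exists_isSplitting
  rw [inv_hauptmodul_pow, U_sig_mul, h.gaussQuot_eq,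
    map_add_pow_eight h.mul_eq_sig U U_sig_mul,
    U_add_pow_eq_zero h.hasResidue_a h.hasResidue_b (i := 1) (by norm_num),
    U_add_pow_eq_zero h.hasResidue_a h.hasResidue_b (i := 2) (by norm_num),
    U_add_pow_eq_zero h.hasResidue_a h.hasResidue_b (i := 3) (by norm_num),
    U_add_pow_eq_zero h.hasResidue_a h.hasResidue_b (i := 4) (by norm_num),
    h.U_add_pow_five,
    U_add_pow_eq_zero h.hasResidue_a h.hasResidue_b (i := 6) (by norm_num),
    U_add_pow_eq_zero h.hasResidue_a h.hasResidue_b (i := 7) (by norm_num),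
    U_add_pow_eq_zero h.hasResidue_a h.hasResidue_b (i := 8) (by norm_num),
    U_one]
  have h0 := hauptmodul_ne_zero
  field_simp
  ring

theorem W_inv_hauptmodul_pow_zero : W (hauptmodul⁻¹ ^ 0) = 1 := by
  rw [pow_zero]
  obtain ⟨a, b, c, h⟩ := exists_isSplitting
  exact h.W_one

theorem W_inv_hauptmodul_pow_one : W (hauptmodul⁻¹ ^ 1) = 5 * hauptmodul := by
  obtain ⟨a, b, c, h⟩ := exists_isSplitting
  rw [inv_hauptmodul_pow, W_sig_mul, h.gaussQuot_eq,
    map_add_pow_two h.mul_eq_sig W W_sig_mul,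
    h.W_add_pow_eq_zero (i := 1) (by norm_num),
    h.W_add_pow_two,
    h.W_one]
  have h0 := hauptmodul_ne_zero
  field_simp
  ring

theorem W_inv_hauptmodul_pow_two :
    W (hauptmodul⁻¹ ^ 2) = -2 + 20 * hauptmodul - 25 * hauptmodul ^ 2 := by
  obtain ⟨a, b, c, h⟩ := exists_isSplitting
  rw [inv_hauptmodul_pow, W_sig_mul, h.gaussQuot_eq,
    map_add_pow_four h.mul_eq_sig W W_sig_mul,
    h.W_add_pow_eq_zero (i := 1) (by norm_num),
    h.W_add_pow_two,
    h.W_add_pow_three,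
    h.W_add_pow_eq_zero (i := 4) (by norm_num),
    h.W_one]
  have h0 := hauptmodul_ne_zero
  field_simp
  ring

theorem W_inv_hauptmodul_pow_three :
    W (hauptmodul⁻¹ ^ 3) = -4 + 30 * hauptmodul - 125 * hauptmodul ^ 3 := by
  obtain ⟨a, b, c, h⟩ := exists_isSplitting
  rw [inv_hauptmodul_pow, W_sig_mul, h.gaussQuot_eq,
    map_add_pow_six h.mul_eq_sig W W_sig_mul,
    h.W_add_pow_eq_zero (i := 1) (by norm_num),
    h.W_add_pow_two,
    h.W_add_pow_three,
    h.W_add_pow_eq_zero (i := 4) (by norm_num),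
    h.W_add_pow_five,
    h.W_add_pow_eq_zero (i := 6) (by norm_num),
    h.W_one]
  have h0 := hauptmodul_ne_zero
  field_simp
  ring

theorem W_inv_hauptmodul_pow_four :
    W (hauptmodul⁻¹ ^ 4) = -60 * hauptmodul + 600 * hauptmodul ^ 2 - 1500 * hauptmodul ^ 3 +
      625 * hauptmodul ^ 4 := by
  obtain ⟨a, b, c, h⟩ := exists_isSplitting
  rw [inv_hauptmodul_pow, W_sig_mul, h.gaussQuot_eq,
    map_add_pow_eight h.mul_eq_sig W W_sig_mul,
    h.W_add_pow_eq_zero (i := 1) (by norm_num),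
    h.W_add_pow_two,
    h.W_add_pow_three,
    h.W_add_pow_eq_zero (i := 4) (by norm_num),
    h.W_add_pow_five,
    h.W_add_pow_eq_zero (i := 6) (by norm_num),
    h.W_add_pow_seven,
    h.W_add_pow_eight,
    h.W_one]
  have h0 := hauptmodul_ne_zero
  field_simp
  ring

theorem modular_equation : hauptmodul ^ 5 = sig hauptmodul * (1 +
    (-10 + 5 * sig hauptmodul) * hauptmodul +
    (35 - 50 * sig hauptmodul + 25 * sig hauptmodul ^ 2) * hauptmodul ^ 2 +
    (-60 + 175 * sig hauptmodul - 250 * sig hauptmodul ^ 2 + 125 * sig hauptmodul ^ 3) *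
      hauptmodul ^ 3 +
    (55 - 300 * sig hauptmodul + 875 * sig hauptmodul ^ 2 - 1250 * sig hauptmodul ^ 3 +
      625 * sig hauptmodul ^ 4) * hauptmodul ^ 4) := by
  obtain ⟨a, b, c, h⟩ := exists_isSplitting
  have hx := hauptmodul_ne_zero
  have hX := sig_ne_zero hx
  have hxX := hauptmodul_mul_sig
  have h1 := h.pow_five_add_pow_five
  have h2 := h.mul_eq_sig
  have h3 := h.gaussQuot_eq
  have hp := gaussQuot_ne_zero
  simp only [map_add, map_sub, map_mul, map_pow, map_ofNat, map_inv₀, map_one] at h1 h2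
  generalize sig hauptmodul = X at *
  generalize hauptmodul = x at *
  generalize gaussQuot = p at *
  obtain rfl : x = (X * p ^ 2)⁻¹ := by
    field_simp
    linear_combination hxX
  have hab : X * (a * b) = 1 - X := by
    rw [h2]
    field_simp
  -- The quintic for a + b = Ψ - 1, from (a+b)⁵ - 5ab(a+b)³ + 5(ab)²(a+b) = a⁵ + b⁵, with
  -- denominators in X = σ(x) cleared.
  have hp5 : X ^ 3 * (p - 1) ^ 5 - 5 * X ^ 2 * (1 - X) * (p - 1) ^ 3 +
      5 * X * (1 - X) ^ 2 * (p - 1) -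
      8 * X ^ 2 * (1 - X) + 2 * X * (1 - X) ^ 2 - (1 - X) ^ 3 = 0 := by
    have e1 : X ^ 3 * (a ^ 5 + b ^ 5) =
        8 * X ^ 2 * (1 - X) - 2 * X * (1 - X) ^ 2 + (1 - X) ^ 3 := by
      rw [h1]
      field_simp
    rw [← hab] at e1 ⊢
    rw [h3]
    linear_combination e1
  field_simp
  -- Multiplying the quintic at p by its value at -p leaves a polynomial in p² = 1/(xX).
  linear_combination (X ^ 3 * (-p - 1) ^ 5 - 5 * X ^ 2 * (1 - X) * (-p - 1) ^ 3 +
    5 * X * (1 - X) ^ 2 * (-p - 1) -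
      8 * X ^ 2 * (1 - X) + 2 * X * (1 - X) ^ 2 - (1 - X) ^ 3) * hp5

theorem one_sub_hauptmodul_ne_zero : 1 - hauptmodul ≠ 0 := by
  obtain ⟨a, b, c, h⟩ := exists_isSplitting
  intro h0
  have h1 := h.sig_eq
  have h2 : hauptmodul = 1 := by linear_combination -h0
  rw [h2, inv_one, sub_self, map_zero, eq_comm, div_eq_zero_iff] at h1
  rcases h1 with h1 | h1
  · exact h.ne_zero (by linear_combination (1 / 4 : ℚ⸨X⸩) * h1)
  · exact h.sq_sub_one_ne_zero h1

/-- The quotient `(1 - 5 x) / (1 - x)` for the Hauptmodul `x`. -/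
noncomputable def mobius : ℚ⸨X⸩ := (1 - 5 * hauptmodul) / (1 - hauptmodul)

/-- Multiplication in the span of 1, a, b, a², b² over the coefficients: a³ and b² lie in the same
residue class, as do b³ and a², so the span closes up. -/
theorem quintic_product {F : Type*} [Field F] {a b H S T f₀ f₁ f₂ f₃ f₄ g : F} (hab : a * b = H)
    (ha : a ^ 3 = T * b ^ 2) (hb : b ^ 3 = S * a ^ 2) :
    (f₀ + f₁ * a ^ 2 + f₂ * b ^ 2 + f₃ * b + f₄ * a) * (g + 2 * a + 2 * b + a ^ 2 + b ^ 2) =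
      f₀ * g + 2 * H * (f₃ + f₄) + H ^ 2 * (f₁ + f₂) +
      (2 * f₀ + f₄ * g + 2 * f₁ * H + f₂ * S * H + f₃ * H) * a +
      (2 * f₀ + f₃ * g + 2 * f₂ * H + f₁ * T * H + f₄ * H) * b +
      (f₀ + f₁ * g + 2 * f₂ * S + f₃ * S + 2 * f₄) * a ^ 2 +
      (f₀ + f₂ * g + 2 * f₁ * T + f₄ * T + 2 * f₃) * b ^ 2 := by
  subst hab
  linear_combination (2 * f₁ + f₄ + f₁ * a) * ha + (2 * f₂ + f₃ + f₂ * b) * hb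

theorem mobius_identity {F : Type*} [Field F] [CharZero F] {a b c p φ x X : F} (hc0 : c ≠ 0)
    (hc1 : c - 1 ≠ 0) (hc2 : c + 1 ≠ 0) (hX0 : X ≠ 0) (hp0 : p ≠ 0)
    (hp : p = 1 + a + b) (hab : a * b = 4 * c / (c ^ 2 - 1))
    (ha : a ^ 3 = 2 / (c * (c - 1)) * b ^ 2) (hb : b ^ 3 = 2 * c ^ 2 / (c + 1) * a ^ 2)
    (hX : X⁻¹ - 1 = 4 * c / (c ^ 2 - 1)) (hx : x * X * p ^ 2 = 1)
    (hφ : φ = 1 + (c - 1) ^ 2 * (c + 1) / (4 * c) * a ^ 2 -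
      (c - 1) * (c + 1) ^ 2 / (4 * c ^ 2) * b ^ 2) :
    (1 - 5 * x) * (1 - 5 * X) = φ ^ 2 * ((1 - x) * (1 - X)) := by
  have hcc : c ^ 2 - 1 ≠ 0 := by
    have : c ^ 2 - 1 = (c - 1) * (c + 1) := by ring
    rw [this]
    exact mul_ne_zero hc1 hc2
  have hX1 : X * (c ^ 2 + 4 * c - 1) = c ^ 2 - 1 := by
    field_simp at hX
    linear_combination -hX
  have hc4 : c ^ 2 + 4 * c - 1 ≠ 0 := fun h => hcc (by rw [← hX1, h, mul_zero])
  have hX' : X = (c ^ 2 - 1) / (c ^ 2 + 4 * c - 1) := by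
    rw [eq_div_iff hc4, hX1]
  have e1 : φ ^ 2 = 1 - 2 * (c ^ 2 - 1) / c + (c - 1) ^ 2 * (c + 1) / (2 * c) * a ^ 2 -
      (c - 1) * (c + 1) ^ 2 / (2 * c ^ 2) * b ^ 2 +
      (c - 1) ^ 2 * (c + 1) / (2 * c ^ 2) * b + (c - 1) * (c + 1) ^ 2 / (2 * c) * a := by
    have ha4 : a ^ 4 = 8 / ((c - 1) ^ 2 * (c + 1)) * b := by
      have : a ^ 4 = 2 / (c * (c - 1)) * (a * b) * b := by linear_combination a * ha
      rw [this, hab]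
      field_simp
      ring
    have hb4 : b ^ 4 = 8 * c ^ 3 / ((c + 1) ^ 2 * (c - 1)) * a := by
      have : b ^ 4 = 2 * c ^ 2 / (c + 1) * (a * b) * a := by linear_combination b * hb
      rw [this, hab]
      field_simp
      ring
    have hab2 : (c ^ 2 - 1) ^ 2 * (a * b) ^ 2 = 16 * c ^ 2 := by
      rw [hab]
      field_simp
      ring
    have e : φ ^ 2 = 1 + (c - 1) ^ 2 * (c + 1) / (2 * c) * a ^ 2 -
        (c - 1) * (c + 1) ^ 2 / (2 * c ^ 2) * b ^ 2 +
        ((c - 1) ^ 2 * (c + 1) / (4 * c)) ^ 2 * a ^ 4 +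
        ((c - 1) * (c + 1) ^ 2 / (4 * c ^ 2)) ^ 2 * b ^ 4 -
        (c ^ 2 - 1) / (8 * c ^ 3) * ((c ^ 2 - 1) ^ 2 * (a * b) ^ 2) := by
      rw [hφ]
      field_simp
      ring
    rw [e, hab2, ha4, hb4]
    field_simp
    ring
  -- As x = 1/(Xp²), this says (1 - 5x)/(1 - x) = cφ²/(1 + c - c²), while `hX2` below says (1 -
  -- 5X)/(1 - X) = (1 + c - c²)/c; the factors in c cancel.
  have key : (X * p ^ 2 - 5) * (1 + c - c ^ 2) = c * φ ^ 2 * (X * p ^ 2 - 1) := by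
    have e2 : p ^ 2 = (1 + 2 * (4 * c / (c ^ 2 - 1))) + 2 * a + 2 * b + a ^ 2 + b ^ 2 := by
      rw [hp, ← hab]
      ring
    have e3 := quintic_product (f₀ := 1 - 2 * (c ^ 2 - 1) / c)
      (f₁ := (c - 1) ^ 2 * (c + 1) / (2 * c)) (f₂ := -((c - 1) * (c + 1) ^ 2 / (2 * c ^ 2)))
      (f₃ := (c - 1) ^ 2 * (c + 1) / (2 * c ^ 2)) (f₄ := (c - 1) * (c + 1) ^ 2 / (2 * c))
      (g := 1 + 2 * (4 * c / (c ^ 2 - 1))) hab ha hb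
    rw [← e2] at e3
    have e4 : φ ^ 2 * p ^ 2 = _ := (congrArg (· * p ^ 2) (e1.trans (by ring))).trans e3
    have e5 : (c ^ 2 + 4 * c - 1) *
        ((X * p ^ 2 - 5) * (1 + c - c ^ 2) - c * φ ^ 2 * (X * p ^ 2 - 1)) =
        (c ^ 2 - 1) * (1 + c - c ^ 2) * p ^ 2 - 5 * (c ^ 2 + 4 * c - 1) * (1 + c - c ^ 2) -
          c * (c ^ 2 - 1) * (φ ^ 2 * p ^ 2) + c * (c ^ 2 + 4 * c - 1) * φ ^ 2 := by
      linear_combination ((1 + c - c ^ 2) * p ^ 2 - c * φ ^ 2 * p ^ 2) * hX1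
    rw [← sub_eq_zero]
    apply (mul_eq_zero.mp (e5.trans ?_)).resolve_left hc4
    rw [e4, e1, e2]
    field_simp
    ring
  have hx' : x = (X * p ^ 2)⁻¹ := by
    field_simp
    linear_combination hx
  have hX2 : (1 - 5 * X) * c = (1 - X) * (1 + c - c ^ 2) := by linear_combination -hX1
  apply mul_right_cancel₀ (mul_ne_zero hc0 (mul_ne_zero hX0 (pow_ne_zero 2 hp0)))
  have hx2 : X * p ^ 2 * x = 1 := by linear_combination hx
  linear_combination (X * p ^ 2 - 5) * hX2 + (1 - X) * key +
    (-5 * (1 - 5 * X) * c + φ ^ 2 * (1 - X) * c) * hx2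

theorem phiQuot_ne_zero : phiQuot ≠ 0 :=
  div_ne_zero (pow_ne_zero 2 eulerQuot_ne_zero) ((map_ne_zero _).mpr eulerQuot_ne_zero)

theorem mobius_mul_sig : mobius * sig mobius = phiQuot ^ 2 := by
  obtain ⟨a, b, c, h⟩ := exists_isSplitting
  have h1 := one_sub_hauptmodul_ne_zero
  have h2 := sig_ne_zero h1
  have hcc := h.sq_sub_one_ne_zero
  have hc0 := h.ne_zero
  have hc1 := h.sub_ne_zero
  have hc2 := h.add_ne_zero
  have hab : a * b ≠ 0 := by
    rw [h.mul_eq]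
    exact div_ne_zero (mul_ne_zero (by norm_num) hc0) hcc
  have ha : a ^ 3 = 2 / (c * (c - 1)) * b ^ 2 := by
    apply mul_right_cancel₀ (pow_ne_zero 2 hab)
    have : a ^ 3 * (a * b) ^ 2 = a ^ 5 * b ^ 2 := by ring
    rw [this, h.a_pow_five, h.mul_eq]
    field_simp
    ring
  have hb : b ^ 3 = 2 * c ^ 2 / (c + 1) * a ^ 2 := by
    apply mul_right_cancel₀ (pow_ne_zero 2 hab)
    have : b ^ 3 * (a * b) ^ 2 = b ^ 5 * a ^ 2 := by ring
    rw [this, h.b_pow_five, h.mul_eq]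
    field_simp
    ring
  have hX := h.sig_eq
  rw [map_sub, map_inv₀, map_one] at hX
  have key := mobius_identity hc0 hc1 hc2 (sig_ne_zero hauptmodul_ne_zero) gaussQuot_ne_zero
    h.gaussQuot_eq h.mul_eq ha hb hX hauptmodul_mul_sig h.phiQuot_eq
  rw [map_sub, map_one] at h2
  rw [mobius, map_div₀, map_sub, map_sub, map_mul, map_one, map_ofNat, div_mul_div_comm,
    div_eq_iff (mul_ne_zero h1 h2), key]

theorem mobius_ne_zero : mobius ≠ 0 := fun h => by
  have h1 := mobius_mul_sig
  rw [h, zero_mul] at h1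
  exact pow_ne_zero 2 phiQuot_ne_zero h1.symm

/-- The multiplier `x (1 - x)⁵ / (1 - 5 x)⁵`. -/
noncomputable def kappa : ℚ⸨X⸩ := hauptmodul / mobius ^ 5

/-- The generating function as a Laurent series. -/
noncomputable def diamond : ℚ⸨X⸩ :=
  HahnSeries.ofPowerSeries ℤ ℚ (PowerSeries.map (Int.castRingHom ℚ) (diamondSeries 5))

theorem diamond_mul_euler : diamond * euler ^ 16 = dilate 2 two_pos euler ^ 5 := by
  have h := congrArg (fun f => HahnSeries.ofPowerSeries ℤ ℚ (PowerSeries.map (Int.castRingHom ℚ) f))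
    (diamondSeries_mul 5)
  simp only [map_mul, map_pow, map_expand', map_pentagonalSeries] at h
  rw [coe_expand two_pos] at h
  exact h

theorem diamond_eq : diamond = dilate 2 two_pos euler ^ 5 / euler ^ 16 :=
  eq_div_of_mul_eq (pow_ne_zero _ euler_ne_zero) diamond_mul_euler

theorem eta_quotient_identity {F : Type*} [Field F] {q e e' d d' : F} (hq : q ≠ 0) (he : e ≠ 0)
    (he' : e' ≠ 0) (hd : d ≠ 0) (hd' : d' ≠ 0) : q ^ 6 * (d ^ 5 / e ^ 16) =
      (d / (q ^ 2 * d')) ^ 5 / (e / (q * e')) ^ 16 * (d' ^ 5 / e' ^ 16) := by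
  field_simp

theorem eta_quotient_identity' {F : Type*} [Field F] {P Q : F} (hP : P ≠ 0) (hQ : Q ≠ 0) :
    Q ^ 5 / P ^ 16 = 1 / ((Q ^ 2 / P) ^ 2 * (P ^ 2 / Q) ^ 10) * (P ^ 2 / Q) := by
  field_simp

/-- With Q = P(q²), the ratio q⁶D/σσ(D) is Q⁵/P¹⁶ = Ψ⁻²φ⁻⁹. From xσ(x) = Ψ⁻² and yσ(y) = φ² one gets
κσ(κ) = Ψ⁻²φ⁻¹⁰, so a single φ remains; it is what distinguishes W from U. -/
theorem qvar_pow_six_mul_diamond :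
    qvar ^ 6 * diamond = kappa * sig kappa * phiQuot * sig (sig diamond) := by
  have hx := hauptmodul_mul_sig
  have hy := mobius_mul_sig
  have hp := gaussQuot_mul_eulerQuot
  have hP0 := eulerQuot_ne_zero
  have hQ0 : dilate 2 two_pos eulerQuot ≠ 0 := (map_ne_zero _).mpr hP0
  have hΨ0 := gaussQuot_ne_zero
  have hφ0 := phiQuot_ne_zero
  have hy0 := mobius_ne_zero
  have hsy0 := sig_ne_zero hy0
  have hκ : kappa * sig kappa = 1 / (gaussQuot ^ 2 * phiQuot ^ 10) := by
    have : phiQuot ^ 10 = (mobius * sig mobius) ^ 5 := by rw [hy]; ring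
    rw [this, kappa, map_div₀, map_pow]
    field_simp
    linear_combination hx
  have h3 : dilate 2 two_pos eulerQuot =
      dilate 2 two_pos euler / (qvar ^ 2 * sig (sig (dilate 2 two_pos euler))) := by
    rw [eulerQuot, map_div₀, map_mul, dilate_qvar, dilate_two_sig, dilate_two_sig]
    rfl
  have hD : qvar ^ 6 * diamond =
      dilate 2 two_pos eulerQuot ^ 5 / eulerQuot ^ 16 * sig (sig diamond) := by
    have he := euler_ne_zero
    have hd : dilate 2 two_pos euler ≠ 0 := (map_ne_zero _).mpr he
    rw [h3, diamond_eq, eulerQuot, map_div₀, map_div₀, map_pow, map_pow, map_pow, map_pow]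
    exact eta_quotient_identity qvar_ne_zero he (sig_ne_zero (sig_ne_zero he)) hd
      (sig_ne_zero (sig_ne_zero hd))
  have hΨ : gaussQuot = dilate 2 two_pos eulerQuot ^ 2 / eulerQuot := eq_div_of_mul_eq hP0 hp
  rw [hD, hκ, phiQuot, hΨ]
  exact congrArg (· * _) (eta_quotient_identity' hP0 hQ0)

end Values

end ElongatedDiamond

/-! ### Orders of vanishing and series with constant term one. -/

namespace ElongatedDiamond

open scoped LaurentSeries
open PowerSeries (pentagonalSeries expand)

section Truncation

/-- The Laurent series `f` vanishes to order at least `N`. -/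
def VanishesTo (N : ℤ) (f : ℚ⸨X⸩) : Prop :=
  ∃ h : PowerSeries ℚ, f = qvar ^ N * HahnSeries.ofPowerSeries ℤ ℚ h

theorem VanishesTo.add {N : ℤ} {f g : ℚ⸨X⸩} (hf : VanishesTo N f) (hg : VanishesTo N g) :
    VanishesTo N (f + g) := by
  obtain ⟨f, rfl⟩ := hf
  obtain ⟨g, rfl⟩ := hg
  exact ⟨f + g, by rw [map_add, mul_add]⟩

theorem VanishesTo.mul {N M : ℤ} {f g : ℚ⸨X⸩} (hf : VanishesTo N f) (hg : VanishesTo M g) :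
    VanishesTo (N + M) (f * g) := by
  obtain ⟨f, rfl⟩ := hf
  obtain ⟨g, rfl⟩ := hg
  exact ⟨f * g, by rw [map_mul, zpow_add₀ qvar_ne_zero]; ring⟩

theorem VanishesTo.pow {N : ℤ} {f : ℚ⸨X⸩} (hf : VanishesTo N f) (n : ℕ) :
    VanishesTo (N * n) (f ^ n) := by
  obtain ⟨f, rfl⟩ := hf
  exact ⟨f ^ n, by rw [map_pow, mul_pow, zpow_mul, zpow_natCast]⟩

theorem VanishesTo.mono {N M : ℤ} {f : ℚ⸨X⸩} (hf : VanishesTo N f) (h : M ≤ N) :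
    VanishesTo M f := by
  obtain ⟨f, rfl⟩ := hf
  obtain ⟨k, rfl⟩ := Int.le.dest h
  refine ⟨PowerSeries.X ^ k * f, ?_⟩
  rw [map_mul, map_pow, coe_X, zpow_add₀ qvar_ne_zero, zpow_natCast]
  ring

theorem vanishesTo_coe (f : PowerSeries ℚ) : VanishesTo 0 (HahnSeries.ofPowerSeries ℤ ℚ f) :=
  ⟨f, by simp⟩

theorem vanishesTo_qvar_zpow (N : ℤ) : VanishesTo N (qvar ^ N) := ⟨1, by simp⟩

theorem vanishesTo_natCast (n : ℕ) : VanishesTo 0 (n : ℚ⸨X⸩) := ⟨n, by simp⟩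

theorem vanishesTo_intCast (n : ℤ) : VanishesTo 0 (n : ℚ⸨X⸩) := ⟨n, by simp⟩

theorem VanishesTo.coeff_eq_zero {N n : ℤ} {f : ℚ⸨X⸩} (hf : VanishesTo N f) (hn : n < N) :
    f.coeff n = 0 := by
  obtain ⟨f, rfl⟩ := hf
  rw [coeff_qvar_zpow_mul, PowerSeries.coeff_coe, if_pos (by omega)]

theorem VanishesTo.U {N : ℤ} {f : ℚ⸨X⸩} (hf : VanishesTo (5 * N) f) : VanishesTo N (U f) := by
  obtain ⟨f, rfl⟩ := hf
  rw [U_qvar_zpow_five_mul]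
  refine ⟨PowerSeries.mk fun n => f.coeff (5 * n), ?_⟩
  congr 1
  ext m
  rw [coeff_U, PowerSeries.coeff_coe, PowerSeries.coeff_coe]
  by_cases hm : m < 0
  · rw [if_pos hm, if_pos (by omega)]
  · rw [if_neg hm, if_neg (by omega), PowerSeries.coeff_mk]
    congr 2
    omega

/-- The Laurent series `f` is a power series with constant coefficient one. -/
def IsMonic (f : ℚ⸨X⸩) : Prop :=
  ∃ h : PowerSeries ℚ, PowerSeries.constantCoeff h = 1 ∧ f = HahnSeries.ofPowerSeries ℤ ℚ h

theorem IsMonic.vanishesTo {f : ℚ⸨X⸩} (hf : IsMonic f) : VanishesTo 0 f := by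
  obtain ⟨h, -, rfl⟩ := hf
  exact vanishesTo_coe h

theorem IsMonic.mul {f g : ℚ⸨X⸩} (hf : IsMonic f) (hg : IsMonic g) : IsMonic (f * g) := by
  obtain ⟨f, hf, rfl⟩ := hf
  obtain ⟨g, hg, rfl⟩ := hg
  exact ⟨f * g, by rw [map_mul, hf, hg, one_mul], (map_mul _ _ _).symm⟩

theorem isMonic_one : IsMonic 1 := ⟨1, by simp, (map_one _).symm⟩

theorem IsMonic.pow {f : ℚ⸨X⸩} (hf : IsMonic f) (n : ℕ) : IsMonic (f ^ n) := by
  induction n with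
  | zero => rw [pow_zero]; exact isMonic_one
  | succ n ih => rw [pow_succ]; exact ih.mul hf

theorem IsMonic.inv {f : ℚ⸨X⸩} (hf : IsMonic f) : IsMonic f⁻¹ := by
  obtain ⟨f, hf, rfl⟩ := hf
  have h0 : PowerSeries.constantCoeff f ≠ 0 := by rw [hf]; exact one_ne_zero
  refine ⟨f⁻¹, by rw [PowerSeries.constantCoeff_inv, hf, inv_one], ?_⟩
  refine inv_eq_of_mul_eq_one_right ?_
  rw [← map_mul, PowerSeries.mul_inv_cancel f h0, map_one]

theorem IsMonic.div {f g : ℚ⸨X⸩} (hf : IsMonic f) (hg : IsMonic g) : IsMonic (f / g) :=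
  div_eq_mul_inv f g ▸ hf.mul hg.inv

theorem IsMonic.dilate {d : ℕ} (hd : 0 < d) {f : ℚ⸨X⸩} (hf : IsMonic f) :
    IsMonic (dilate d hd f) := by
  obtain ⟨f, hf, rfl⟩ := hf
  exact ⟨expand d hd.ne' f, by rw [PowerSeries.constantCoeff_expand, hf], (coe_expand hd f).symm⟩

theorem IsMonic.sig {f : ℚ⸨X⸩} (hf : IsMonic f) : IsMonic (sig f) := hf.dilate _

theorem isMonic_one_sub {f : ℚ⸨X⸩} (hf : VanishesTo 1 f) : IsMonic (1 - f) := by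
  obtain ⟨f, rfl⟩ := hf
  refine ⟨1 - PowerSeries.X * f, by simp, ?_⟩
  rw [map_sub, map_one, map_mul, coe_X, zpow_one]

theorem isMonic_euler : IsMonic euler := ⟨_, constantCoeff_pentagonalSeries ℚ, rfl⟩

theorem isMonic_gauss : IsMonic gauss := by
  refine ⟨_, ?_, rfl⟩
  rw [← PowerSeries.coeff_zero_eq_constantCoeff_apply, triangularSeries, PowerSeries.coeff_mk,
    if_pos ⟨0, rfl⟩]

theorem isMonic_hauptmodul_div : IsMonic (hauptmodul / qvar) := by
  have hq := qvar_ne_zero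
  rw [hauptmodul, mul_div_cancel_left₀ _ hq]
  exact (isMonic_gauss.sig.div isMonic_gauss).pow 2

theorem vanishesTo_hauptmodul : VanishesTo 1 hauptmodul := by
  have h := (vanishesTo_qvar_zpow 1).mul isMonic_hauptmodul_div.vanishesTo
  rwa [zpow_one, mul_div_cancel₀ _ qvar_ne_zero] at h

theorem vanishesTo_inv_hauptmodul : VanishesTo (-1) hauptmodul⁻¹ := by
  have h := (vanishesTo_qvar_zpow (-1)).mul isMonic_hauptmodul_div.inv.vanishesTo
  have hq := qvar_ne_zero
  rwa [zpow_neg_one, inv_div, inv_mul_eq_div, div_div, mul_comm, ← div_div, div_self hq,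
    one_div] at h

theorem isMonic_one_sub_hauptmodul : IsMonic (1 - hauptmodul) :=
  isMonic_one_sub vanishesTo_hauptmodul

theorem isMonic_one_sub_five_mul_hauptmodul : IsMonic (1 - 5 * hauptmodul) :=
  isMonic_one_sub (by simpa using (vanishesTo_natCast 5).mul vanishesTo_hauptmodul)

theorem isMonic_phiQuot : IsMonic phiQuot := by
  have h3 : dilate 2 two_pos eulerQuot =
      dilate 2 two_pos euler / (qvar ^ 2 * sig (sig (dilate 2 two_pos euler))) := by
    rw [eulerQuot, map_div₀, map_mul, dilate_qvar, dilate_two_sig, dilate_two_sig]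
    rfl
  have h4 : phiQuot = (euler / sig (sig euler)) ^ 2 /
      (dilate 2 two_pos euler / sig (sig (dilate 2 two_pos euler))) := by
    rw [phiQuot, h3, eulerQuot, div_pow, mul_pow, div_pow, div_div_eq_mul_div, div_div_eq_mul_div]
    have hq := pow_ne_zero 2 qvar_ne_zero
    rw [div_mul_eq_mul_div, div_mul_eq_mul_div, mul_left_comm, mul_div_mul_left _ _ hq]
  rw [h4]
  exact ((isMonic_euler.div isMonic_euler.sig.sig).pow 2).div
    ((isMonic_euler.dilate two_pos).div (isMonic_euler.dilate two_pos).sig.sig)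

theorem VanishesTo.W {N : ℤ} {f : ℚ⸨X⸩} (hf : VanishesTo (5 * N) f) : VanishesTo N (W f) := by
  refine VanishesTo.U ?_
  have := isMonic_phiQuot.vanishesTo.mul hf
  rwa [zero_add] at this

end Truncation

end ElongatedDiamond

/-! ### Integer polynomials with 5-adic lower bounds on their coefficients. -/

namespace ElongatedDiamond

open Polynomial

section Bounds

/-- The integer polynomials whose `r`-th coefficient is divisible by `5 ^ e r`. -/
def divisibleBy (e : ℕ → ℕ) : AddSubgroup ℤ[X] where
  carrier := {p | ∀ r, (5 : ℤ) ^ e r ∣ p.coeff r}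
  zero_mem' r := by simp
  add_mem' hp hq r := by rw [coeff_add]; exact dvd_add (hp r) (hq r)
  neg_mem' hp r := by rw [coeff_neg]; exact (hp r).neg_right

/-- The least natural number `v` with `10 v ≥ w r - d`. -/
def slope (w d : ℤ) (r : ℕ) : ℕ := ((w * r - d + 9) / 10).toNat

theorem slope_add_le (w d d' : ℤ) (r s : ℕ) :
    slope w (d + d') (r + s) ≤ slope w d r + slope w d' s := by
  unfold slope
  push_cast
  rw [mul_add]
  generalize w * (r : ℤ) = a
  generalize w * (s : ℤ) = b
  omega

theorem slope_anti (w : ℤ) {d d' : ℤ} (h : d ≤ d') (r : ℕ) : slope w d' r ≤ slope w d r := by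
  unfold slope
  generalize w * (r : ℤ) = a
  omega

theorem divisibleBy_mono {e e' : ℕ → ℕ} (h : ∀ r, e' r ≤ e r) {p : ℤ[X]}
    (hp : p ∈ divisibleBy e) : p ∈ divisibleBy e' := fun r => (pow_dvd_pow 5 (h r)).trans (hp r)

theorem mul_mem_divisibleBy {e e' e'' : ℕ → ℕ} (h : ∀ r s, e'' (r + s) ≤ e r + e' s) {p q : ℤ[X]}
    (hp : p ∈ divisibleBy e) (hq : q ∈ divisibleBy e') : p * q ∈ divisibleBy e'' := fun n => by
  rw [coeff_mul]
  refine Finset.dvd_sum fun rs hrs => ?_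
  rw [Finset.HasAntidiagonal.mem_antidiagonal] at hrs
  rw [← hrs]
  refine (pow_dvd_pow 5 (h rs.1 rs.2)).trans ?_
  rw [pow_add]
  exact mul_dvd_mul (hp _) (hq _)

theorem slope_mul_mem {w d d' : ℤ} {p q : ℤ[X]} (hp : p ∈ divisibleBy (slope w d))
    (hq : q ∈ divisibleBy (slope w d')) : p * q ∈ divisibleBy (slope w (d + d')) :=
  mul_mem_divisibleBy (slope_add_le w d d') hp hq

theorem slope_mono_mem {w d d' : ℤ} (h : d ≤ d') {p : ℤ[X]} (hp : p ∈ divisibleBy (slope w d)) :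
    p ∈ divisibleBy (slope w d') := divisibleBy_mono (slope_anti w h) hp

theorem C_mul_X_pow_mem {e : ℕ → ℕ} {a : ℤ} {n : ℕ} (h : (5 : ℤ) ^ e n ∣ a) :
    C a * X ^ n ∈ divisibleBy e := fun r => by
  rw [coeff_C_mul_X_pow]
  split_ifs with hr
  · rwa [hr]
  · exact dvd_zero _

end Bounds

/-! ### The recurrences for U(xⁿ) and W(xⁿ) and their 5-adic bounds. -/

section Recurrence

/-- The nontrivial coefficients of the modular equation. -/
noncomputable def modCoeff : Fin 4 → ℤ[X] :=
  ![C (-10) * X ^ 0 + C 5 * X ^ 1, C 35 * X ^ 0 + C (-50) * X ^ 1 + C 25 * X ^ 2,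
    C (-60) * X ^ 0 + C 175 * X ^ 1 + C (-250) * X ^ 2 + C 125 * X ^ 3,
    C 55 * X ^ 0 + C (-300) * X ^ 1 + C 875 * X ^ 2 + C (-1250) * X ^ 3 + C 625 * X ^ 4]

/-- The coefficients of the cofactor of `1 - σ x` in `(1 - x) ^ 5`. -/
noncomputable def cofCoeff : Fin 4 → ℤ[X] :=
  ![C (-5) * X ^ 0 + C 5 * X ^ 1, C 10 * X ^ 0 + C (-25) * X ^ 1 + C 25 * X ^ 2,
    C (-10) * X ^ 0 + C 50 * X ^ 1 + C (-125) * X ^ 2 + C 125 * X ^ 3,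
    C 5 * X ^ 0 + C (-50) * X ^ 1 + C 250 * X ^ 2 + C (-625) * X ^ 3 + C 625 * X ^ 4]

/-- The coefficient of degree k is divisible by 5^⌈(k+1)/2⌉; the negative offset is the gain that
drives the induction. -/
theorem modCoeff_mem (i : Fin 4) : modCoeff i ∈ divisibleBy (slope 5 (-5)) := by
  fin_cases i <;> simp only [modCoeff] <;>
  repeat' first
    | apply AddSubgroup.add_mem
    | (apply C_mul_X_pow_mem; decide)

theorem cofCoeff_mem (i : Fin 4) : cofCoeff i ∈ divisibleBy (slope 5 (-5)) := by
  fin_cases i <;> simp only [cofCoeff] <;>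
  repeat' first
    | apply AddSubgroup.add_mem
    | (apply C_mul_X_pow_mem; decide)

/-- The solution of the recurrence with given initial values. -/
noncomputable def modularSeq (i : Fin 5 → ℤ[X]) : ℕ → ℤ[X]
  | 0 => i 0
  | 1 => i 1
  | 2 => i 2
  | 3 => i 3
  | 4 => i 4
  | n + 5 => X * (modularSeq i n + modCoeff 0 * modularSeq i (n + 1) +
      modCoeff 1 * modularSeq i (n + 2) + modCoeff 2 * modularSeq i (n + 3) +
      modCoeff 3 * modularSeq i (n + 4))

theorem X_mem : X ∈ divisibleBy (slope 5 5) := by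
  have : (X : ℤ[X]) = C 1 * X ^ 1 := by simp
  rw [this]
  apply C_mul_X_pow_mem
  decide

/-- The quotient of `modularSeq i (n + 5)` by `X`. -/
noncomputable def modularQuot (i : Fin 5 → ℤ[X]) (n : ℕ) : ℤ[X] :=
  modularSeq i n + modCoeff 0 * modularSeq i (n + 1) + modCoeff 1 * modularSeq i (n + 2) +
    modCoeff 2 * modularSeq i (n + 3) + modCoeff 3 * modularSeq i (n + 4)

theorem modularSeq_add_five (i : Fin 5 → ℤ[X]) (n : ℕ) :
    modularSeq i (n + 5) = X * modularQuot i n := by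
  rw [modularSeq, modularQuot]

theorem modularQuot_mem {i : Fin 5 → ℤ[X]} {d : ℤ} {n : ℕ}
    (h : ∀ j : ℕ, j < 5 → modularSeq i (n + j) ∈ divisibleBy (slope 5 (d + (n + j : ℕ)))) :
    modularQuot i n ∈ divisibleBy (slope 5 (d + (n : ℕ))) := by
  have key : ∀ (k : Fin 4) (j : ℕ), j < 5 →
      modCoeff k * modularSeq i (n + j) ∈ divisibleBy (slope 5 (d + (n : ℕ))) := fun k j hj =>
    slope_mono_mem (by push_cast; omega) (slope_mul_mem (modCoeff_mem k) (h j hj))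
  have h0 := h 0 (by norm_num)
  rw [add_zero] at h0
  exact add_mem (add_mem (add_mem (add_mem h0 (key 0 1 (by norm_num))) (key 1 2 (by norm_num)))
    (key 2 3 (by norm_num))) (key 3 4 (by norm_num))

/-- The offset may grow by 1 per index. The factor X costs 5, which the shift from n to n + 5 pays
for; at the later indices the coefficients of the modular equation give 5 back. -/
theorem modularSeq_mem {i : Fin 5 → ℤ[X]} {d : ℤ}
    (h : ∀ j : Fin 5, i j ∈ divisibleBy (slope 5 (d + (j : ℕ)))) (n : ℕ) :
    modularSeq i n ∈ divisibleBy (slope 5 (d + (n : ℕ))) := by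
  induction n using Nat.strong_induction_on with
  | _ n ih =>
    match n with
    | 0 => exact h 0
    | 1 => exact h 1
    | 2 => exact h 2
    | 3 => exact h 3
    | 4 => exact h 4
    | n + 5 =>
      rw [modularSeq_add_five]
      have := slope_mul_mem X_mem (modularQuot_mem (d := d) (n := n)
        fun j hj => ih (n + j) (by omega))
      exact slope_mono_mem (by push_cast; omega) this

/-- The combination that appears when a power `(1 - x) ^ 5` is split off. -/
noncomputable def cofSum (p : ℕ → ℤ[X]) (n : ℕ) : ℤ[X] :=
  p n + cofCoeff 0 * p (n + 1) + cofCoeff 1 * p (n + 2) + cofCoeff 2 * p (n + 3) +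
    cofCoeff 3 * p (n + 4)

theorem cofSum_mem {p : ℕ → ℤ[X]} {d : ℤ} (h : ∀ n : ℕ, p n ∈ divisibleBy (slope 5 (d + (n : ℕ))))
    (n : ℕ) : cofSum p n ∈ divisibleBy (slope 5 (d + (n : ℕ))) := by
  have key : ∀ (k : Fin 4) (j : ℕ), j < 5 →
      cofCoeff k * p (n + j) ∈ divisibleBy (slope 5 (d + n)) := fun k j hj =>
    slope_mono_mem (by push_cast; omega) (slope_mul_mem (cofCoeff_mem k) (h (n + j)))
  exact add_mem (add_mem (add_mem (add_mem (h n) (key 0 1 (by norm_num)))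
    (key 1 2 (by norm_num))) (key 2 3 (by norm_num))) (key 3 4 (by norm_num))

/-- The initial values for the sequence of images under `U`. -/
noncomputable def initU : Fin 5 → ℤ[X] :=
  ![C 126 * X ^ 0 + C (-125) * X ^ 4, C 26 * X ^ 0 + C (-25) * X ^ 3,
    C 6 * X ^ 0 + C (-5) * X ^ 2, C 2 * X ^ 0 + C (-1) * X ^ 1, C 1 * X ^ 0]

/-- The initial values for the sequence of images under `W`. -/
noncomputable def initW : Fin 5 → ℤ[X] :=
  ![C (-60) * X ^ 1 + C 600 * X ^ 2 + C (-1500) * X ^ 3 + C 625 * X ^ 4,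
    C (-4) * X ^ 0 + C 30 * X ^ 1 + C (-125) * X ^ 3,
    C (-2) * X ^ 0 + C 20 * X ^ 1 + C (-25) * X ^ 2, C 5 * X ^ 1, C 1 * X ^ 0]

theorem initU_mem (j : Fin 5) : initU j ∈ divisibleBy (slope 5 (6 + (j : ℕ))) := by
  fin_cases j <;> simp only [initU] <;>
  repeat' first
    | apply AddSubgroup.add_mem
    | (apply C_mul_X_pow_mem; decide)

/-- The constant term -4 at index 1 allows no offset below -1. -/
theorem initW_mem (j : Fin 5) : initW j ∈ divisibleBy (slope 5 (-1 + (j : ℕ))) := by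
  fin_cases j <;> simp only [initW] <;>
  repeat' first
    | apply AddSubgroup.add_mem
    | (apply C_mul_X_pow_mem; decide)

theorem modularQuot_initU_mem (n : ℕ) :
    modularQuot initU n ∈ divisibleBy (slope 5 (6 + (n : ℕ))) :=
  modularQuot_mem fun j _ => modularSeq_mem initU_mem (n + j)

theorem modularQuot_initW_mem (n : ℕ) :
    modularQuot initW n ∈ divisibleBy (slope 5 (-1 + (n : ℕ))) :=
  modularQuot_mem fun j _ => modularSeq_mem initW_mem (n + j)

/-- The polynomials giving `U (x ^ (r + 2) (1 - x) ^ 6)`. -/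
noncomputable def stepU (r : ℕ) : ℤ[X] :=
  cofSum (modularQuot initU) (r + 1) - cofSum (modularQuot initU) (r + 2)

/-- The polynomials giving `W (x ^ (r + 2) (1 - x) ^ 6)`. -/
noncomputable def stepW (r : ℕ) : ℤ[X] :=
  cofSum (modularQuot initW) (r + 1) - cofSum (modularQuot initW) (r + 2)

theorem stepU_mem (r : ℕ) : stepU r ∈ divisibleBy (slope 5 (8 + (r : ℕ))) :=
  sub_mem (slope_mono_mem (by push_cast; omega) (cofSum_mem modularQuot_initU_mem (r + 1)))
    (slope_mono_mem (by push_cast; omega) (cofSum_mem modularQuot_initU_mem (r + 2)))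

theorem stepW_mem (r : ℕ) : stepW r ∈ divisibleBy (slope 5 (1 + (r : ℕ))) :=
  sub_mem (slope_mono_mem (by push_cast; omega) (cofSum_mem modularQuot_initW_mem (r + 1)))
    (slope_mono_mem (by push_cast; omega) (cofSum_mem modularQuot_initW_mem (r + 2)))

theorem exists_modCoeff_eq (i : Fin 4) : ∃ r, modCoeff i = 5 * r := by
  fin_cases i
  · exact ⟨-2 + X, by simp [modCoeff, map_ofNat]; ring⟩
  · exact ⟨7 - 10 * X + 5 * X ^ 2, by simp [modCoeff, map_ofNat]; ring⟩
  · exact ⟨-12 + 35 * X - 50 * X ^ 2 + 25 * X ^ 3, by simp [modCoeff, map_ofNat]; ring⟩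
  · exact ⟨11 - 60 * X + 175 * X ^ 2 - 250 * X ^ 3 + 125 * X ^ 4,
      by simp [modCoeff, map_ofNat]; ring⟩

theorem exists_cofCoeff_eq (i : Fin 4) : ∃ r, cofCoeff i = 5 * r := by
  fin_cases i
  · exact ⟨-1 + X, by simp [cofCoeff, map_ofNat]; ring⟩
  · exact ⟨2 - 5 * X + 5 * X ^ 2, by simp [cofCoeff, map_ofNat]; ring⟩
  · exact ⟨-2 + 10 * X - 25 * X ^ 2 + 25 * X ^ 3, by simp [cofCoeff, map_ofNat]; ring⟩
  · exact ⟨1 - 10 * X + 50 * X ^ 2 - 125 * X ^ 3 + 125 * X ^ 4,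
      by simp [cofCoeff, map_ofNat]; ring⟩

theorem exists_modularQuot_eq (i : Fin 5 → ℤ[X]) (n : ℕ) :
    ∃ r, modularQuot i n = modularSeq i n + 5 * r := by
  obtain ⟨r0, h0⟩ := exists_modCoeff_eq 0
  obtain ⟨r1, h1⟩ := exists_modCoeff_eq 1
  obtain ⟨r2, h2⟩ := exists_modCoeff_eq 2
  obtain ⟨r3, h3⟩ := exists_modCoeff_eq 3
  refine ⟨r0 * modularSeq i (n + 1) + r1 * modularSeq i (n + 2) + r2 * modularSeq i (n + 3) +
    r3 * modularSeq i (n + 4), ?_⟩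
  rw [modularQuot, h0, h1, h2, h3]
  ring

theorem exists_cofSum_eq (p : ℕ → ℤ[X]) (n : ℕ) : ∃ r, cofSum p n = p n + 5 * r := by
  obtain ⟨r0, h0⟩ := exists_cofCoeff_eq 0
  obtain ⟨r1, h1⟩ := exists_cofCoeff_eq 1
  obtain ⟨r2, h2⟩ := exists_cofCoeff_eq 2
  obtain ⟨r3, h3⟩ := exists_cofCoeff_eq 3
  refine ⟨r0 * p (n + 1) + r1 * p (n + 2) + r2 * p (n + 3) + r3 * p (n + 4), ?_⟩
  rw [cofSum, h0, h1, h2, h3]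
  ring

/-- Modulo 5 all coefficients `modCoeff` and `cofCoeff` vanish, leaving the difference of two
initial values, 26 - 6 ≡ 0. -/
theorem five_dvd_coeff_stepU_zero (k : ℕ) : (5 : ℤ) ∣ (stepU 0).coeff k := by
  obtain ⟨r1, h1⟩ := exists_cofSum_eq (modularQuot initU) 1
  obtain ⟨r2, h2⟩ := exists_cofSum_eq (modularQuot initU) 2
  obtain ⟨r3, h3⟩ := exists_modularQuot_eq initU 1
  obtain ⟨r4, h4⟩ := exists_modularQuot_eq initU 2
  have e1 : modularSeq initU 1 = 26 - 25 * X ^ 3 := by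
    simp [modularSeq, initU, map_ofNat, sub_eq_add_neg]
  have e2 : modularSeq initU 2 = 6 - 5 * X ^ 2 := by
    simp [modularSeq, initU, map_ofNat, sub_eq_add_neg]
  have h : stepU 0 = C 5 * (4 - 5 * X ^ 3 + X ^ 2 + r1 - r2 + r3 - r4) := by
    have h5 : (C 5 : ℤ[X]) = 5 := map_ofNat C 5
    rw [stepU, zero_add, zero_add, h1, h2, h3, h4, e1, e2, h5]
    ring
  rw [h, coeff_C_mul]
  exact dvd_mul_right _ _

/-- The general bound gives only one factor 5 here. Replacing each later `modularQuot` by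
`modularSeq` costs a multiple of 5, which `cofCoeff` turns into a multiple of 25, so an explicit
computation modulo 25 suffices. -/
theorem twentyfive_dvd_coeff_cofSum_initW :
    (25 : ℤ) ∣ (cofSum (modularQuot initW) 0).coeff 1 := by
  obtain ⟨r1, h1⟩ := exists_modularQuot_eq initW 1
  obtain ⟨r2, h2⟩ := exists_modularQuot_eq initW 2
  obtain ⟨r3, h3⟩ := exists_modularQuot_eq initW 3
  obtain ⟨r4, h4⟩ := exists_modularQuot_eq initW 4
  have e0 : modularSeq initW 0 = -60 * X + 600 * X ^ 2 - 1500 * X ^ 3 + 625 * X ^ 4 := by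
    simp [modularSeq, initW, map_ofNat, sub_eq_add_neg]
  have e1 : modularSeq initW 1 = -4 + 30 * X - 125 * X ^ 3 := by
    simp [modularSeq, initW, map_ofNat, sub_eq_add_neg]
  have e2 : modularSeq initW 2 = -2 + 20 * X - 25 * X ^ 2 := by
    simp [modularSeq, initW, map_ofNat, sub_eq_add_neg]
  have e3 : modularSeq initW 3 = 5 * X := by
    simp [modularSeq, initW, map_ofNat]
  have e4 : modularSeq initW 4 = 1 := by
    simp [modularSeq, initW]
  have c0 : cofCoeff 0 = -5 + 5 * X := by simp [cofCoeff, map_ofNat]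
  have c1 : cofCoeff 1 = 10 - 25 * X + 25 * X ^ 2 := by
    simp [cofCoeff, map_ofNat, sub_eq_add_neg]
  have c2 : cofCoeff 2 = -10 + 50 * X - 125 * X ^ 2 + 125 * X ^ 3 := by
    simp [cofCoeff, map_ofNat, sub_eq_add_neg]
  have c3 : cofCoeff 3 = 5 - 50 * X + 250 * X ^ 2 - 625 * X ^ 3 + 625 * X ^ 4 := by
    simp [cofCoeff, map_ofNat, sub_eq_add_neg]
  have m0 : modCoeff 0 = -10 + 5 * X := by simp [modCoeff, map_ofNat]
  have m1 : modCoeff 1 = 35 - 50 * X + 25 * X ^ 2 := by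
    simp [modCoeff, map_ofNat, sub_eq_add_neg]
  have m2 : modCoeff 2 = -60 + 175 * X - 250 * X ^ 2 + 125 * X ^ 3 := by
    simp [modCoeff, map_ofNat, sub_eq_add_neg]
  have m3 : modCoeff 3 = 55 - 300 * X + 875 * X ^ 2 - 1250 * X ^ 3 + 625 * X ^ 4 := by
    simp [modCoeff, map_ofNat, sub_eq_add_neg]
  have h0 : modularQuot initW 0 = 25 - 180 * X + 575 * X ^ 2 - 1000 * X ^ 3 + 625 * X ^ 4 := by
    rw [modularQuot, e0, e1, e2, e3, e4, m0, m1, m2, m3]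
    ring
  -- The shape isolates the linear coefficient: the constant and the multiple of X² do not
  -- contribute to it.
  have h : ∃ a g s, cofSum (modularQuot initW) 0 = C a + X ^ 2 * g + C 25 * (s : ℤ[X]) := by
    refine ⟨5, 575 - 1000 * X + 625 * X ^ 2 - 50 + 250 - 625 * X + 625 * X ^ 2,
      -7 * X + (-1 + X) * (-1 + 6 * X - 25 * X ^ 3 + r1) +
      (2 - 5 * X + 5 * X ^ 2) * (4 * X - 5 * X ^ 2 + r2) +
      (-2 + 10 * X - 25 * X ^ 2 + 25 * X ^ 3) * (X + r3) +
      (1 - 10 * X + 50 * X ^ 2 - 125 * X ^ 3 + 125 * X ^ 4) * r4, ?_⟩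
    have h5 : (C 5 : ℤ[X]) = 5 := map_ofNat C 5
    have h25 : (C 25 : ℤ[X]) = 25 := map_ofNat C 25
    rw [cofSum, h0, h1, h2, h3, h4, e1, e2, e3, e4, c0, c1, c2, c3, h5, h25]
    ring
  obtain ⟨a, g, s, h⟩ := h
  rw [h, coeff_add, coeff_add, coeff_C_mul, coeff_C_of_ne_zero one_ne_zero, coeff_X_pow_mul']
  simp

end Recurrence

end ElongatedDiamond

/-! ### Limits of polynomials in x and the operators that preserve them. -/

namespace ElongatedDiamond

open Polynomial
open scoped LaurentSeries

section Closure

/-- Evaluation of integer polynomials at the Hauptmodul. -/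
noncomputable def evalH : ℤ[X] →+* ℚ⸨X⸩ := eval₂RingHom (Int.castRingHom ℚ⸨X⸩) hauptmodul

theorem evalH_X : evalH X = hauptmodul := eval₂_X _ _

theorem evalH_C (a : ℤ) : evalH (C a) = a := eval₂_C _ _

theorem vanishesTo_evalH (p : ℤ[X]) : VanishesTo 0 (evalH p) := by
  induction p using Polynomial.induction_on' with
  | add p q hp hq => rw [map_add]; exact hp.add hq
  | monomial n a =>
    rw [← C_mul_X_pow_eq_monomial, map_mul, map_pow, evalH_C, evalH_X]
    have := (vanishesTo_intCast a).mul ((vanishesTo_hauptmodul.mono (M := 0) (by norm_num)).pow n)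
    simpa using this

/-- The Laurent series that are limits of values at the Hauptmodul of polynomials with
coefficients divisible by prescribed powers of five. -/
def IsLimit (e : ℕ → ℕ) (f : ℚ⸨X⸩) : Prop :=
  ∀ N : ℕ, ∃ p ∈ divisibleBy e, VanishesTo N (f - evalH p)

theorem isLimit_one {e : ℕ → ℕ} (h : e 0 = 0) : IsLimit e 1 := fun N => by
  refine ⟨1, ?_, ⟨0, by simp⟩⟩
  have : (1 : ℤ[X]) = C 1 * X ^ 0 := by simp
  rw [this]
  exact C_mul_X_pow_mem (by simp [h])

/-- Division by `1 - 5 x`. -/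
theorem IsLimit.div_one_sub {e : ℕ → ℕ} (he : ∀ r, e (r + 1) ≤ e r + 1) {f : ℚ⸨X⸩}
    (hf : IsLimit e f) : IsLimit e (f / (1 - 5 * hauptmodul)) := fun N => by
  obtain ⟨p, hp, h⟩ := hf N
  have hz := isMonic_one_sub_five_mul_hauptmodul
  have hz0 : 1 - 5 * hauptmodul ≠ 0 := by
    obtain ⟨g, hg, h0⟩ := hz
    intro h1
    rw [h1] at h0
    have : g = 0 := HahnSeries.ofPowerSeries_injective (Γ := ℤ) (h0.symm.trans (map_zero _).symm)
    simp [this] at hg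
  -- Multiplying by 5x raises the degree by one and supplies one factor 5, all that `he` allows the
  -- bound to grow.
  have hstep : ∀ q ∈ divisibleBy e, C 5 * X * q ∈ divisibleBy e := fun q hq r => by
    rw [mul_assoc, coeff_C_mul]
    rcases r with _ | r
    · simp
    · rw [coeff_X_mul]
      refine (pow_dvd_pow 5 (he r)).trans ?_
      rw [pow_succ']
      exact mul_dvd_mul_left 5 (hq r)
  have hpow : ∀ i : ℕ, (C 5 * X) ^ i * p ∈ divisibleBy e := fun i => by
    induction i with
    | zero => simpa using hp
    | succ i ih => rw [pow_succ', mul_assoc]; exact hstep _ ih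
  refine ⟨∑ i ∈ Finset.range N, (C 5 * X) ^ i * p, sum_mem fun i _ => hpow i, ?_⟩
  have h5 : evalH (C 5 * X) = 5 * hauptmodul := by
    rw [map_mul, evalH_C, evalH_X]
    norm_num
  have hgeom := geom_sum_mul (5 * hauptmodul) N
  have key : f / (1 - 5 * hauptmodul) - evalH (∑ i ∈ Finset.range N, (C 5 * X) ^ i * p) =
      (f - evalH p + (5 * hauptmodul) ^ N * evalH p) * (1 - 5 * hauptmodul)⁻¹ := by
    rw [← Finset.sum_mul, map_mul, map_sum]
    simp only [map_pow, h5]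
    generalize 5 * hauptmodul = t at *
    generalize ∑ i ∈ Finset.range N, t ^ i = S at *
    field_simp
    linear_combination evalH p * hgeom
  rw [key]
  have h5x : VanishesTo 1 (5 * hauptmodul) := by
    simpa using (vanishesTo_natCast 5).mul vanishesTo_hauptmodul
  have hA := (h.add (((h5x.pow N).mul (vanishesTo_evalH p)).mono (M := N) (by simp))).mul
    hz.inv.vanishesTo
  rwa [add_zero] at hA

theorem IsLimit.div_one_sub_pow {e : ℕ → ℕ} (he : ∀ r, e (r + 1) ≤ e r + 1) {f : ℚ⸨X⸩}
    (hf : IsLimit e f) (n : ℕ) : IsLimit e (f / (1 - 5 * hauptmodul) ^ n) := by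
  induction n with
  | zero => simpa using hf
  | succ n ih => rw [pow_succ, ← div_div]; exact ih.div_one_sub he

theorem IsLimit.div_five {e : ℕ → ℕ} {f : ℚ⸨X⸩} (hf : IsLimit (fun r => e r + 1) f) :
    IsLimit e (f / 5) := fun N => by
  obtain ⟨p, hp, h⟩ := hf N
  obtain ⟨p, rfl⟩ : C 5 ∣ p := C_dvd_iff_dvd_coeff _ _ |>.mpr fun r =>
    (dvd_pow_self 5 (Nat.succ_ne_zero _)).trans (hp r)
  refine ⟨p, fun r => ?_, ?_⟩
  · have := hp r
    rw [coeff_C_mul, pow_succ'] at this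
    exact (mul_dvd_mul_iff_left (by norm_num)).mp this
  · have h5 : VanishesTo 0 ((5 : ℚ⸨X⸩)⁻¹) := ⟨PowerSeries.C (5 : ℚ)⁻¹, by
      rw [zpow_zero, one_mul, HahnSeries.ofPowerSeries_C]
      refine inv_eq_of_mul_eq_one_right ?_
      have : (5 : ℚ⸨X⸩) = HahnSeries.C (5 : ℚ) := (map_ofNat HahnSeries.C 5).symm
      rw [this, ← map_mul]
      norm_num⟩
    have := h.mul h5
    rw [add_zero] at this
    convert this using 1
    rw [map_mul, evalH_C]
    push_cast
    field_simp

/-- An operator with polynomial values on powers of the Hauptmodul preserves limits. -/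
theorem IsLimit.map {e e' : ℕ → ℕ} {L : ℚ⸨X⸩ →+ ℚ⸨X⸩}
    (hL : ∀ (N : ℤ) (f : ℚ⸨X⸩), VanishesTo (5 * N) f → VanishesTo N (L f)) {m m' : ℚ⸨X⸩}
    (hm : VanishesTo 0 m) (hm' : VanishesTo (-1) m'⁻¹) (hm0 : m' ≠ 0) {s : ℕ → ℤ[X]}
    (hs : ∀ r, L (m * hauptmodul ^ r) = m' * evalH (s r))
    (he : ∀ r k, (5 : ℤ) ^ e' k ∣ 5 ^ e r * (s r).coeff k) {f : ℚ⸨X⸩} (hf : IsLimit e f) :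
    IsLimit e' (L (m * f) / m') := fun N => by
  -- L divides the order of vanishing by 5, and the division by m' costs one more order.
  obtain ⟨p, hp, h⟩ := hf (5 * (N + 1))
  refine ⟨∑ r ∈ p.support, C (p.coeff r) * s r, sum_mem fun r _ k => ?_, ?_⟩
  · rw [coeff_C_mul]
    exact (he r k).trans (mul_dvd_mul_right (hp r) _)
  · have hLint : ∀ (a : ℤ) (g : ℚ⸨X⸩), L (a * g) = a * L g := fun a g => by
      rw [← zsmul_eq_mul, map_zsmul, zsmul_eq_mul]
    have hLp : L (m * evalH p) = m' * evalH (∑ r ∈ p.support, C (p.coeff r) * s r) := by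
      conv_lhs => rw [p.as_sum_support_C_mul_X_pow]
      simp only [map_sum, map_mul, map_pow, evalH_C, evalH_X, Finset.mul_sum]
      refine Finset.sum_congr rfl fun r _ => ?_
      rw [mul_left_comm, hLint, hs, mul_left_comm]
    have h1 : VanishesTo (N + 1) (L (m * f) - L (m * evalH p)) := by
      rw [← map_sub, ← mul_sub]
      refine hL _ _ ?_
      have := hm.mul h
      rw [zero_add] at this
      exact_mod_cast this
    have h2 := h1.mul hm'
    rw [add_neg_cancel_right, hLp, sub_mul, mul_right_comm, mul_inv_cancel₀ hm0, one_mul,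
      ← div_eq_mul_inv] at h2
    exact h2

end Closure

end ElongatedDiamond

/-! ### Images of powers of x under U and W. -/

namespace ElongatedDiamond

open Polynomial
open scoped LaurentSeries

section Images

theorem evalH_modCoeff : sig (evalH (modCoeff 0)) = -10 + 5 * sig hauptmodul ∧
    sig (evalH (modCoeff 1)) = 35 - 50 * sig hauptmodul + 25 * sig hauptmodul ^ 2 ∧
    sig (evalH (modCoeff 2)) =
      -60 + 175 * sig hauptmodul - 250 * sig hauptmodul ^ 2 + 125 * sig hauptmodul ^ 3 ∧
    sig (evalH (modCoeff 3)) = 55 - 300 * sig hauptmodul + 875 * sig hauptmodul ^ 2 -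
      1250 * sig hauptmodul ^ 3 + 625 * sig hauptmodul ^ 4 := by
  refine ⟨?_, ?_, ?_, ?_⟩ <;> simp [modCoeff, evalH_X, map_ofNat, sub_eq_add_neg]

theorem evalH_cofCoeff : sig (evalH (cofCoeff 0)) = -5 + 5 * sig hauptmodul ∧
    sig (evalH (cofCoeff 1)) = 10 - 25 * sig hauptmodul + 25 * sig hauptmodul ^ 2 ∧
    sig (evalH (cofCoeff 2)) =
      -10 + 50 * sig hauptmodul - 125 * sig hauptmodul ^ 2 + 125 * sig hauptmodul ^ 3 ∧
    sig (evalH (cofCoeff 3)) = 5 - 50 * sig hauptmodul + 250 * sig hauptmodul ^ 2 -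
      625 * sig hauptmodul ^ 3 + 625 * sig hauptmodul ^ 4 := by
  refine ⟨?_, ?_, ?_, ?_⟩ <;> simp [cofCoeff, evalH_X, map_ofNat, sub_eq_add_neg]

variable {L : ℚ⸨X⸩ →+ ℚ⸨X⸩}

/-- The modular equation multiplied by x^(n-4) becomes the recurrence, because L turns a factor σ(f)
into f; the five starting exponents are -4, …, 0. -/
theorem map_modularSeq (hL : ∀ f g, L (sig f * g) = f * L g) {i : Fin 5 → ℤ[X]}
    (hi : ∀ j : Fin 5, L (hauptmodul⁻¹ ^ (4 - (j : ℕ))) = evalH (i j)) (n : ℕ) :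
    L (hauptmodul⁻¹ ^ 4 * hauptmodul ^ n) = evalH (modularSeq i n) := by
  have hx := hauptmodul_ne_zero
  induction n using Nat.strong_induction_on with
  | _ n ih =>
    match n with
    | 0 => rw [pow_zero, mul_one]; exact hi 0
    | 1 => rw [show hauptmodul⁻¹ ^ 4 * hauptmodul ^ 1 = hauptmodul⁻¹ ^ 3 by field_simp]; exact hi 1
    | 2 => rw [show hauptmodul⁻¹ ^ 4 * hauptmodul ^ 2 = hauptmodul⁻¹ ^ 2 by field_simp]; exact hi 2
    | 3 => rw [show hauptmodul⁻¹ ^ 4 * hauptmodul ^ 3 = hauptmodul⁻¹ ^ 1 by field_simp]; exact hi 3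
    | 4 => rw [show hauptmodul⁻¹ ^ 4 * hauptmodul ^ 4 = hauptmodul⁻¹ ^ 0 by field_simp]; exact hi 4
    | n + 5 =>
      obtain ⟨h0, h1, h2, h3⟩ := evalH_modCoeff
      have key : hauptmodul⁻¹ ^ 4 * hauptmodul ^ (n + 5) = sig hauptmodul *
          (hauptmodul⁻¹ ^ 4 * hauptmodul ^ n +
          sig (evalH (modCoeff 0)) * (hauptmodul⁻¹ ^ 4 * hauptmodul ^ (n + 1)) +
          sig (evalH (modCoeff 1)) * (hauptmodul⁻¹ ^ 4 * hauptmodul ^ (n + 2)) +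
          sig (evalH (modCoeff 2)) * (hauptmodul⁻¹ ^ 4 * hauptmodul ^ (n + 3)) +
          sig (evalH (modCoeff 3)) * (hauptmodul⁻¹ ^ 4 * hauptmodul ^ (n + 4))) := by
        rw [h0, h1, h2, h3, pow_add _ n 5, modular_equation]
        ring
      rw [key, hL]
      simp only [map_add, hL]
      rw [ih n (by omega), ih (n + 1) (by omega), ih (n + 2) (by omega), ih (n + 3) (by omega),
        ih (n + 4) (by omega), modularSeq]
      simp only [map_add, map_mul, evalH_X]

theorem map_modularQuot (hL : ∀ f g, L (sig f * g) = f * L g) {i : Fin 5 → ℤ[X]}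
    (hi : ∀ j : Fin 5, L (hauptmodul⁻¹ ^ (4 - (j : ℕ))) = evalH (i j)) (n : ℕ) :
    L (hauptmodul ^ (n + 1)) = hauptmodul * evalH (modularQuot i n) := by
  have hx := hauptmodul_ne_zero
  have h := map_modularSeq hL hi (n + 5)
  rw [modularSeq_add_five, map_mul evalH, evalH_X] at h
  rw [← h]
  congr 1
  field_simp
  ring

/-- At σ(x) = 1 the modular equation reads (1 - x)⁵ = 0, so (1 - x)⁵ contains the factor 1 - σ(x).
-/
theorem one_sub_hauptmodul_pow_five : (1 - hauptmodul) ^ 5 = sig (1 - hauptmodul) *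
    (1 + sig (evalH (cofCoeff 0)) * hauptmodul + sig (evalH (cofCoeff 1)) * hauptmodul ^ 2 +
      sig (evalH (cofCoeff 2)) * hauptmodul ^ 3 + sig (evalH (cofCoeff 3)) * hauptmodul ^ 4) := by
  obtain ⟨h0, h1, h2, h3⟩ := evalH_cofCoeff
  rw [h0, h1, h2, h3, map_sub, map_one]
  linear_combination -modular_equation

/-- The factor σ(1 - x) leaves L as 1 - x: this is how the multipliers keep their factor (1 - x)x.
-/
theorem map_one_sub_pow_five (hL : ∀ f g, L (sig f * g) = f * L g) {p : ℕ → ℤ[X]}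
    (hp : ∀ n, L (hauptmodul ^ (n + 1)) = hauptmodul * evalH (p n)) (n : ℕ) :
    L ((1 - hauptmodul) ^ 5 * hauptmodul ^ (n + 1)) =
      (1 - hauptmodul) * hauptmodul * evalH (cofSum p n) := by
  have key : (1 - hauptmodul) ^ 5 * hauptmodul ^ (n + 1) = sig (1 - hauptmodul) *
      (hauptmodul ^ (n + 1) + sig (evalH (cofCoeff 0)) * hauptmodul ^ (n + 1 + 1) +
        sig (evalH (cofCoeff 1)) * hauptmodul ^ (n + 2 + 1) +
        sig (evalH (cofCoeff 2)) * hauptmodul ^ (n + 3 + 1) +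
        sig (evalH (cofCoeff 3)) * hauptmodul ^ (n + 4 + 1)) := by
    rw [one_sub_hauptmodul_pow_five]
    ring
  rw [key, hL]
  simp only [map_add L, hL, hp]
  rw [cofSum]
  simp only [map_add, map_mul]
  ring

theorem map_one_sub_pow_six (hL : ∀ f g, L (sig f * g) = f * L g) {p : ℕ → ℤ[X]}
    (hp : ∀ n, L (hauptmodul ^ (n + 1)) = hauptmodul * evalH (p n)) (n : ℕ) :
    L ((1 - hauptmodul) ^ 6 * hauptmodul ^ 2 * hauptmodul ^ n) =
      (1 - hauptmodul) * hauptmodul * evalH (cofSum p (n + 1) - cofSum p (n + 2)) := by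
  have key : (1 - hauptmodul) ^ 6 * hauptmodul ^ 2 * hauptmodul ^ n =
      (1 - hauptmodul) ^ 5 * hauptmodul ^ (n + 1 + 1) -
        (1 - hauptmodul) ^ 5 * hauptmodul ^ (n + 2 + 1) := by
    ring
  rw [key, map_sub, map_one_sub_pow_five hL hp, map_one_sub_pow_five hL hp, map_sub]
  ring

theorem U_hauptmodul_pow (n : ℕ) :
    U (hauptmodul ^ (n + 1)) = hauptmodul * evalH (modularQuot initU n) := by
  refine map_modularQuot U_sig_mul (fun j => ?_) n
  fin_cases j
  · refine U_inv_hauptmodul_pow_four.trans ?_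
    simp [initU, evalH_X, map_ofNat, sub_eq_add_neg]
  · refine U_inv_hauptmodul_pow_three.trans ?_
    simp [initU, evalH_X, map_ofNat, sub_eq_add_neg]
  · refine U_inv_hauptmodul_pow_two.trans ?_
    simp [initU, evalH_X, map_ofNat, sub_eq_add_neg]
  · refine U_inv_hauptmodul_pow_one.trans ?_
    simp [initU, evalH_X, map_ofNat, sub_eq_add_neg]
  · refine U_inv_hauptmodul_pow_zero.trans ?_
    simp [initU]

theorem W_hauptmodul_pow (n : ℕ) :
    W (hauptmodul ^ (n + 1)) = hauptmodul * evalH (modularQuot initW n) := by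
  refine map_modularQuot W_sig_mul (fun j => ?_) n
  fin_cases j
  · refine W_inv_hauptmodul_pow_four.trans ?_
    simp [initW, evalH_X, map_ofNat, sub_eq_add_neg]
  · refine W_inv_hauptmodul_pow_three.trans ?_
    simp [initW, evalH_X, map_ofNat, sub_eq_add_neg]
  · refine W_inv_hauptmodul_pow_two.trans ?_
    simp [initW, evalH_X, map_ofNat, sub_eq_add_neg]
  · refine W_inv_hauptmodul_pow_one.trans ?_
    simp [initW, evalH_X, map_ofNat]
  · refine W_inv_hauptmodul_pow_zero.trans ?_
    simp [initW]

end Images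

/-! ### The 5-adic induction on the multipliers. -/

section Operators

theorem pow_dvd_pow_mul {a b v : ℕ} {c : ℤ} (hc : (5 : ℤ) ^ v ∣ c) (h : a ≤ b + v) :
    (5 : ℤ) ^ a ∣ 5 ^ b * c :=
  (pow_dvd_pow 5 h).trans (by rw [pow_add]; exact mul_dvd_mul_left _ hc)

theorem kappa_eq : kappa =
    (1 - hauptmodul) ^ 5 * hauptmodul * (1 / (1 - 5 * hauptmodul) ^ 5) := by
  rw [kappa, mobius, div_pow, div_div_eq_mul_div]
  ring

theorem kappa_mul (f : ℚ⸨X⸩) : kappa * ((1 - hauptmodul) * hauptmodul * f) =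
    (1 - hauptmodul) ^ 6 * hauptmodul ^ 2 * (f / (1 - 5 * hauptmodul) ^ 5) := by
  rw [kappa_eq]
  ring

theorem slope_one_succ_le (d : ℤ) (r : ℕ) : slope 1 d (r + 1) ≤ slope 1 d r + 1 := by
  unfold slope
  omega

theorem vanishesTo_one_sub_hauptmodul_pow_mul (a b : ℕ) :
    VanishesTo 0 ((1 - hauptmodul) ^ a * hauptmodul ^ b) := by
  have := (isMonic_one_sub_hauptmodul.pow a).vanishesTo.mul
    ((vanishesTo_hauptmodul.mono (M := 0) (by norm_num)).pow b)
  simpa using this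

theorem vanishesTo_inv_one_sub_mul : VanishesTo (-1) ((1 - hauptmodul) * hauptmodul)⁻¹ := by
  rw [mul_inv]
  have := isMonic_one_sub_hauptmodul.inv.vanishesTo.mul vanishesTo_inv_hauptmodul
  rwa [zero_add] at this

theorem one_sub_mul_ne_zero : (1 - hauptmodul) * hauptmodul ≠ 0 :=
  mul_ne_zero one_sub_hauptmodul_ne_zero hauptmodul_ne_zero

theorem exists_U_kappa_mul {g : ℚ⸨X⸩} (hg : IsLimit (slope 1 0) g) :
    ∃ s, IsLimit (slope 1 3) s ∧ U (kappa * ((1 - hauptmodul) * hauptmodul * g)) =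
      5 * ((1 - hauptmodul) * hauptmodul * s) := by
  have h := IsLimit.map (e' := fun r => slope 1 3 r + 1) (L := U) (fun N f hf => hf.U)
    (vanishesTo_one_sub_hauptmodul_pow_mul 6 2) vanishesTo_inv_one_sub_mul one_sub_mul_ne_zero
    (s := stepU) (fun r => map_one_sub_pow_six U_sig_mul U_hauptmodul_pow r) (fun r k => ?_)
    (hg.div_one_sub_pow (slope_one_succ_le 0) 5)
  · refine ⟨_, h.div_five, ?_⟩
    rw [kappa_mul]
    have h0 := one_sub_mul_ne_zero
    generalize (1 - hauptmodul) * hauptmodul = m at *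
    field_simp
  -- Needed: ⌈(k-3)/10⌉ + 1 ≤ ⌈r/10⌉ + ⌈(5k-8-r)/10⌉, negative ceilings counting as 0. The extra
  -- divisibility of `stepU 0` covers r = 0, k < 4; at r = 0, k = 4 both sides equal 2.
  · rcases r with _ | r
    · rcases lt_or_ge k 4 with hk | hk
      · refine pow_dvd_pow_mul (v := 1) (by rw [pow_one]; exact five_dvd_coeff_stepU_zero k) ?_
        unfold slope
        omega
      · refine pow_dvd_pow_mul (stepU_mem 0 k) ?_
        unfold slope
        omega
    · refine pow_dvd_pow_mul (stepU_mem (r + 1) k) ?_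
      unfold slope
      omega

/-- The offset 3 is critical: for k = 1 the bound on `stepW r` supplies a factor 5 only up to r = 3,
and from r = 4 on the bound on s does. -/
theorem exists_W_kappa_mul {s : ℚ⸨X⸩} (hs : IsLimit (slope 1 3) s) :
    ∃ g, IsLimit (slope 1 0) g ∧ W (kappa * ((1 - hauptmodul) * hauptmodul * s)) =
      (1 - hauptmodul) * hauptmodul * g := by
  have h := IsLimit.map (e' := slope 1 0) (L := W) (fun N f hf => hf.W)
    (vanishesTo_one_sub_hauptmodul_pow_mul 6 2) vanishesTo_inv_one_sub_mul one_sub_mul_ne_zero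
    (s := stepW) (fun r => map_one_sub_pow_six W_sig_mul W_hauptmodul_pow r) (fun r k => ?_)
    (hs.div_one_sub_pow (slope_one_succ_le 3) 5)
  · refine ⟨_, h, ?_⟩
    rw [kappa_mul, mul_div_cancel₀ _ one_sub_mul_ne_zero]
  · refine pow_dvd_pow_mul (stepW_mem r k) ?_
    unfold slope
    omega

theorem exists_W_kappa : ∃ g, IsLimit (slope 1 0) g ∧
    W kappa = 5 * ((1 - hauptmodul) * hauptmodul * g) := by
  -- `slope 10 0 r` is r: the expansion of 1/(1 - 5x)⁵ has 5ʳ in degree r, and this sharper bound is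
  -- needed to gain a 5 here.
  have h := IsLimit.map (e := slope 10 0) (e' := fun r => slope 1 0 r + 1) (L := W)
    (m := (1 - hauptmodul) ^ 5 * hauptmodul ^ 1) (fun N f hf => hf.W)
    (vanishesTo_one_sub_hauptmodul_pow_mul 5 1) vanishesTo_inv_one_sub_mul one_sub_mul_ne_zero
    (s := cofSum (modularQuot initW))
    (fun r => by
      rw [mul_assoc, ← pow_add, add_comm 1 r]
      exact map_one_sub_pow_five W_sig_mul W_hauptmodul_pow r) (fun r k => ?_)
    ((isLimit_one (e := slope 10 0) rfl).div_one_sub_pow (fun r => by unfold slope; omega) 5)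
  · refine ⟨_, h.div_five, ?_⟩
    rw [kappa_eq, pow_one]
    have h0 := one_sub_mul_ne_zero
    generalize (1 - hauptmodul) * hauptmodul = m at *
    field_simp
  · have hm := cofSum_mem modularQuot_initW_mem r k
    -- The only pair where the general bound falls short: two factors 5 are needed and it gives one.
    by_cases hrk : r = 0 ∧ k = 1
    · obtain ⟨rfl, rfl⟩ := hrk
      exact pow_dvd_pow_mul (v := 2) (by norm_num; exact twentyfive_dvd_coeff_cofSum_initW)
        (by decide)
    · refine pow_dvd_pow_mul hm ?_
      unfold slope
      omega

/-- The multipliers of the generating function in the even dissections. -/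
noncomputable def evenMultiplier : ℕ → ℚ⸨X⸩
  | 0 => 1
  | a + 1 => U (kappa * W (kappa * evenMultiplier a))

/-- The first W-step and every U-step gain a 5. Later W-steps gain none and only pass from offset 3
back to offset 0. -/
theorem exists_evenMultiplier (a : ℕ) :
    (∃ g, IsLimit (slope 1 0) g ∧ W (kappa * evenMultiplier a) =
      5 ^ (a + 1) * ((1 - hauptmodul) * hauptmodul * g)) ∧
    ∃ s, IsLimit (slope 1 3) s ∧ evenMultiplier (a + 1) =
      5 ^ (a + 2) * ((1 - hauptmodul) * hauptmodul * s) := by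
  have hU : ∀ (n : ℕ) (f : ℚ⸨X⸩), U (5 ^ n * f) = 5 ^ n * U f := fun n f => by
    have := U_sig_mul (5 ^ n) f
    rwa [map_pow, map_ofNat] at this
  have hW : ∀ (n : ℕ) (f : ℚ⸨X⸩), W (5 ^ n * f) = 5 ^ n * W f := fun n f => by
    have := W_sig_mul (5 ^ n) f
    rwa [map_pow, map_ofNat] at this
  have step : ∀ a, (∃ g, IsLimit (slope 1 0) g ∧ W (kappa * evenMultiplier a) =
      5 ^ (a + 1) * ((1 - hauptmodul) * hauptmodul * g)) →
      ∃ s, IsLimit (slope 1 3) s ∧ evenMultiplier (a + 1) =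
      5 ^ (a + 2) * ((1 - hauptmodul) * hauptmodul * s) := by
    rintro a ⟨g, hg, h⟩
    obtain ⟨s, hs, h'⟩ := exists_U_kappa_mul hg
    refine ⟨s, hs, ?_⟩
    rw [evenMultiplier, h, mul_left_comm, hU, h']
    ring
  suffices h : ∃ g, IsLimit (slope 1 0) g ∧ W (kappa * evenMultiplier a) =
      5 ^ (a + 1) * ((1 - hauptmodul) * hauptmodul * g) from ⟨h, step a h⟩
  induction a with
  | zero =>
    obtain ⟨g, hg, h⟩ := exists_W_kappa
    exact ⟨g, hg, by rw [evenMultiplier, mul_one, h, zero_add, pow_one]⟩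
  | succ a ih =>
    obtain ⟨s, hs, h⟩ := step a ih
    obtain ⟨g, hg, h'⟩ := exists_W_kappa_mul hs
    refine ⟨g, hg, ?_⟩
    rw [h, mul_left_comm, hW, h']

end Operators

end ElongatedDiamond

/-! ### Integrality of coefficients and extraction of arithmetic progressions. -/

namespace ElongatedDiamond

open scoped LaurentSeries

section Integrality

/-- The power series with integer coefficients, inside the field of Laurent series. -/
noncomputable def integralSeries : Subring ℚ⸨X⸩ :=
  ((HahnSeries.ofPowerSeries ℤ ℚ).comp (PowerSeries.map (Int.castRingHom ℚ))).range

theorem exists_coeff_eq_intCast {f : ℚ⸨X⸩} (hf : f ∈ integralSeries) (n : ℤ) :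
    ∃ k : ℤ, f.coeff n = k := by
  obtain ⟨h, rfl⟩ := hf
  rw [RingHom.comp_apply, PowerSeries.coeff_coe]
  split_ifs
  · exact ⟨0, by simp⟩
  · exact ⟨_, PowerSeries.coeff_map _ _ _⟩

theorem qvar_mem_integralSeries : qvar ∈ integralSeries :=
  ⟨PowerSeries.X, by rw [RingHom.comp_apply, PowerSeries.map_X, coe_X]⟩

theorem sig_mem_integralSeries {f : ℚ⸨X⸩} (hf : f ∈ integralSeries) : sig f ∈ integralSeries := by
  obtain ⟨h, rfl⟩ := hf
  refine ⟨PowerSeries.expand 5 five_ne_zero' h, ?_⟩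
  rw [RingHom.comp_apply, RingHom.comp_apply, map_expand', coe_expand_five]

theorem gauss_mem_integralSeries : gauss ∈ integralSeries :=
  ⟨triangularSeries ℤ, by rw [RingHom.comp_apply, map_triangularSeries]; rfl⟩

theorem inv_gauss_mem_integralSeries : gauss⁻¹ ∈ integralSeries := by
  refine ⟨PowerSeries.invOfUnit (triangularSeries ℤ) 1, ?_⟩
  refine (inv_eq_of_mul_eq_one_right ?_).symm
  have h : triangularSeries ℤ * PowerSeries.invOfUnit (triangularSeries ℤ) 1 = 1 := by
    refine PowerSeries.mul_invOfUnit _ _ ?_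
    rw [← PowerSeries.coeff_zero_eq_constantCoeff_apply, triangularSeries, PowerSeries.coeff_mk,
      if_pos ⟨0, rfl⟩, Units.val_one]
  have h' := congrArg
    ((HahnSeries.ofPowerSeries ℤ ℚ).comp (PowerSeries.map (Int.castRingHom ℚ))) h
  rw [map_mul, map_one] at h'
  rw [← h']
  congr 1
  rw [RingHom.comp_apply, map_triangularSeries]
  rfl

theorem hauptmodul_mem_integralSeries : hauptmodul ∈ integralSeries := by
  rw [hauptmodul, div_eq_mul_inv]
  exact mul_mem qvar_mem_integralSeries
    (pow_mem (mul_mem (sig_mem_integralSeries gauss_mem_integralSeries)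
      inv_gauss_mem_integralSeries) 2)

theorem diamond_mem_integralSeries : diamond ∈ integralSeries := ⟨_, rfl⟩

theorem evalH_mem_integralSeries (p : Polynomial ℤ) : evalH p ∈ integralSeries := by
  induction p using Polynomial.induction_on' with
  | add p q hp hq => rw [map_add]; exact add_mem hp hq
  | monomial n a =>
    rw [← Polynomial.C_mul_X_pow_eq_monomial, map_mul, map_pow, evalH_C, evalH_X]
    exact mul_mem (intCast_mem _ a) (pow_mem hauptmodul_mem_integralSeries n)

theorem vanishesTo_of_mem_integralSeries {f : ℚ⸨X⸩} (hf : f ∈ integralSeries) :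
    VanishesTo 0 f := by
  obtain ⟨h, rfl⟩ := hf
  exact vanishesTo_coe _

/-- A given coefficient depends only on a close enough approximation, an integer polynomial in x.
The 5-adic bounds have done their work; only integrality is used from here on. -/
theorem IsLimit.exists_coeff_mul_eq_intCast {e : ℕ → ℕ} {f m : ℚ⸨X⸩} (hf : IsLimit e f)
    (hm : m ∈ integralSeries) (n : ℤ) : ∃ k : ℤ, (m * f).coeff n = k := by
  obtain ⟨p, -, h⟩ := hf (n.toNat + 1)
  obtain ⟨k, hk⟩ := exists_coeff_eq_intCast (mul_mem hm (evalH_mem_integralSeries p)) n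
  refine ⟨k, ?_⟩
  have h0 := (vanishesTo_of_mem_integralSeries hm).mul h
  have h1 := h0.coeff_eq_zero (n := n) (by push_cast; omega)
  rw [mul_sub, HahnSeries.coeff_sub, sub_eq_zero] at h1
  rw [h1, hk]

theorem coeff_diamond (n : ℕ) : diamond.coeff n = diamondCount 5 n := by
  rw [diamond, PowerSeries.coeff_coe, if_neg (by omega), Int.natAbs_natCast,
    PowerSeries.coeff_map]
  rfl

end Integrality

section Dissection

/-- In the functional equation the factors κ, φ stay inside U, while σ(κ) and σσ(D) leave it with
one σ removed. -/
theorem U_qvar_pow_six_mul (f : ℚ⸨X⸩) :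
    U (qvar ^ 6 * (f * diamond)) = kappa * W (kappa * f) * sig diamond := by
  have h : qvar ^ 6 * (f * diamond) = sig (kappa * sig diamond) * (phiQuot * (kappa * f)) := by
    rw [mul_left_comm, qvar_pow_six_mul_diamond, map_mul]
    ring
  rw [h, U_sig_mul, W_apply]
  ring

theorem four_dvd_pow_sub_one (a : ℕ) : (4 : ℤ) ∣ 25 ^ a - 1 := by
  have h := sub_dvd_pow_sub_pow (25 : ℤ) 1 a
  rw [one_pow] at h
  exact (by norm_num : (4 : ℤ) ∣ 25 - 1).trans h

/-- The factor q⁶ replaces n by 5n - 6, and 6·25ᵃ + (25ᵃ - 1)/4 = (25ᵃ⁺¹ - 1)/4. The following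
application of U replaces n by 5n. -/
theorem coeff_multiplier_mul_diamond (a : ℕ) :
    (∀ n : ℤ, (evenMultiplier a * diamond).coeff n =
      diamond.coeff (25 ^ a * n - (25 ^ a - 1) / 4)) ∧
    ∀ n : ℤ, (kappa * W (kappa * evenMultiplier a) * sig diamond).coeff n =
      diamond.coeff (5 * 25 ^ a * n - (25 ^ (a + 1) - 1) / 4) := by
  have hdvd := four_dvd_pow_sub_one
  have step : ∀ a : ℕ, (∀ n : ℤ, (evenMultiplier a * diamond).coeff n =
      diamond.coeff (25 ^ a * n - (25 ^ a - 1) / 4)) →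
      ∀ n : ℤ, (kappa * W (kappa * evenMultiplier a) * sig diamond).coeff n =
      diamond.coeff (5 * 25 ^ a * n - (25 ^ (a + 1) - 1) / 4) := fun a ha n => by
    rw [← U_qvar_pow_six_mul, coeff_U]
    have h6 : qvar ^ 6 = qvar ^ (6 : ℤ) := rfl
    rw [h6, coeff_qvar_zpow_mul, ha]
    congr 1
    have h1 := hdvd a
    have h2 := hdvd (a + 1)
    rw [pow_succ] at h2 ⊢
    have h3 : (25 : ℤ) ^ a * (5 * n - 6) = 5 * 25 ^ a * n - 6 * 25 ^ a := by ring
    rw [h3]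
    generalize (25 : ℤ) ^ a = b at *
    generalize 5 * b * n = t
    omega
  suffices h : ∀ n : ℤ, (evenMultiplier a * diamond).coeff n =
      diamond.coeff (25 ^ a * n - (25 ^ a - 1) / 4) from ⟨h, step a h⟩
  induction a with
  | zero => intro n; simp [evenMultiplier]
  | succ a ih =>
    intro n
    have h := step a ih (5 * n)
    rw [← coeff_U, U_mul_sig] at h
    rw [evenMultiplier, h]
    congr 1
    ring

theorem exists_coeff_eq (a : ℕ) (f : ℚ⸨X⸩) (e : ℕ → ℕ) (hf : IsLimit e f) (m g : ℚ⸨X⸩)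
    (hm : m ∈ integralSeries) (hg : g = 5 ^ a * (m * f)) (n : ℤ) :
    ∃ k : ℤ, g.coeff n = ((5 ^ a * k : ℤ) : ℚ) := by
  obtain ⟨k, hk⟩ := hf.exists_coeff_mul_eq_intCast hm n
  refine ⟨k, ?_⟩
  have h5 : (5 ^ a : ℚ⸨X⸩) = HahnSeries.C (5 ^ a : ℚ) := by rw [map_pow, map_ofNat]
  rw [hg, h5, HahnSeries.C_mul_eq_smul, HahnSeries.coeff_smul, hk, smul_eq_mul]
  push_cast
  rfl

theorem exists_coeff_evenMultiplier (a : ℕ) (n : ℤ) :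
    ∃ k : ℤ, (evenMultiplier (a + 1) * diamond).coeff n = ((5 ^ (a + 2) * k : ℤ) : ℚ) := by
  obtain ⟨s, hs, h⟩ := (exists_evenMultiplier a).2
  refine exists_coeff_eq (a + 2) s _ hs ((1 - hauptmodul) * hauptmodul * diamond) _
    (mul_mem (mul_mem (sub_mem (one_mem _) hauptmodul_mem_integralSeries)
      hauptmodul_mem_integralSeries) diamond_mem_integralSeries) ?_ n
  rw [h]
  ring

theorem exists_coeff_oddMultiplier (a : ℕ) (n : ℤ) :
    ∃ k : ℤ, (kappa * W (kappa * evenMultiplier a) * sig diamond).coeff n =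
      ((5 ^ (a + 1) * k : ℤ) : ℚ) := by
  obtain ⟨g, hg, h⟩ := (exists_evenMultiplier a).1
  refine exists_coeff_eq (a + 1) _ _ (hg.div_one_sub_pow (slope_one_succ_le 0) 5)
    ((1 - hauptmodul) ^ 6 * hauptmodul ^ 2 * sig diamond) _
    (mul_mem (mul_mem (pow_mem (sub_mem (one_mem _) hauptmodul_mem_integralSeries) 6)
      (pow_mem hauptmodul_mem_integralSeries 2))
      (sig_mem_integralSeries diamond_mem_integralSeries)) ?_ n
  rw [h, mul_left_comm, kappa_mul]
  ring

end Dissection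

end ElongatedDiamond

theorem theorem1p1 (n α : ℕ) (hn : 1 ≤ n) (hα : 1 ≤ α) (h : 4 * n ≡ 1 [MOD 5 ^ α]) :
    diamondCount 5 n ≡ 0 [ZMOD 5 ^ (α / 2 + 1)] := by
  rw [Int.modEq_zero_iff_dvd]
  have h4 : (5 : ℤ) ^ α ∣ 4 * n - 1 := by
    have := (Int.natCast_modEq_iff.mpr h).symm.dvd
    exact_mod_cast this
  have hdvd := ElongatedDiamond.four_dvd_pow_sub_one
  have hcop : IsCoprime ((5 : ℤ) ^ α) 4 := IsCoprime.pow_left (by norm_num)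
  -- Both n and -(25ᵃ - 1)/4 become 1 modulo 5^α after multiplication by 4, which is invertible
  -- there.
  have key : ∀ a : ℕ, (5 : ℤ) ^ α ∣ 25 ^ a → ∃ m : ℤ, (n : ℤ) = 5 ^ α * m - (25 ^ a - 1) / 4 := by
    intro a ha
    obtain ⟨m, hm⟩ : (5 : ℤ) ^ α ∣ n + (25 ^ a - 1) / 4 := by
      refine hcop.dvd_of_dvd_mul_left ?_
      rw [mul_add, Int.mul_ediv_cancel' (hdvd a)]
      have := dvd_add h4 ha
      convert this using 1
      ring
    exact ⟨m, by linarith⟩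
  obtain ⟨a, rfl | rfl⟩ : ∃ a, α = 2 * (a + 1) ∨ α = 2 * a + 1 := by
    rcases Nat.even_or_odd' α with ⟨b, hb | hb⟩
    -- The subtraction is harmless: α ≥ 1 forces b ≥ 1.
    · exact ⟨b - 1, Or.inl (by omega)⟩
    · exact ⟨b, Or.inr hb⟩
  · have h25 : (5 : ℤ) ^ (2 * (a + 1)) = 25 ^ (a + 1) := by rw [pow_mul]; norm_num
    obtain ⟨m, hm⟩ := key (a + 1) (by rw [h25])
    obtain ⟨k, hk⟩ := ElongatedDiamond.exists_coeff_evenMultiplier a m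
    rw [(ElongatedDiamond.coeff_multiplier_mul_diamond (a + 1)).1] at hk
    rw [h25] at hm
    rw [← hm,
      ElongatedDiamond.coeff_diamond] at hk
    have he : 2 * (a + 1) / 2 + 1 = a + 2 := by omega
    rw [he]
    exact ⟨k, by exact_mod_cast hk⟩
  · have h25 : (5 : ℤ) ^ (2 * a + 1) = 5 * 25 ^ a := by rw [pow_succ, pow_mul, mul_comm]; norm_num
    -- For odd α = 2a + 1 the shift in the progression is (25ᵃ⁺¹ - 1)/4, hence a + 1 rather than a.
    obtain ⟨m, hm⟩ := key (a + 1) (by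
      rw [h25, pow_succ, mul_comm]
      exact mul_dvd_mul_left _ (by norm_num))
    obtain ⟨k, hk⟩ := ElongatedDiamond.exists_coeff_oddMultiplier a m
    rw [(ElongatedDiamond.coeff_multiplier_mul_diamond a).2, ← h25, ← hm,
      ElongatedDiamond.coeff_diamond] at hk
    have he : (2 * a + 1) / 2 + 1 = a + 1 := by omega
    rw [he]
    exact ⟨k, by exact_mod_cast hk⟩
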